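/- **Model.** Let $c\in[0,1)$, $d\in(0,1]$ with $c+d\le 1$, let $\mathcal S'$ be a Polish space with metric $\rho'$, and let $\mathcal S=\mathcal S'\times[-1,1]\times\{0,1\}\times\mathbb N\times[0,1]^\infty$ be the space of full marks $\mathbf x=(\mathbf a,q,s,d^-,c_1,c_2,\dots)$, with $$\rho(\mathbf x,\tilde{\mathbf x})=\rho'(\mathbf a,\tilde{\mathbf a})+|q-\tilde q|+|s-\tilde s|+|d^--\tilde d^-|+\sum_{j\ge1}\big|c_j1(d^-\ge j)-\tilde c_j1(\tilde d^-\ge j)\big| .$$ A marked directed multigraph assigns to every vertex $i$ a full mark $\mathbf x_i\in\mathcal S$, whose weights are denoted $c(i,1),c(i,2),\dots$, and an enumeration $\ell(i,1),\dots,\ell(i,d_i^-)$ of its inbound neighbors (one edge $\ell(i,r)\to i$ for each $r$). Put $\Delta f(i)=\sum_{r=1}^{d_i^-}c(i,r)f(\ell(i,r))+(1-c-d)f(i)$. Opinions started from $\mathbf R^{(0)}$ evolve by $R_i^{(k+1)}=\Delta \mathbf R^{(k)}(i)+W_i^{(k)}$, $k\ge 0$. For every $n$ let $G_n$ be a random marked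 directed multigraph with vertex set $V_n=\{1,\dots,n\}$, full marks $\mathbf X_i$ and attributes $\mathscr A_n=\{(\mathbf A_i,Q_i,S_i):i\in V_n\}$ (the first three components of the marks), such that $\sum_{r\le D_i^-}C(i,r)=c$ whenever $D_i^->0$. Let $\nu(\mathbf x)$, $\mathbf x\in\mathcal S$, be the law of the signals of a vertex with mark $\mathbf x$; almost surely, for every $i\in V_n$, $\nu(\mathbf X_i)$ is carried by $\{|w|\le d+c-\sum_{r\le D_i^-}C(i,r)\}$. Assume that there is $K<\infty$ with $$d_1(\nu(\mathbf x),\nu(\tilde{\mathbf x}))\le K\rho(\mathbf x,\tilde{\mathbf x})\qquad\text{for all }\mathbf x,\tilde{\mathbf x}\in\mathcal S,$$ where $d_1(\mu,\mu')=\inf\{E|X-Y|: X\sim\mu,\,Y\sim\mu'\}$ is the Wasserstein-1 distance. **Strong coupling.** The in-component of depth $k$ of a vertex $i$ is the marked subgraph induced on the vertices from which there is a directed path of length at most $k$ to $i$. Let $\mathcal G$ be a random marked directed multigraph on a countable vertex set with root $\emptyset$ and marks $\boldsymbol{\mathcal X}_i$. For a coupling of $G_n$ and a vertex $i\in V_n$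 with a copy $\mathcal G_\emptyset$ of $\mathcal G$, let $\mathcal E_{i}^{(k,\epsilon)}$ be the event that there is an isomorphism $\theta$ from the in-component of depth $k$ of $\emptyset$ in $\mathcal G_\emptyset$ onto that of $i$ in $G_n$, respecting the enumeration of inbound edges, with $\theta(\emptyset)=i$ and $\rho(\mathbf X_{\theta(j)},\boldsymbol{\mathcal X}_j)\le\epsilon$ for all $j$ in the former. The sequence $(G_n)$ admits a strong coupling with $\mathcal G$ if for all $k$ and $\epsilon>0$: * for each $n$, with $I_n$ uniform on $V_n$ (independent of $G_n$), there is a coupling of $(G_n,I_n)$ with a copy of $\mathcal G$ such that $P(\mathcal E_{I_n}^{(k,\epsilon)}\mid\mathscr A_n)\to1$ in probability as $n\to\infty$; * for each $n$, with $I_n,J_n$ independent and uniform on $V_n$ (independent of $G_n$), there is a coupling of $(G_n,I_n,J_n)$ with two independent copies of $\mathcal G$ such that, in probability as $n\to\infty$, $$P\big(\mathcal E_{I_n}^{(k,\epsilon)}\cap\mathcal E_{J_n}^{(k,\epsilon)}\cap\{\text{the in-components of depth }k\text{ of }I_n\text{ and }J_n\text{ have no common vertex}\}\,\big|\,\mathscr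 A_n\big)\to1 .$$ **Theorem.** Suppose that $(G_n)$ admits a strong coupling with a random marked graph $\mathcal G$. Then there are a probability measure $\mu^*$ on $[-1,1]$ and a constant $C<\infty$ with the following properties. Below, $\mathcal R^*$ denotes a random variable with law $\mu^*$, and $I_n$ is uniform on $V_n$ and independent of the graph, the opinions and the signals. 1. *(Finite times.)* Let $\mathbf R^{(0)}\in[-1,1]^{V_n}$ be random initial opinions and let $\{W_i^{(k)}\}$ be signals which, conditionally on $(G_n,\mathbf R^{(0)})$, are independent with $W_i^{(k)}\sim\nu(\mathbf X_i)$. Assume that the initial opinions take part in the strong coupling: the graphs $G_n$ with $R_i^{(0)}$ appended to the generic attribute of each vertex $i$ (so that $\mathbb R$-valued initial opinions are compared as part of $\rho'$) admit a strong coupling, with conditioning still on $\mathscr A_n$, with some random marked graph $(\mathcal G',\boldsymbol{\mathcal R}^{(0)})$. Let $\mathcal R^{(r)}$ be the opinion at time $r$ of the root of $\mathcal G'$, started from $\boldsymbol{\mathcal R}^{(0)}$, with signals that are, given $(\mathcal G',\boldsymbol{\mathcal R}^{(0)})$, independent with $\mathcal W_i^{(k)}\sim\nu(\boldsymbol{\mathcal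 X}_i)$. Then $\mathcal R^{(r)}\in[-1,1]$ a.s., and for every $k\ge0$ there are, for each $n$, on an extension of the probability space of the opinions on $G_n$, the uniform vertex $I_n$ and a copy of $(\mathcal R^{(0)},\dots,\mathcal R^{(k)})$ that is independent of $\mathscr A_n$, such that, in probability as $n\to\infty$, $$\max_{0\le r\le k}E\big[|R_{I_n}^{(r)}-\mathcal R^{(r)}|\,\big|\,\mathscr A_n\big]\to0 .$$ Moreover, for every $k\ge0$ and every continuous $f:[-1,1]\to\mathbb R$, $\frac1n\sum_{i=1}^nf(R_i^{(k)})\to E[f(\mathcal R^{(k)})]$ in probability. Finally, $\mathcal R^{(k)}\Rightarrow\mathcal R^*$ as $k\to\infty$, at a geometric rate: $d_1(\mathrm{law}(\mathcal R^{(k)}),\mu^*)\le C(1-d)^k$ for all $k\ge0$. 2. *(Stationarity.)* Let $\mathbf R=(R_1,\dots,R_n)$ be random vectors whose conditional law given $G_n$ is a stationary distribution of the Markov chain $\{\mathbf R^{(k)}\}$ on $G_n$. Then for each $n$ there are, on an extension of the probability space, $I_n$ and a copy of $\mathcal R^*$ that is independent of $\mathscr A_n$, such that $E[|R_{I_n}-\mathcal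 R^*|\mid\mathscr A_n]\to0$ in probability. Moreover $\frac1n\sum_{i=1}^nf(R_i)\to E[f(\mathcal R^*)]$ in probability for every continuous $f:[-1,1]\to\mathbb R$. -/

import Mathlib

open MeasureTheory ProbabilityTheory Filter Topology
open scoped NNReal ENNReal

universe u v w

namespace OpinionDynamics

/-! ### Vertex marks and marked directed multigraphs -/

/-- Attribute vectors `(a, q, s)`: a generic attribute, the internal opinion in `[-1,1]` and a
label in `{0,1}`. -/
abbrev Attr (A : Type u) : Type u := A × Set.Icc (-1 : ℝ) 1 × Fin 2

/-- Full marks `(a, q, s, d⁻, c₁, c₂, …)`: attributes, in-degree and weights in `[0,1]`.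
Weights are numbered from `0`; those with number at least the in-degree carry no meaning and are
never looked at. -/
abbrev Mark (A : Type u) : Type u := Attr A × ℕ × (ℕ → unitInterval)

namespace Mark

variable {A : Type u}

/-- The attribute vector of a full mark. -/
def attr (x : Mark A) : Attr A := x.1

/-- The in-degree recorded in a full mark. -/
def deg (x : Mark A) : ℕ := x.2.1

/-- The truncated weight `c_r 1(r is below the in-degree)`. -/
def weight (x : Mark A) (r : ℕ) : ℝ := if r < x.deg then (x.2.2 r : ℝ) else 0

/-- The total weight given to the inbound neighbours. -/
def totalWeight (x : Mark A) : ℝ := ∑ r ∈ Finset.range x.deg, x.weight r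

/-- The distance `ρ` between full marks. All but finitely many terms of the series vanish. -/
noncomputable def rho [MetricSpace A] (x y : Mark A) : ℝ :=
  dist x.attr.1 y.attr.1 + |(x.attr.2.1 : ℝ) - (y.attr.2.1 : ℝ)|
    + |((x.attr.2.2 : ℕ) : ℝ) - ((y.attr.2.2 : ℕ) : ℝ)| + |(x.deg : ℝ) - (y.deg : ℝ)|
    + ∑' r, |x.weight r - y.weight r|

end Mark

/-- Vertex-marked directed multigraphs with vertex set `V`: every vertex carries its full mark and
the enumeration `ℓ(i,0), ℓ(i,1), …` of its inbound neighbours. There is one edge from `ℓ(i,r)` to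
`i` for each `r` below the in-degree recorded in the mark of `i`, with multiplicities and self-loops
allowed; the entries `ℓ(i,r)` with larger `r` carry no meaning and are never looked at. -/
abbrev MarkedGraph (V : Type w) (A : Type u) : Type (max u w) := V → Mark A × (ℕ → V)

namespace MarkedGraph

variable {V : Type w} {A : Type u}

instance [MeasurableSpace V] [MeasurableSpace A] : MeasurableSpace (MarkedGraph V A) :=
  MeasurableSpace.pi

/-- The full mark of a vertex. -/
def mark (g : MarkedGraph V A) (i : V) : Mark A := (g i).1

/-- `ℓ(i,r)`, the `r`-th inbound neighbour of `i`. -/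
def nbr (g : MarkedGraph V A) (i : V) (r : ℕ) : V := (g i).2 r

/-- The family of the attribute vectors of all vertices. -/
def attributes (g : MarkedGraph V A) : V → Attr A := fun i => (g.mark i).attr

/-- The graph in which the initial opinion `r0 i` is appended to the generic attribute of `i`. -/
def withInitial (g : MarkedGraph V A) (r0 : V → ℝ) : MarkedGraph V (A × ℝ) := fun i =>
  (((((g.mark i).attr.1, r0 i), (g.mark i).attr.2), (g.mark i).2), (g i).2)

/-- The vertices of the in-component of depth `k` of `i`: those `j` with a directed path from `j` to
`i` of length at most `k`. -/
def inComp (g : MarkedGraph V A) (i : V) : ℕ → Set V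
  | 0 => {i}
  | k + 1 => inComp g i k ∪ {j | ∃ m ∈ inComp g i k, ∃ r < (g.mark m).deg, g.nbr m r = j}

/-- `Δ f (i) = ∑_{r < d_i⁻} c(i,r) f(ℓ(i,r)) + (1 - c - d) f(i)`. -/
noncomputable def avg (c d : ℝ) (g : MarkedGraph V A) (f : V → ℝ) (i : V) : ℝ :=
  ∑ r ∈ Finset.range (g.mark i).deg, (g.mark i).weight r * f (g.nbr i r) + (1 - c - d) * f i

/-- The opinions at time `k` on the graph `g`, started from `r0`, where vertex `i` receives the
signal `w (k, i)` in the step from time `k` to time `k + 1`. -/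
noncomputable def opinion (c d : ℝ) (g : MarkedGraph V A) (r0 : V → ℝ) (w : ℕ × V → ℝ) :
    ℕ → V → ℝ
  | 0 => r0
  | k + 1 => fun i => avg c d g (opinion c d g r0 w k) i + w (k, i)

/-- The event of a successful coupling of depth `k` and precision `ε`: there is an isomorphism `θ`
from the in-component of depth `k` of `o` in `h` to the in-component of depth `k` of `i` in `g`
(as subgraphs induced on these vertices, with enumerated inbound edges), it maps `o` to `i`, and
corresponding marks are at distance at most `ε`. -/
def Coupled [MetricSpace A] {V' : Type v} (g : MarkedGraph V A) (i : V) (h : MarkedGraph V' A)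
    (o : V') (k : ℕ) (ε : ℝ) : Prop :=
  ∃ θ : V' → V, Set.BijOn θ (h.inComp o k) (g.inComp i k) ∧ θ o = i ∧
    (∀ a ∈ h.inComp o k, ∀ b ∈ h.inComp o k, ∀ r,
      (r < (h.mark a).deg ∧ h.nbr a r = b) ↔
        (r < (g.mark (θ a)).deg ∧ g.nbr (θ a) r = θ b)) ∧
    ∀ a ∈ h.inComp o k, Mark.rho (g.mark (θ a)) (h.mark a) ≤ ε

end MarkedGraph

/-! ### Probabilistic notions -/

/-- Convergence in probability to a constant, for random variables that may live on different
probability spaces. -/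
def TendstoInProb {Ω : ℕ → Type v} [∀ n, MeasurableSpace (Ω n)] (P : ∀ n, Measure (Ω n))
    (Z : ∀ n, Ω n → ℝ) (a : ℝ) : Prop :=
  ∀ δ : ℝ, 0 < δ → Tendsto (fun n => P n {ω | δ ≤ |Z n ω - a|}) atTop (𝓝 0)

/-- The Wasserstein-1 distance `inf E|X - Y|` over all couplings of `X ∼ μ` and `Y ∼ μ'`. -/
noncomputable def wasserstein1 (μ μ' : Measure ℝ) : ℝ≥0∞ :=
  ⨅ (π : Measure (ℝ × ℝ)) (_ : π.map Prod.fst = μ ∧ π.map Prod.snd = μ'),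
    ∫⁻ z, edist z.1 z.2 ∂π

/-- `g` is a random marked graph, `r0` a random vector of initial opinions and `W` a family of
signals on the probability space `(Ω, P)` such that, conditionally on the marked graph and the
initial opinions, the signals `W (k, i)` are independent with `W (k, i) ∼ ν(x_i)`, where `x_i` is the
full mark of `i`. -/
structure IsOpinionProcess {V : Type w} [MeasurableSpace V] [Countable V] {A : Type u}
    [MeasurableSpace A] {Ω : Type v} [MeasurableSpace Ω] (ν : Kernel (Mark A) ℝ)
    [IsMarkovKernel ν] (P : Measure Ω) [IsProbabilityMeasure P] (g : Ω → MarkedGraph V A)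
    (r0 : Ω → V → ℝ) (W : Ω → ℕ × V → ℝ) : Prop where
  measurable_graph : Measurable g
  measurable_initial : Measurable r0
  measurable_signal : Measurable W
  condDistrib_signal : ∀ᵐ ω ∂P,
    condDistrib W (fun ω' => (g ω', r0 ω')) P (g ω, r0 ω) =
      Measure.infinitePi (fun p : ℕ × V => ν ((g ω).mark p.2))

/-- `π` is a stationary distribution of the Markov chain of the opinions on the fixed finite marked
graph `g`: if `R ∼ π` and the signals `W_i ∼ ν(x_i)` are independent of each other and of `R`, then
`Δ R + W ∼ π`. -/
def IsStationaryLaw {V : Type w} [Fintype V] {A : Type u} [MeasurableSpace A]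
    (ν : Kernel (Mark A) ℝ) (c d : ℝ) (g : MarkedGraph V A) (π : Measure (V → ℝ)) : Prop :=
  IsProbabilityMeasure π ∧
    (π.prod (Measure.pi fun i => ν (g.mark i))).map (fun z i => g.avg c d z.1 i + z.2 i) = π

/-- The σ-algebra on `Ω × E` generated by a random element `Y` of `Ω`. -/
abbrev sigma {Ω : Type v} {F : Type u} [MeasurableSpace F] {E : Type w} (Y : Ω → F) :
    MeasurableSpace (Ω × E) :=
  MeasurableSpace.comap (fun z => Y z.1) inferInstance

/-- The uniform distribution on the vertex set `{0, …, n}`. -/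
noncomputable def unifVertex (n : ℕ) : Measure (Fin (n + 1)) := uniformOn Set.univ

/-- Strong coupling of the random marked graphs `G n` on `(Ω n, P n)`, with vertex set `Fin (n + 1)`,
with a random marked graph on a countable vertex set with root `0`, whose law is `Γ`.
Conditional probabilities are given `Y n`, the vertex attributes. -/
structure StrongCoupling {A : Type u} [MetricSpace A] [MeasurableSpace A] {F : ℕ → Type u}
    [∀ n, MeasurableSpace (F n)] {Ω : ℕ → Type v} [∀ n, MeasurableSpace (Ω n)]
    (P : ∀ n, Measure (Ω n)) (Y : ∀ n, Ω n → F n) (G : ∀ n, Ω n → MarkedGraph (Fin (n + 1)) A)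
    (Γ : Measure (MarkedGraph ℕ A)) : Prop where
  /-- A uniform vertex `I` can be coupled with one copy of the limit. -/
  one_vertex : ∀ (k : ℕ) (ε : ℝ), 0 < ε →
    ∃ Q : ∀ n, Measure (Ω n × (Fin (n + 1) × MarkedGraph ℕ A)),
      (∀ n, (Q n).map (fun z => (z.1, z.2.1)) = (P n).prod (unifVertex n)) ∧
      (∀ n, (Q n).map (fun z => z.2.2) = Γ) ∧
      TendstoInProb Q (fun n =>
        (Q n)[Set.indicator {z | (G n z.1).Coupled z.2.1 z.2.2 0 k ε} (fun _ => (1 : ℝ)) |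
          sigma (Y n)]) 1
  /-- Two independent uniform vertices `I`, `J` can be coupled with two independent copies of the
  limit, in such a way that the in-components of `I` and `J` do not share a vertex. -/
  two_vertices : ∀ (k : ℕ) (ε : ℝ), 0 < ε →
    ∃ Q : ∀ n, Measure (Ω n × ((Fin (n + 1) × Fin (n + 1)) × (MarkedGraph ℕ A × MarkedGraph ℕ A))),
      (∀ n, (Q n).map (fun z => (z.1, z.2.1)) =
        (P n).prod ((unifVertex n).prod (unifVertex n))) ∧
      (∀ n, (Q n).map (fun z => z.2.2) = Γ.prod Γ) ∧
      TendstoInProb Q (fun n =>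
        (Q n)[Set.indicator {z |
            (G n z.1).Coupled z.2.1.1 z.2.2.1 0 k ε ∧ (G n z.1).Coupled z.2.1.2 z.2.2.2 0 k ε ∧
            Disjoint ((G n z.1).inComp z.2.1.1 k) ((G n z.1).inComp z.2.1.2 k)}
          (fun _ => (1 : ℝ)) | sigma (Y n)]) 1

/-- `Q` extends `(Ω, P)` by a uniform vertex, independent of everything on `Ω`, and by a random
element of law `Λ` which is independent of the vertex attributes `Y`. -/
def IsLimitCoupling {Ω : Type v} [MeasurableSpace Ω] {F : Type u} [MeasurableSpace F] {E : Type w}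
    [MeasurableSpace E] {n : ℕ} (P : Measure Ω) (Y : Ω → F) (Λ : Measure E)
    (Q : Measure (Ω × (Fin (n + 1) × E))) : Prop :=
  Q.map (fun z => (z.1, z.2.1)) = P.prod (unifVertex n) ∧
    Q.map (fun z => (Y z.1, z.2.2)) = (P.map Y).prod Λ

end OpinionDynamics

open OpinionDynamics

/-!
The opinion of a vertex at time `k` depends only on its in-component of depth `k` and on the signals
there. If the in-component is isomorphic to the one of the root of another graph, with marks that
are `ε`-close, then driving both recursions by near optimal couplings of the signals keeps the
opinions up to time `k` within a constant multiple of `ε` of each other in mean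
(`exists_coupling_opinionPath`). Here the signals are Lipschitz in the marks, and the weights of a
vertex sum to at most `c`, so that one step at most doubles the distance, up to multiples of `ε`.

Two vertices with disjoint in-components have independent opinions, given the graph. By the coupling
of two uniform vertices with two independent copies of the limit, the averages `(n + 1)⁻¹ ∑ f(R_i)`
of a bounded uniformly continuous `f` therefore have asymptotically vanishing variance, and they
converge in mean square to the mean of `f` at the root of the limit
(`PairCoupling.tendsto_average`). Conditioning on the attributes costs nothing: conditional
expectations of nonnegative variables that tend to zero in mean tend to zero in probability.

The limit coupling has to provide a copy of the limit which is independent of the attributes. It is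
constructed from the convergence of averages (`exists_limit_coupling`): given the empirical
distribution of the opinions, a partition of unity into small cells and the masses of the cells
under the empirical distribution and under the limit law determine the density of a coupling of the
uniform vertex with the limit law. The conditional law of the copy given everything on the original
space is the limit law, and the cost is small because the masses of the cells nearly agree.

For large times, two opinion processes on the same graph with the same signals approach each other
like `(1 - d) ^ k`. On the finite graphs, this compares the opinions at time `k` from arbitrary
initial opinions with those at time `j + k` from zero, and in the weak limit it gives a coupling of
the laws at the root within `2 (1 - d) ^ k` (`CoupledOpinions.exists_coupling_rootLaw`). The limit
law `μ*` is a limit point of the laws at the root started from zero, and weak limits of these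
couplings compare it with the law at every time `k` (`CoupledOpinions.exists_coupling_limit`), which
gives the rate.

A stationary law is invariant under `k` steps of the chain. After `k` steps the opinions are within
`(1 - d) ^ k` of those started from zero, whose averages are already known to converge; letting `n`
and then `k` tend to infinity gives the convergence of averages in the stationary regime
(`CoupledOpinions.tendsto_sq_stationary`), and the limit coupling follows from it as before.
-/

namespace OpinionDynamics

/-! ### Measurability of the opinions and of the law of the signals -/

section Measurability

theorem measurable_eval_countable {α : Type*} {ι : Type*} {β : Type*} [MeasurableSpace α]
    [MeasurableSpace β] [Countable ι] [MeasurableSpace ι] [MeasurableSingletonClass ι]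
    {F : α → ι → β} {j : α → ι} (hF : Measurable F) (hj : Measurable j) :
    Measurable fun x => F x (j x) := by
  have h : Measurable fun p : α × ι => F p.1 p.2 :=
    measurable_from_prod_countable_left fun i => (measurable_pi_apply i).comp hF
  exact h.comp (measurable_id.prodMk hj)

theorem measurable_sum_range {α : Type*} [MeasurableSpace α] {N : α → ℕ} {F : ℕ → α → ℝ}
    (hN : Measurable N) (hF : ∀ r, Measurable (F r)) :
    Measurable fun x => ∑ r ∈ Finset.range (N x), F r x := by
  have h : Measurable fun x => fun m : ℕ => ∑ r ∈ Finset.range m, F r x :=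
    measurable_pi_lambda _ fun m => Finset.measurable_sum _ fun r _ => hF r
  exact measurable_eval_countable (F := fun x (m : ℕ) => ∑ r ∈ Finset.range m, F r x) h hN

variable {V : Type w} [MeasurableSpace V] {A : Type u} [MeasurableSpace A]

theorem Mark.measurable_deg : Measurable (Mark.deg : Mark A → ℕ) :=
  measurable_fst.comp measurable_snd

theorem Mark.measurable_weight (r : ℕ) : Measurable fun x : Mark A => x.weight r := by
  unfold Mark.weight
  refine Measurable.ite ?_ ?_ measurable_const
  · exact measurableSet_lt measurable_const Mark.measurable_deg
  · exact measurable_subtype_coe.comp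
      ((measurable_pi_apply r).comp (measurable_snd.comp measurable_snd))

namespace MarkedGraph

theorem measurable_mark (i : V) : Measurable fun g : MarkedGraph V A => g.mark i :=
  measurable_fst.comp (measurable_pi_apply i)

theorem measurable_nbr (i : V) (r : ℕ) : Measurable fun g : MarkedGraph V A => g.nbr i r :=
  (measurable_pi_apply r).comp (measurable_snd.comp (measurable_pi_apply i))

theorem measurable_attributes : Measurable (attributes : MarkedGraph V A → V → Attr A) :=
  measurable_pi_lambda _ fun i => measurable_fst.comp (measurable_mark i)

theorem measurable_avg [Countable V] [MeasurableSingletonClass V] (c d : ℝ) {α : Type*}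
    [MeasurableSpace α]
    {g : α → MarkedGraph V A} {f : α → V → ℝ} (hg : Measurable g) (hf : Measurable f) :
    Measurable fun x => avg c d (g x) (f x) := by
  refine measurable_pi_lambda _ fun i => ?_
  unfold avg
  refine Measurable.add (measurable_sum_range
    (Mark.measurable_deg.comp ((measurable_mark i).comp hg)) fun r => ?_) ?_
  · exact ((Mark.measurable_weight r).comp ((measurable_mark i).comp hg)).mul
      (measurable_eval_countable hf ((measurable_nbr i r).comp hg))
  · exact ((measurable_pi_apply i).comp hf).const_mul _

theorem measurable_opinion [Countable V] [MeasurableSingletonClass V] (c d : ℝ) {α : Type*}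
    [MeasurableSpace α] {g : α → MarkedGraph V A} {r0 : α → V → ℝ} {w : α → ℕ × V → ℝ}
    (hg : Measurable g) (hr : Measurable r0) (hw : Measurable w) (k : ℕ) :
    Measurable fun x => opinion c d (g x) (r0 x) (w x) k := by
  induction k with
  | zero => exact hr
  | succ k ih =>
    have h := measurable_avg c d hg ih
    refine measurable_pi_lambda _ fun i => ?_
    exact ((measurable_pi_apply i).comp h).add ((measurable_pi_apply (k, i)).comp hw)

/-- The opinions of the vertex `i` at the times `0, …, k`. -/
noncomputable def opinionPath (c d : ℝ) (g : MarkedGraph V A) (r0 : V → ℝ) (w : ℕ × V → ℝ)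
    (k : ℕ) (i : V) : Fin (k + 1) → ℝ := fun r => opinion c d g r0 w r i

theorem measurable_opinionPath [Countable V] [MeasurableSingletonClass V] (c d : ℝ) {α : Type*}
    [MeasurableSpace α] {g : α → MarkedGraph V A} {r0 : α → V → ℝ} {w : α → ℕ × V → ℝ}
    {i : α → V} (hg : Measurable g) (hr : Measurable r0) (hw : Measurable w) (k : ℕ)
    (hi : Measurable i) :
    Measurable fun x => opinionPath c d (g x) (r0 x) (w x) k (i x) :=
  measurable_pi_lambda _ fun r =>
    measurable_eval_countable (F := fun x => opinion c d (g x) (r0 x) (w x) r)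
      (measurable_opinion c d hg hr hw r) hi

end MarkedGraph

/-- The law of the signals given the marked graph: independent, with `w (k, i) ∼ ν(x_i)`. -/
noncomputable def signalLaw (ν : Kernel (Mark A) ℝ) [IsMarkovKernel ν] (g : MarkedGraph V A) :
    Measure (ℕ × V → ℝ) :=
  Measure.infinitePi fun p : ℕ × V => ν (g.mark p.2)

instance (ν : Kernel (Mark A) ℝ) [IsMarkovKernel ν] (g : MarkedGraph V A) :
    IsProbabilityMeasure (signalLaw ν g) := by
  unfold signalLaw; infer_instance

theorem measurable_signalLaw (ν : Kernel (Mark A) ℝ) [IsMarkovKernel ν] :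
    Measurable (signalLaw ν : MarkedGraph V A → Measure (ℕ × V → ℝ)) := by
  refine Measurable.measure_of_isPiSystem_of_isProbabilityMeasure
    (generateFrom_squareCylinders (α := fun _ : ℕ × V => ℝ)).symm
    (isPiSystem_squareCylinders (fun _ => MeasurableSpace.isPiSystem_measurableSet) (by simp)) ?_
  rintro s ⟨S, t, ht, rfl⟩
  have ht' : ∀ p, MeasurableSet (t p) := fun p => ht p trivial
  have : (fun g : MarkedGraph V A => signalLaw ν g ((S : Set (ℕ × V)).pi t)) =
      fun g => ∏ p ∈ S, ν (g.mark p.2) (t p) := by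
    funext g
    exact Measure.infinitePi_pi _ fun p _ => ht' p
  rw [this]
  exact Finset.measurable_prod _ fun p _ =>
    (ν.measurable_coe (ht' p)).comp (MarkedGraph.measurable_mark p.2)

/-- The law of the signals, as a Markov kernel. -/
noncomputable def signalKernel (ν : Kernel (Mark A) ℝ) [IsMarkovKernel ν] :
    Kernel (MarkedGraph V A) (ℕ × V → ℝ) :=
  ⟨signalLaw ν, measurable_signalLaw ν⟩

theorem signalKernel_apply (ν : Kernel (Mark A) ℝ) [IsMarkovKernel ν] (g : MarkedGraph V A) :
    signalKernel ν g = signalLaw ν g := rfl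

instance (ν : Kernel (Mark A) ℝ) [IsMarkovKernel ν] :
    IsMarkovKernel (signalKernel ν : Kernel (MarkedGraph V A) (ℕ × V → ℝ)) :=
  ⟨fun g => by rw [signalKernel_apply]; infer_instance⟩

end Measurability

/-! ### Product measures and disjoint families of coordinates -/

section InfinitePi

/-- Disjoint families of coordinates are independent under a product measure. -/
theorem infinitePi_map_prodMk {ι α β : Type*} {X : Type*} [MeasurableSpace X]
    (μ : ι → Measure X) [∀ i, IsProbabilityMeasure (μ i)] {e₁ : α → ι} {e₂ : β → ι}
    (h₁ : Function.Injective e₁) (h₂ : Function.Injective e₂)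
    (hdisj : Disjoint (Set.range e₁) (Set.range e₂)) :
    (Measure.infinitePi μ).map (fun w => ((fun a => w (e₁ a)), fun b => w (e₂ b))) =
      (Measure.infinitePi fun a => μ (e₁ a)).prod (Measure.infinitePi fun b => μ (e₂ b)) := by
  have hm₁ : Measurable fun (w : ι → X) a => w (e₁ a) := by fun_prop
  have hm₂ : Measurable fun (w : ι → X) b => w (e₂ b) := by fun_prop
  have hind : IndepFun (fun (w : ι → X) a => w (e₁ a)) (fun (w : ι → X) b => w (e₂ b))
      (Measure.infinitePi μ) := by
    have h := iIndepFun_infinitePi (P := μ) (X := fun _ (x : X) => x) (by fun_prop)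
    have h' := indep_iSup_of_disjoint (m := fun i => MeasurableSpace.comap (fun w : ι → X => w i)
      inferInstance) (fun i => (measurable_pi_apply i).comap_le) h hdisj
    rw [IndepFun_iff_Indep]
    convert h' using 1
    · simp only [MeasurableSpace.pi, MeasurableSpace.comap_iSup, MeasurableSpace.comap_comp,
        iSup_range]
      rfl
    · simp only [MeasurableSpace.pi, MeasurableSpace.comap_iSup, MeasurableSpace.comap_comp,
        iSup_range]
      rfl
  rw [(indepFun_iff_map_prod_eq_prod_map_map hm₁.aemeasurable hm₂.aemeasurable).1 hind,
    Measure.map_infinitePi_infinitePi_of_inj h₁, Measure.map_infinitePi_infinitePi_of_inj h₂]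

end InfinitePi

/-! ### Opinions on a fixed marked graph -/

section Deterministic

namespace Mark

variable {A : Type u}

theorem weight_nonneg (x : Mark A) (r : ℕ) : 0 ≤ x.weight r := by
  unfold weight
  split_ifs
  · exact (x.2.2 r).2.1
  · exact le_rfl

theorem totalWeight_eq_zero {x : Mark A} (h : x.deg = 0) : x.totalWeight = 0 := by
  simp [totalWeight, h]

theorem summable_abs_weight_sub (x y : Mark A) :
    Summable fun r => |x.weight r - y.weight r| := by
  refine summable_of_ne_finset_zero (s := Finset.range (max x.deg y.deg)) fun r hr => ?_
  have hr' : max x.deg y.deg ≤ r := by simpa using hr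
  simp [weight, not_lt.2 (le_trans (le_max_left _ _) hr'),
    not_lt.2 (le_trans (le_max_right _ _) hr')]

variable [MetricSpace A] {x y : Mark A} {ε : ℝ}

theorem dist_le_of_rho_le (h : rho x y ≤ ε) : dist x.attr.1 y.attr.1 ≤ ε := by
  have h2 : 0 ≤ ∑' r, |x.weight r - y.weight r| := tsum_nonneg fun _ => abs_nonneg _
  unfold rho at h
  linarith [abs_nonneg ((x.attr.2.1 : ℝ) - (y.attr.2.1 : ℝ)),
    abs_nonneg (((x.attr.2.2 : ℕ) : ℝ) - ((y.attr.2.2 : ℕ) : ℝ)),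
    abs_nonneg ((x.deg : ℝ) - (y.deg : ℝ))]

theorem deg_eq_of_rho_lt_one (h : rho x y < 1) : x.deg = y.deg := by
  have h2 : 0 ≤ ∑' r, |x.weight r - y.weight r| := tsum_nonneg fun _ => abs_nonneg _
  unfold rho at h
  have h3 : |(x.deg : ℝ) - (y.deg : ℝ)| < 1 := by
    linarith [abs_nonneg ((x.attr.2.1 : ℝ) - (y.attr.2.1 : ℝ)),
      abs_nonneg (((x.attr.2.2 : ℕ) : ℝ) - ((y.attr.2.2 : ℕ) : ℝ)),
      dist_nonneg (x := x.attr.1) (y := y.attr.1)]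
  have h4 : |(x.deg : ℤ) - (y.deg : ℤ)| < 1 := by exact_mod_cast h3
  rw [Int.abs_lt_one_iff] at h4
  omega

theorem sum_abs_weight_sub_le (h : rho x y ≤ ε) (N : ℕ) :
    ∑ r ∈ Finset.range N, |x.weight r - y.weight r| ≤ ε := by
  refine ((summable_abs_weight_sub x y).sum_le_tsum _ fun _ _ => abs_nonneg _).trans ?_
  unfold rho at h
  linarith [abs_nonneg ((x.attr.2.1 : ℝ) - (y.attr.2.1 : ℝ)),
    abs_nonneg (((x.attr.2.2 : ℕ) : ℝ) - ((y.attr.2.2 : ℕ) : ℝ)),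
    abs_nonneg ((x.deg : ℝ) - (y.deg : ℝ)), dist_nonneg (x := x.attr.1) (y := y.attr.1)]

end Mark

namespace MarkedGraph

variable {V : Type w} {A : Type u} {g : MarkedGraph V A} {c d : ℝ}

theorem mem_inComp_self (g : MarkedGraph V A) (i : V) (k : ℕ) : i ∈ g.inComp i k := by
  induction k with
  | zero => rfl
  | succ k ih => exact Or.inl ih

theorem inComp_mono (g : MarkedGraph V A) (i : V) {j k : ℕ} (h : j ≤ k) :
    g.inComp i j ⊆ g.inComp i k := by
  induction h with
  | refl => exact subset_rfl
  | step _ ih => exact ih.trans Set.subset_union_left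

theorem nbr_mem_inComp {i v : V} {k r : ℕ} (hv : v ∈ g.inComp i k) (hr : r < (g.mark v).deg) :
    g.nbr v r ∈ g.inComp i (k + 1) :=
  Or.inr ⟨v, hv, r, hr, rfl⟩

theorem inComp_withInitial (g : MarkedGraph V A) (r0 : V → ℝ) (i : V) (k : ℕ) :
    (g.withInitial r0).inComp i k = g.inComp i k := by
  induction k with
  | zero => rfl
  | succ k ih => simp only [inComp, ih]; rfl

theorem avg_sub (f f' : V → ℝ) (i : V) :
    avg c d g f i - avg c d g f' i = avg c d g (fun v => f v - f' v) i := by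
  simp only [avg, mul_sub, Finset.sum_sub_distrib]
  ring

theorem abs_avg_le (hcd : c + d ≤ 1) {f : V → ℝ} {M : ℝ} (hf : ∀ v, |f v| ≤ M) (i : V) :
    |avg c d g f i| ≤ ((g.mark i).totalWeight + (1 - c - d)) * M := by
  unfold avg Mark.totalWeight
  rw [add_mul, Finset.sum_mul]
  refine (abs_add_le _ _).trans (add_le_add ((Finset.abs_sum_le_sum_abs _ _).trans
    (Finset.sum_le_sum fun r _ => ?_)) ?_)
  · rw [abs_mul, abs_of_nonneg (Mark.weight_nonneg _ _)]
    exact mul_le_mul_of_nonneg_left (hf _) (Mark.weight_nonneg _ _)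
  · rw [abs_mul, abs_of_nonneg (by linarith)]
    exact mul_le_mul_of_nonneg_left (hf _) (by linarith)

/-- The condition on the weights: those of a vertex with inbound neighbours add up to `c`. -/
def HasWeightSum (g : MarkedGraph V A) (c : ℝ) : Prop :=
  ∀ i, 0 < (g.mark i).deg → (g.mark i).totalWeight = c

theorem HasWeightSum.totalWeight_le (hg : g.HasWeightSum c) (hc : 0 ≤ c) (i : V) :
    (g.mark i).totalWeight ≤ c := by
  rcases Nat.eq_zero_or_pos (g.mark i).deg with h | h
  · rw [Mark.totalWeight_eq_zero h]; exact hc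
  · exact (hg i h).le

theorem abs_opinion_le_one (hcd : c + d ≤ 1)
    {r0 : V → ℝ} {w : ℕ × V → ℝ} (hr : ∀ i, |r0 i| ≤ 1)
    (hw : ∀ t i, |w (t, i)| ≤ d + c - (g.mark i).totalWeight) (k : ℕ) (i : V) :
    |opinion c d g r0 w k i| ≤ 1 := by
  induction k generalizing i with
  | zero => exact hr i
  | succ k ih =>
    refine (abs_add_le _ _).trans ?_
    have h1 := abs_avg_le (g := g) hcd ih i
    linarith [hw k i]

/-- Opinions driven by the same signals approach each other at the rate `1 - d`. -/
theorem abs_opinion_sub_le (hg : g.HasWeightSum c) (hc : 0 ≤ c) (hcd : c + d ≤ 1)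
    {r0 r1 : V → ℝ} {w : ℕ × V → ℝ} {M : ℝ} (hM : ∀ i, |r0 i - r1 i| ≤ M) (k : ℕ) (i : V) :
    |opinion c d g r0 w k i - opinion c d g r1 w k i| ≤ (1 - d) ^ k * M := by
  induction k generalizing i with
  | zero => simpa [opinion] using hM i
  | succ k ih =>
    have h0 : (0 : ℝ) ≤ (1 - d) ^ k * M := (abs_nonneg _).trans (ih i)
    have h1 := abs_avg_le (g := g) hcd ih i
    have h2 : opinion c d g r0 w (k + 1) i - opinion c d g r1 w (k + 1) i =
        avg c d g (fun v => opinion c d g r0 w k v - opinion c d g r1 w k v) i := by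
      rw [← avg_sub]; simp only [opinion]; ring
    rw [h2, pow_succ]
    refine h1.trans ?_
    have := hg.totalWeight_le hc i
    calc _ ≤ (1 - d) * ((1 - d) ^ k * M) := mul_le_mul_of_nonneg_right (by linarith) h0
      _ = _ := by ring

theorem opinion_add (g : MarkedGraph V A) (r0 : V → ℝ) (w : ℕ × V → ℝ) (m k : ℕ) :
    opinion c d g r0 w (m + k) =
      opinion c d g (opinion c d g r0 w m) (fun p => w (m + p.1, p.2)) k := by
  induction k with
  | zero => rfl
  | succ k ih =>
    rw [← add_assoc]
    simp only [opinion, ih]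

/-- The opinions of `i` up to time `k` only depend on the signals and the initial opinions in the
in-component of depth `k`. -/
theorem opinion_congr {i : V} {k : ℕ} {r0 : V → ℝ} {w w' : ℕ × V → ℝ}
    (h : ∀ t, ∀ v ∈ g.inComp i k, w (t, v) = w' (t, v)) {t j : ℕ} (htj : j + t ≤ k) {v : V}
    (hv : v ∈ g.inComp i j) : opinion c d g r0 w t v = opinion c d g r0 w' t v := by
  induction t generalizing j v with
  | zero => rfl
  | succ t ih =>
    simp only [opinion, avg]
    rw [h t v (inComp_mono g i (by omega) hv), ih (by omega) hv]
    congr 2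
    refine Finset.sum_congr rfl fun r hr => ?_
    rw [ih (j := j + 1) (by omega) (nbr_mem_inComp hv (Finset.mem_range.1 hr))]

theorem opinionPath_congr {i : V} {k : ℕ} {r0 : V → ℝ} {w w' : ℕ × V → ℝ}
    (h : ∀ t, ∀ v ∈ g.inComp i k, w (t, v) = w' (t, v)) :
    opinionPath c d g r0 w k i = opinionPath c d g r0 w' k i :=
  funext fun r => opinion_congr h (j := 0) (by have := r.2; omega) (mem_inComp_self g i 0)

end MarkedGraph

end Deterministic

/-! ### Comparison of the opinions on two marked graphs -/

section Comparison

/-- The signals on `V` obtained from signals on the vertices of an embedded set, extended by `0`. -/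
noncomputable def extendSignal {S : Type*} {V : Type*} (θ : S → V) (u : ℕ × S → ℝ) : ℕ × V → ℝ :=
  Function.extend (Prod.map id θ) u 0

section Extend

variable {S : Type*} {V : Type*} {θ : S → V}

theorem extendSignal_apply (hθ : Function.Injective θ) (u : ℕ × S → ℝ) (t : ℕ) (a : S) :
    extendSignal θ u (t, θ a) = u (t, a) :=
  (Function.injective_id.prodMap hθ).extend_apply u 0 (t, a)

theorem extendSignal_apply_of_notMem (u : ℕ × S → ℝ) (t : ℕ) {v : V} (hv : v ∉ Set.range θ) :
    extendSignal θ u (t, v) = 0 :=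
  Function.extend_apply' _ _ _ fun ⟨p, hp⟩ => hv ⟨p.2, congrArg Prod.snd hp⟩

theorem measurable_extendSignal (hθ : Function.Injective θ) :
    Measurable (extendSignal θ : (ℕ × S → ℝ) → ℕ × V → ℝ) := by
  refine measurable_pi_lambda _ fun p => ?_
  obtain ⟨t, v⟩ := p
  by_cases hv : v ∈ Set.range θ
  · obtain ⟨a, rfl⟩ := hv
    simp only [extendSignal_apply hθ]
    exact measurable_pi_apply _
  · simp only [extendSignal_apply_of_notMem _ _ hv]
    exact measurable_const

variable {A : Type u} {c d : ℝ} {g : MarkedGraph V A}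

theorem opinionPath_extendSignal (hθ : Function.Injective θ) {i : V} {k : ℕ}
    (hS : g.inComp i k ⊆ Set.range θ) (r0 : V → ℝ) (w : ℕ × V → ℝ) :
    g.opinionPath c d r0 (extendSignal θ fun p => w (p.1, θ p.2)) k i =
      g.opinionPath c d r0 w k i := by
  refine MarkedGraph.opinionPath_congr fun t v hv => ?_
  obtain ⟨a, rfl⟩ := hS hv
  rw [extendSignal_apply hθ]

/-- The law of the opinions of `i` up to time `k` only involves the signals in a set that contains
the in-component of depth `k`. -/
theorem integral_opinionPath_eq [MeasurableSpace A] [Countable V] [MeasurableSpace V]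
    [MeasurableSingletonClass V] (ν : Kernel (Mark A) ℝ) [IsMarkovKernel ν]
    (hθ : Function.Injective θ) {i : V} {k : ℕ}
    (hS : g.inComp i k ⊆ Set.range θ) (r0 : V → ℝ) {f : (Fin (k + 1) → ℝ) → ℝ}
    (hf : Measurable f) :
    ∫ w, f (g.opinionPath c d r0 w k i) ∂signalLaw ν g =
      ∫ u, f (g.opinionPath c d r0 (extendSignal θ u) k i)
        ∂Measure.infinitePi fun p : ℕ × S => ν (g.mark (θ p.2)) := by
  have hinj : Function.Injective (fun p : ℕ × S => (p.1, θ p.2)) :=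
    Function.injective_id.prodMap hθ
  have h := Measure.map_infinitePi_infinitePi_of_inj (P := fun p : ℕ × V => ν (g.mark p.2)) hinj
  rw [← h, integral_map (Measurable.aemeasurable (by fun_prop)), signalLaw]
  · simp only [opinionPath_extendSignal hθ hS]
  · exact (hf.comp (MarkedGraph.measurable_opinionPath c d measurable_const measurable_const
      (measurable_extendSignal hθ) k measurable_const)).aestronglyMeasurable

end Extend

variable {A : Type u} [MetricSpace A] {V : Type v} {V' : Type w} {c d : ℝ}

/-- One step of the dynamics at two vertices with close marks and matching inbound neighbours. -/
theorem abs_avg_sub_avg_le {g : MarkedGraph V A} {h : MarkedGraph V' A} {θ : V' → V} {a : V'}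
    {ε : ℝ} (hε : ε < 1) (hcd : c + d ≤ 1) (hrho : Mark.rho (g.mark (θ a)) (h.mark a) ≤ ε)
    (hnbr : ∀ r < (h.mark a).deg, g.nbr (θ a) r = θ (h.nbr a r))
    {f : V → ℝ} (hf : ∀ v, |f v| ≤ 1) (f' : V' → ℝ) :
    |g.avg c d f (θ a) - h.avg c d f' a| ≤
      ε + ∑ r ∈ Finset.range (h.mark a).deg,
          (h.mark a).weight r * |f (θ (h.nbr a r)) - f' (h.nbr a r)|
        + (1 - c - d) * |f (θ a) - f' a| := by
  -- integers at distance less than one are equal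
  have hdeg := Mark.deg_eq_of_rho_lt_one (hrho.trans_lt hε)
  have hsum := Mark.sum_abs_weight_sub_le hrho (h.mark a).deg
  have key : g.avg c d f (θ a) - h.avg c d f' a =
      ∑ r ∈ Finset.range (h.mark a).deg,
          ((g.mark (θ a)).weight r - (h.mark a).weight r) * f (θ (h.nbr a r))
        + ∑ r ∈ Finset.range (h.mark a).deg,
          (h.mark a).weight r * (f (θ (h.nbr a r)) - f' (h.nbr a r))
        + (1 - c - d) * (f (θ a) - f' a) := by
    simp only [MarkedGraph.avg, hdeg]
    rw [← Finset.sum_add_distrib]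
    have : ∀ r ∈ Finset.range (h.mark a).deg,
        ((g.mark (θ a)).weight r - (h.mark a).weight r) * f (θ (h.nbr a r)) +
          (h.mark a).weight r * (f (θ (h.nbr a r)) - f' (h.nbr a r)) =
        (g.mark (θ a)).weight r * f (g.nbr (θ a) r) -
          (h.mark a).weight r * f' (h.nbr a r) := by
      intro r hr
      rw [hnbr r (Finset.mem_range.1 hr)]; ring
    rw [Finset.sum_congr rfl this, Finset.sum_sub_distrib]; ring
  rw [key]
  refine (abs_add_le _ _).trans (add_le_add ((abs_add_le _ _).trans (add_le_add ?_ ?_)) ?_)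
  · refine (Finset.abs_sum_le_sum_abs _ _).trans ((Finset.sum_le_sum fun r _ => ?_).trans hsum)
    rw [abs_mul]
    exact mul_le_of_le_one_right (abs_nonneg _) (hf _)
  · refine (Finset.abs_sum_le_sum_abs _ _).trans (Finset.sum_le_sum fun r _ => ?_)
    rw [abs_mul, abs_of_nonneg (Mark.weight_nonneg _ _)]
  · rw [abs_mul, abs_of_nonneg (by linarith)]

/-- The factor by which the precision of a coupling of marked graphs bounds the mean distance of the
opinions after `t` steps. -/
noncomputable def stepConst (K : ℝ≥0) : ℕ → ℝ
  | 0 => 1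
  | t + 1 => 2 * stepConst K t + K + 2

theorem stepConst_nonneg (K : ℝ≥0) (t : ℕ) : 0 ≤ stepConst K t := by
  induction t with
  | zero => exact zero_le_one
  | succ t ih => unfold stepConst; positivity

/-- The factor for the whole path of the opinions up to time `k`. -/
noncomputable def pathConst (K : ℝ≥0) (k : ℕ) : ℝ := ∑ t : Fin (k + 1), stepConst K t

theorem pathConst_nonneg (K : ℝ≥0) (k : ℕ) : 0 ≤ pathConst K k :=
  Finset.sum_nonneg fun _ _ => stepConst_nonneg _ _

variable [MeasurableSpace A]

/-- The assumptions on a finite marked graph: the weights of a vertex with inbound neighbours add up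
to `c`, and the signals are small enough to keep the opinions in `[-1, 1]`. -/
structure Admissible (ν : Kernel (Mark A) ℝ) (c d : ℝ) (g : MarkedGraph V A) : Prop where
  hasWeightSum : g.HasWeightSum c
  signal_le : ∀ i, ∀ᵐ t ∂(ν (g.mark i)), |t| ≤ d + c - (g.mark i).totalWeight

variable [Countable V] [MeasurableSpace V] [MeasurableSingletonClass V]
  [Countable V'] [MeasurableSpace V'] [MeasurableSingletonClass V']

/-- Near optimal couplings of the signals of corresponding vertices keep the opinions on two coupled
marked graphs close together. -/
theorem exists_coupling_opinionPath {ν : Kernel (Mark A) ℝ} [IsMarkovKernel ν] {K : ℝ≥0}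
    (hLip : ∀ x y : Mark A, wasserstein1 (ν x) (ν y) ≤ ENNReal.ofReal (K * Mark.rho x y))
    (hc : 0 ≤ c) (hd : 0 < d) (hcd : c + d ≤ 1) {g : MarkedGraph V A} {h : MarkedGraph V' A}
    (hg : Admissible ν c d g) {r0 : V → ℝ} {r0' : V' → ℝ} (hr0 : ∀ i, |r0 i| ≤ 1)
    {i : V} {o : V'} {k : ℕ} {ε : ℝ} (hε0 : 0 < ε) (hε1 : ε < 1)
    (hcoup : (g.withInitial r0).Coupled i (h.withInitial r0') o k ε) :
    ∃ (T : Type w) (_ : MeasurableSpace T) (Q : Measure T) (_ : IsProbabilityMeasure Q)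
      (X Y : T → Fin (k + 1) → ℝ), Measurable X ∧ Measurable Y ∧
      (∀ f : (Fin (k + 1) → ℝ) → ℝ, Measurable f →
        ∫ w, f (g.opinionPath c d r0 w k i) ∂signalLaw ν g = ∫ z, f (X z) ∂Q) ∧
      (∀ f : (Fin (k + 1) → ℝ) → ℝ, Measurable f →
        ∫ w, f (h.opinionPath c d r0' w k o) ∂signalLaw ν h = ∫ z, f (Y z) ∂Q) ∧
      ∫⁻ z, ENNReal.ofReal (dist (X z) (Y z)) ∂Q ≤ ENNReal.ofReal (pathConst K k * ε) := by
  obtain ⟨θ, hbij, rfl, hedge, hrho'⟩ := hcoup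
  rw [MarkedGraph.inComp_withInitial] at hbij hedge hrho'
  rw [MarkedGraph.inComp_withInitial] at hbij
  set S := h.inComp o k
  have hrho : ∀ a ∈ S, Mark.rho (g.mark (θ a)) (h.mark a) ≤ ε := by
    intro a ha
    refine le_trans ?_ (hrho' a ha)
    have hd : dist (g.mark (θ a)).attr.1 (h.mark a).attr.1 ≤
      dist ((g.withInitial r0).mark (θ a)).attr.1 ((h.withInitial r0').mark a).attr.1 :=
      le_max_left _ _
    unfold Mark.rho
    exact add_le_add (add_le_add (add_le_add (add_le_add hd le_rfl) le_rfl) le_rfl) le_rfl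
  have hinit : ∀ a ∈ S, |r0 (θ a) - r0' a| ≤ ε := by
    intro a ha
    refine le_trans ?_ (Mark.dist_le_of_rho_le (hrho' a ha))
    rw [← Real.dist_eq]
    exact le_max_right _ _
  have hnbr : ∀ j < k, ∀ a ∈ h.inComp o j, ∀ r < (h.mark a).deg,
      g.nbr (θ a) r = θ (h.nbr a r) := by
    intro j hj a ha r hr
    have hb : h.nbr a r ∈ S :=
      MarkedGraph.inComp_mono h o (Nat.succ_le_of_lt hj) (MarkedGraph.nbr_mem_inComp ha hr)
    exact ((hedge a (MarkedGraph.inComp_mono h o hj.le ha) _ hb r).1 ⟨hr, rfl⟩).2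
  -- near optimal couplings of the signals of corresponding vertices
  have hex : ∀ a : S, ∃ π : Measure (ℝ × ℝ), (π.map Prod.fst = ν (g.mark (θ a)) ∧
      π.map Prod.snd = ν (h.mark a)) ∧
      ∫⁻ z, edist z.1 z.2 ∂π ≤ ENNReal.ofReal ((K + 1) * ε) := by
    intro a
    have h1 : wasserstein1 (ν (g.mark (θ a))) (ν (h.mark a)) <
        ENNReal.ofReal ((K + 1) * ε) := by
      refine (hLip _ _).trans_lt ((ENNReal.ofReal_lt_ofReal_iff (by positivity)).2 ?_)
      have := mul_le_mul_of_nonneg_left (hrho a a.2) K.2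
      calc (K : ℝ) * Mark.rho (g.mark (θ a)) (h.mark a) ≤ K * ε := this
        _ < (K + 1) * ε := by linarith
    unfold wasserstein1 at h1
    simp only [iInf_lt_iff] at h1
    obtain ⟨π, hπ, hlt⟩ := h1
    exact ⟨π, hπ, hlt.le⟩
  choose π hπ hcost using hex
  have hprob : ∀ a, IsProbabilityMeasure (π a) := by
    intro a
    have : IsProbabilityMeasure ((π a).map Prod.fst) := by rw [(hπ a).1]; infer_instance
    exact Measure.isProbabilityMeasure_of_map Prod.fst
  -- the pairs of signals are independent, over the vertices of `S` and the times; outside the two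
  -- in-components the signals do not matter, and they are set to zero
  let Q : Measure (ℕ × S → ℝ × ℝ) := Measure.infinitePi fun p => π p.2
  let θg : S → V := fun a => θ a
  have hθg : Function.Injective θg := fun a b hab => Subtype.ext (hbij.injOn a.2 b.2 hab)
  let θh : S → V' := Subtype.val
  have hθh : Function.Injective θh := Subtype.val_injective
  let U : (ℕ × S → ℝ × ℝ) → ℕ × V → ℝ := fun z => extendSignal θg fun p => (z p).1
  let U' : (ℕ × S → ℝ × ℝ) → ℕ × V' → ℝ := fun z => extendSignal θh fun p => (z p).2
  have hU : Measurable U := (measurable_extendSignal hθg).comp (by fun_prop)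
  have hU' : Measurable U' := (measurable_extendSignal hθh).comp (by fun_prop)
  have hrange : g.inComp (θ o) k ⊆ Set.range θg := by
    intro v hv
    obtain ⟨a, ha, rfl⟩ := hbij.surjOn hv
    exact ⟨⟨a, ha⟩, rfl⟩
  have hrange' : h.inComp o k ⊆ Set.range θh := fun a ha => ⟨⟨a, ha⟩, rfl⟩
  refine ⟨ℕ × S → ℝ × ℝ, inferInstance, Q, inferInstance,
    fun z => g.opinionPath c d r0 (U z) k (θ o), fun z => h.opinionPath c d r0' (U' z) k o,
    MarkedGraph.measurable_opinionPath c d measurable_const measurable_const hU k measurable_const,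
    MarkedGraph.measurable_opinionPath c d measurable_const measurable_const hU' k
      measurable_const, ?_, ?_, ?_⟩
  · intro f hf
    rw [integral_opinionPath_eq ν hθg hrange r0 hf]
    have hmap := Measure.infinitePi_map_pi (fun p : ℕ × S => π p.2)
      (f := fun _ => Prod.fst) (fun _ => measurable_fst)
    simp only [(hπ _).1] at hmap
    rw [← hmap, integral_map (Measurable.aemeasurable (by fun_prop))]
    exact (hf.comp (MarkedGraph.measurable_opinionPath c d measurable_const measurable_const
      (measurable_extendSignal hθg) k measurable_const)).aestronglyMeasurable
  · intro f hf
    rw [integral_opinionPath_eq ν hθh hrange' r0' hf]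
    have hmap := Measure.infinitePi_map_pi (fun p : ℕ × S => π p.2)
      (f := fun _ => Prod.snd) (fun _ => measurable_snd)
    simp only [(hπ _).2] at hmap
    rw [← hmap, integral_map (Measurable.aemeasurable (by fun_prop))]
    exact (hf.comp (MarkedGraph.measurable_opinionPath c d measurable_const measurable_const
      (measurable_extendSignal hθh) k measurable_const)).aestronglyMeasurable
  -- the opinions on `g` are bounded by one, also for the extended signals
  have hbdd : ∀ᵐ z ∂Q, ∀ t v, |g.opinion c d r0 (U z) t v| ≤ 1 := by
    have h1 : ∀ p : ℕ × S, ∀ᵐ z ∂Q, |(z p).1| ≤ d + c - (g.mark (θ p.2)).totalWeight := by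
      intro p
      have h2 := hg.signal_le (θ p.2)
      rw [← (hπ p.2).1] at h2
      have h3 := ae_of_ae_map measurable_fst.aemeasurable h2
      have h4 : Q.map (fun z => z p) = π p.2 := Measure.infinitePi_map_eval _ p
      rw [← h4] at h3
      exact ae_of_ae_map (measurable_pi_apply p).aemeasurable h3
    filter_upwards [ae_all_iff.2 h1] with z hz t v
    refine MarkedGraph.abs_opinion_le_one hcd hr0 (fun t v => ?_) t v
    by_cases hv : v ∈ Set.range θg
    · obtain ⟨a, rfl⟩ := hv
      simp only [U, extendSignal_apply hθg]
      exact hz (t, a)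
    · simp only [U, extendSignal_apply_of_notMem _ _ hv, abs_zero]
      linarith [hg.hasWeightSum.totalWeight_le hc v]
  let D : ℕ → V' → (ℕ × S → ℝ × ℝ) → ℝ≥0∞ := fun t a z =>
    ENNReal.ofReal |g.opinion c d r0 (U z) t (θ a) - h.opinion c d r0' (U' z) t a|
  have hDm : ∀ t a, Measurable (D t a) := by
    intro t a
    have h1 := (measurable_pi_apply (θ a)).comp
      (MarkedGraph.measurable_opinion c d (measurable_const (a := g)) (measurable_const (a := r0))
        hU t)
    have h2 := (measurable_pi_apply a).comp
      (MarkedGraph.measurable_opinion c d (measurable_const (a := h)) (measurable_const (a := r0'))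
        hU' t)
    exact ENNReal.measurable_ofReal.comp (measurable_norm.comp (h1.sub h2))
  -- the vertices at depth `j` are compared up to time `k - j` only, since the comparison also
  -- involves the inbound neighbours, which have to lie in `S`
  have hD : ∀ t j, j + t ≤ k → ∀ a ∈ h.inComp o j,
      ∫⁻ z, D t a z ∂Q ≤ ENNReal.ofReal (stepConst K t * ε) := by
    intro t
    induction t with
    | zero =>
      intro j hj a ha
      simp only [D, MarkedGraph.opinion, lintegral_const, measure_univ, mul_one, stepConst, one_mul]
      exact ENNReal.ofReal_le_ofReal (hinit a (MarkedGraph.inComp_mono h o (by omega) ha))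
    | succ t ih =>
      intro j hj a ha
      have haS : a ∈ S := MarkedGraph.inComp_mono h o (by omega) ha
      let B : (ℕ × S → ℝ × ℝ) → ℝ≥0∞ := fun z => edist (z (t, ⟨a, haS⟩)).1 (z (t, ⟨a, haS⟩)).2
      have hB : Measurable B := by fun_prop
      have hBint : ∫⁻ z, B z ∂Q ≤ ENNReal.ofReal ((K + 1) * ε) := by
        refine le_trans (le_of_eq ?_) (hcost ⟨a, haS⟩)
        have h4 : Q.map (fun z => z (t, ⟨a, haS⟩)) = π ⟨a, haS⟩ :=
          Measure.infinitePi_map_eval _ (t, (⟨a, haS⟩ : S))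
        rw [← h4, lintegral_map (by fun_prop) (by fun_prop)]
      have hpt : ∀ᵐ z ∂Q, D (t + 1) a z ≤ (ENNReal.ofReal ε +
          ∑ r ∈ Finset.range (h.mark a).deg,
            ENNReal.ofReal ((h.mark a).weight r) * D t (h.nbr a r) z +
          ENNReal.ofReal (1 - c - d) * D t a z) + B z := by
        filter_upwards [hbdd] with z hz
        have h1 := abs_avg_sub_avg_le (c := c) (d := d) hε1 hcd (hrho a haS)
          (hnbr j (by omega) a ha) (hz t) (h.opinion c d r0' (U' z) t)
        have h2 : |g.opinion c d r0 (U z) (t + 1) (θ a) - h.opinion c d r0' (U' z) (t + 1) a| ≤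
            (ε + ∑ r ∈ Finset.range (h.mark a).deg, (h.mark a).weight r *
              |g.opinion c d r0 (U z) t (θ (h.nbr a r)) -
                h.opinion c d r0' (U' z) t (h.nbr a r)|
            + (1 - c - d) * |g.opinion c d r0 (U z) t (θ a) - h.opinion c d r0' (U' z) t a|)
            + |(z (t, ⟨a, haS⟩)).1 - (z (t, ⟨a, haS⟩)).2| := by
          have e1 : U z (t, θ a) = (z (t, ⟨a, haS⟩)).1 :=
            extendSignal_apply hθg (fun p => (z p).1) t ⟨a, haS⟩
          have e2 : U' z (t, a) = (z (t, ⟨a, haS⟩)).2 :=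
            extendSignal_apply hθh (fun p => (z p).2) t ⟨a, haS⟩
          simp only [MarkedGraph.opinion, e1, e2]
          refine le_trans (le_of_eq ?_) ((abs_add_le _ _).trans (add_le_add h1 le_rfl))
          congr 1
          ring
        have hnn : ∀ r ∈ Finset.range (h.mark a).deg, 0 ≤ (h.mark a).weight r *
              |g.opinion c d r0 (U z) t (θ (h.nbr a r)) -
                h.opinion c d r0' (U' z) t (h.nbr a r)| :=
          fun r _ => mul_nonneg (Mark.weight_nonneg _ _) (abs_nonneg _)
        have h0 : 0 ≤ 1 - c - d := by linarith
        refine (ENNReal.ofReal_le_ofReal h2).trans (le_of_eq ?_)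
        rw [ENNReal.ofReal_add (add_nonneg (add_nonneg hε0.le (Finset.sum_nonneg hnn))
            (mul_nonneg h0 (abs_nonneg _))) (abs_nonneg _),
          ENNReal.ofReal_add (add_nonneg hε0.le (Finset.sum_nonneg hnn))
            (mul_nonneg h0 (abs_nonneg _)), ENNReal.ofReal_add hε0.le (Finset.sum_nonneg hnn),
          ENNReal.ofReal_sum_of_nonneg hnn, ENNReal.ofReal_mul h0]
        simp only [B, D, edist_dist, Real.dist_eq, ENNReal.ofReal_mul (Mark.weight_nonneg _ _)]
      have hM := stepConst_nonneg K t
      -- nothing is assumed about the weights of `h`: the bound is inherited from `g`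
      have hw : ∑ r ∈ Finset.range (h.mark a).deg, (h.mark a).weight r ≤ c + ε := by
        have hdeg := Mark.deg_eq_of_rho_lt_one ((hrho a haS).trans_lt hε1)
        have h1 := Mark.sum_abs_weight_sub_le (hrho a haS) (h.mark a).deg
        have h2 := hg.hasWeightSum.totalWeight_le hc (θ a)
        rw [Mark.totalWeight, hdeg] at h2
        have h3 : ∑ r ∈ Finset.range (h.mark a).deg, (h.mark a).weight r ≤
            ∑ r ∈ Finset.range (h.mark a).deg, ((g.mark (θ a)).weight r +
              |(g.mark (θ a)).weight r - (h.mark a).weight r|) :=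
          Finset.sum_le_sum fun r _ => by
            linarith [neg_abs_le ((g.mark (θ a)).weight r - (h.mark a).weight r)]
        rw [Finset.sum_add_distrib] at h3
        linarith
      calc ∫⁻ z, D (t + 1) a z ∂Q ≤ _ := lintegral_mono_ae hpt
        _ = (ENNReal.ofReal ε + ∑ r ∈ Finset.range (h.mark a).deg,
              ENNReal.ofReal ((h.mark a).weight r) * ∫⁻ z, D t (h.nbr a r) z ∂Q +
              ENNReal.ofReal (1 - c - d) * ∫⁻ z, D t a z ∂Q) + ∫⁻ z, B z ∂Q := by
          rw [lintegral_add_right _ hB, lintegral_add_right _ ((hDm t a).const_mul _),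
            lintegral_add_left measurable_const, lintegral_finsetSum _
              (fun r _ => (hDm t _).const_mul _), lintegral_const_mul _ (hDm t a)]
          simp only [lintegral_const, measure_univ, mul_one, lintegral_const_mul _ (hDm t _)]
        _ ≤ (ENNReal.ofReal ε + ∑ r ∈ Finset.range (h.mark a).deg,
              ENNReal.ofReal ((h.mark a).weight r) * ENNReal.ofReal (stepConst K t * ε) +
              ENNReal.ofReal (1 - c - d) * ENNReal.ofReal (stepConst K t * ε)) +
              ENNReal.ofReal ((K + 1) * ε) := by
          gcongr with r hr
          · exact ih (j + 1) (by omega) _ (MarkedGraph.nbr_mem_inComp ha (Finset.mem_range.1 hr))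
          · exact ih j (by omega) a ha
        _ = ENNReal.ofReal (ε + (∑ r ∈ Finset.range (h.mark a).deg, (h.mark a).weight r) *
              (stepConst K t * ε) + (1 - c - d) * (stepConst K t * ε) + (K + 1) * ε) := by
          have h0 : 0 ≤ 1 - c - d := by linarith
          have h1 : 0 ≤ ∑ r ∈ Finset.range (h.mark a).deg, (h.mark a).weight r :=
            Finset.sum_nonneg fun r _ => Mark.weight_nonneg _ _
          rw [ENNReal.ofReal_add (by positivity) (by positivity),
            ENNReal.ofReal_add (by positivity) (by positivity),
            ENNReal.ofReal_add (by positivity) (by positivity), ENNReal.ofReal_mul h1,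
            ENNReal.ofReal_mul h0, ENNReal.ofReal_sum_of_nonneg
              (fun r _ => Mark.weight_nonneg _ _), Finset.sum_mul]
        _ ≤ _ := by
          refine ENNReal.ofReal_le_ofReal ?_
          have h1 : (∑ r ∈ Finset.range (h.mark a).deg, (h.mark a).weight r) *
              (stepConst K t * ε) ≤ (c + ε) * (stepConst K t * ε) :=
            mul_le_mul_of_nonneg_right hw (by positivity)
          have h2 : (1 + ε - d) * (stepConst K t * ε) ≤ 2 * (stepConst K t * ε) :=
            mul_le_mul_of_nonneg_right (by linarith) (by positivity)
          simp only [stepConst]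
          nlinarith
  calc _ ≤ ∫⁻ z, ∑ t : Fin (k + 1), D t o z ∂Q := by
        refine lintegral_mono fun z => ?_
        simp only [D]
        rw [← ENNReal.ofReal_sum_of_nonneg fun _ _ => abs_nonneg _]
        refine ENNReal.ofReal_le_ofReal ((dist_pi_le_iff (Finset.sum_nonneg
          fun _ _ => abs_nonneg _)).2 fun r => ?_)
        rw [Real.dist_eq]
        exact Finset.single_le_sum (f := fun t : Fin (k + 1) =>
          |g.opinion c d r0 (U z) t (θ o) - h.opinion c d r0' (U' z) t o|)
          (fun _ _ => abs_nonneg _) (Finset.mem_univ r)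
    _ = ∑ t : Fin (k + 1), ∫⁻ z, D t o z ∂Q := lintegral_finsetSum _ fun t _ => hDm t o
    _ ≤ ∑ t : Fin (k + 1), ENNReal.ofReal (stepConst K t * ε) :=
        Finset.sum_le_sum fun t _ => hD t 0 (by have := t.2; omega) o
          (MarkedGraph.mem_inComp_self h o 0)
    _ = _ := by
        rw [pathConst, Finset.sum_mul, ENNReal.ofReal_sum_of_nonneg]
        exact fun t _ => mul_nonneg (stepConst_nonneg _ _) hε0.le

end Comparison

/-! ### Averages over a uniform vertex -/

section UnifVertex

instance (n : ℕ) : IsProbabilityMeasure (unifVertex n) := by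
  unfold unifVertex
  exact isProbabilityMeasure_uniformOn Set.finite_univ Set.univ_nonempty

theorem unifVertex_eq (n : ℕ) :
    unifVertex n = ((n : ℝ≥0∞) + 1)⁻¹ • (Measure.count : Measure (Fin (n + 1))) := by
  ext s _
  rw [unifVertex, uniformOn_univ, Measure.smul_apply, smul_eq_mul, ENNReal.div_eq_inv_mul]
  simp

theorem integral_unifVertex (n : ℕ) (F : Fin (n + 1) → ℝ) :
    ∫ i, F i ∂unifVertex n = 1 / ((n : ℝ) + 1) * ∑ i, F i := by
  rw [unifVertex_eq, integral_smul_measure, integral_count, smul_eq_mul, ENNReal.toReal_inv,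
    ENNReal.toReal_add (by simp) (by simp)]
  simp

end UnifVertex

/-! ### Means of functions of the opinions -/

section PathMean

variable {A : Type u} [MeasurableSpace A] {V : Type v}

/-- The mean of `f` at the opinions of the vertex `i` at the times `0, …, k`, for a fixed marked
graph and fixed initial opinions. -/
noncomputable def pathMean (ν : Kernel (Mark A) ℝ) [IsMarkovKernel ν] (c d : ℝ)
    (g : MarkedGraph V A) (r0 : V → ℝ) {k : ℕ} (f : (Fin (k + 1) → ℝ) → ℝ) (i : V) : ℝ :=
  ∫ w, f (g.opinionPath c d r0 w k i) ∂signalLaw ν g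

variable {ν : Kernel (Mark A) ℝ} [IsMarkovKernel ν] {c d : ℝ}

theorem abs_pathMean_le {g : MarkedGraph V A} {r0 : V → ℝ} {k : ℕ}
    {f : (Fin (k + 1) → ℝ) → ℝ} {B : ℝ} (hB : ∀ x, |f x| ≤ B) (i : V) :
    |pathMean ν c d g r0 f i| ≤ B := by
  have := norm_integral_le_of_norm_le_const (μ := signalLaw ν g)
    (f := fun w => f (g.opinionPath c d r0 w k i)) (C := B) (ae_of_all _ fun _ => hB _)
  simpa [pathMean] using this

variable [MeasurableSpace V]

theorem measurable_integral_signalLaw {α : Type*} [MeasurableSpace α] {g : α → MarkedGraph V A}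
    (hg : Measurable g) {F : α → (ℕ × V → ℝ) → ℝ} (hF : Measurable (Function.uncurry F)) :
    Measurable fun x => ∫ w, F x w ∂signalLaw ν (g x) :=
  (StronglyMeasurable.integral_kernel_prod_right' (κ := (signalKernel ν).comap g hg)
    hF.stronglyMeasurable).measurable

variable [Countable V] [MeasurableSingletonClass V]

theorem measurable_pathMean {α : Type*} [MeasurableSpace α] {g : α → MarkedGraph V A}
    {r0 : α → V → ℝ} {i : α → V} (hg : Measurable g) (hr : Measurable r0) (hi : Measurable i)
    {k : ℕ} {f : (Fin (k + 1) → ℝ) → ℝ} (hf : Measurable f) :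
    Measurable fun x => pathMean ν c d (g x) (r0 x) f (i x) :=
  measurable_integral_signalLaw hg (hf.comp (MarkedGraph.measurable_opinionPath c d
    (hg.comp measurable_fst) (hr.comp measurable_fst) measurable_snd k (hi.comp measurable_fst)))

/-- The opinions of two vertices with disjoint in-components are independent. -/
theorem integral_mul_opinionPath {g : MarkedGraph V A} {r0 : V → ℝ} {k : ℕ} {i j : V}
    (hij : Disjoint (g.inComp i k) (g.inComp j k)) {f : (Fin (k + 1) → ℝ) → ℝ}
    (hf : Measurable f) :
    ∫ w, f (g.opinionPath c d r0 w k i) * f (g.opinionPath c d r0 w k j) ∂signalLaw ν g =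
      pathMean ν c d g r0 f i * pathMean ν c d g r0 f j := by
  let e₁ : ℕ × g.inComp i k → ℕ × V := fun p => (p.1, p.2)
  let e₂ : ℕ × g.inComp j k → ℕ × V := fun p => (p.1, p.2)
  have h₁ : Function.Injective e₁ := Function.injective_id.prodMap Subtype.val_injective
  have h₂ : Function.Injective e₂ := Function.injective_id.prodMap Subtype.val_injective
  have hdisj : Disjoint (Set.range e₁) (Set.range e₂) := by
    rw [Set.disjoint_left]
    rintro _ ⟨⟨t, a⟩, rfl⟩ ⟨⟨s, b⟩, hb⟩
    have hb' : (b : V) = a := congrArg Prod.snd hb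
    exact Set.disjoint_left.1 hij a.2 (hb' ▸ b.2)
  have hmap := infinitePi_map_prodMk (fun p : ℕ × V => ν (g.mark p.2)) h₁ h₂ hdisj
  have hm₁ : Measurable fun u => f (g.opinionPath c d r0 (extendSignal (Subtype.val :
      g.inComp i k → V) u) k i) := hf.comp (MarkedGraph.measurable_opinionPath c d measurable_const
      measurable_const (measurable_extendSignal Subtype.val_injective) k measurable_const)
  have hm₂ : Measurable fun u => f (g.opinionPath c d r0 (extendSignal (Subtype.val :
      g.inComp j k → V) u) k j) := hf.comp (MarkedGraph.measurable_opinionPath c d measurable_const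
      measurable_const (measurable_extendSignal Subtype.val_injective) k measurable_const)
  rw [pathMean, pathMean,
    integral_opinionPath_eq ν Subtype.val_injective (S := g.inComp i k) (by simp) r0 hf,
    integral_opinionPath_eq ν Subtype.val_injective (S := g.inComp j k) (by simp) r0 hf,
    ← integral_prod_mul, ← hmap, integral_map (Measurable.aemeasurable (by fun_prop))]
  · refine integral_congr_ae (ae_of_all _ fun w => ?_)
    simp only [e₁, e₂]
    rw [opinionPath_extendSignal Subtype.val_injective (by simp),
      opinionPath_extendSignal Subtype.val_injective (by simp)]
  · exact ((hm₁.comp measurable_fst).mul (hm₂.comp measurable_snd)).aestronglyMeasurable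

end PathMean

/-- A bounded uniformly continuous function is Lipschitz up to an arbitrarily small error. -/
theorem exists_modulus {E : Type*} [PseudoMetricSpace E] {f : E → ℝ} {B : ℝ}
    (hB : ∀ x, |f x| ≤ B) (hf : UniformContinuous f) {η : ℝ} (hη : 0 < η) :
    ∃ L : ℝ, 0 ≤ L ∧ ∀ x y, |f x - f y| ≤ η + L * dist x y := by
  obtain ⟨δ, hδ, h⟩ := Metric.uniformContinuous_iff.1 hf η hη
  refine ⟨2 * |B| / δ, by positivity, fun x y => ?_⟩
  rcases lt_or_ge (dist x y) δ with hxy | hxy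
  · have := h hxy
    rw [Real.dist_eq] at this
    have h2 : 0 ≤ 2 * |B| / δ * dist x y := by positivity
    linarith
  · have h1 : |f x - f y| ≤ 2 * |B| := by
      refine (abs_sub _ _).trans ?_
      linarith [hB x, hB y, le_abs_self B]
    have h2 : 2 * |B| ≤ 2 * |B| / δ * dist x y := by
      rw [div_mul_eq_mul_div, le_div_iff₀ hδ]
      gcongr
    linarith

section Compare

variable {A : Type u} [MetricSpace A] [MeasurableSpace A] {V : Type v} {V' : Type w}
  [Countable V] [MeasurableSpace V] [MeasurableSingletonClass V]
  [Countable V'] [MeasurableSpace V'] [MeasurableSingletonClass V']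

/-- Coupled vertices have nearly the same mean of a function of the opinions. -/
theorem abs_pathMean_sub_le {ν : Kernel (Mark A) ℝ} [IsMarkovKernel ν] {K : ℝ≥0} {c d : ℝ}
    (hLip : ∀ x y : Mark A, wasserstein1 (ν x) (ν y) ≤ ENNReal.ofReal (K * Mark.rho x y))
    (hc : 0 ≤ c) (hd : 0 < d) (hcd : c + d ≤ 1) {g : MarkedGraph V A} {h : MarkedGraph V' A}
    (hg : Admissible ν c d g) {r0 : V → ℝ} {r0' : V' → ℝ} (hr0 : ∀ i, |r0 i| ≤ 1)
    {i : V} {o : V'} {k : ℕ} {ε : ℝ} (hε0 : 0 < ε) (hε1 : ε < 1)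
    (hcoup : (g.withInitial r0).Coupled i (h.withInitial r0') o k ε)
    {f : (Fin (k + 1) → ℝ) → ℝ} {B η L : ℝ} (hf : Measurable f) (hB : ∀ x, |f x| ≤ B)
    (hL : 0 ≤ L) (hmod : ∀ x y, |f x - f y| ≤ η + L * dist x y) :
    |pathMean ν c d g r0 f i - pathMean ν c d h r0' f o| ≤ η + L * (pathConst K k * ε) := by
  obtain ⟨T, _, Q, _, X, Y, hX, hY, hgX, hhY, hdist⟩ :=
    exists_coupling_opinionPath hLip hc hd hcd hg hr0 hε0 hε1 hcoup
  have hM := pathConst_nonneg K k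
  have hint : ∀ {Z : T → Fin (k + 1) → ℝ}, Measurable Z → Integrable (fun z => f (Z z)) Q :=
    fun hZ => Integrable.of_bound (hf.comp hZ).aestronglyMeasurable B (ae_of_all _ fun _ => hB _)
  have hdm : Measurable fun z => dist (X z) (Y z) := hX.dist hY
  have hdi : Integrable (fun z => dist (X z) (Y z)) Q := by
    refine ⟨hdm.aestronglyMeasurable, ?_⟩
    rw [hasFiniteIntegral_iff_ofReal (ae_of_all _ fun _ => dist_nonneg)]
    exact hdist.trans_lt ENNReal.ofReal_lt_top
  have hdle : ∫ z, dist (X z) (Y z) ∂Q ≤ pathConst K k * ε := by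
    rw [integral_eq_lintegral_of_nonneg_ae (ae_of_all _ fun _ => dist_nonneg)
      hdm.aestronglyMeasurable]
    exact ENNReal.toReal_le_of_le_ofReal (by positivity) hdist
  rw [pathMean, pathMean, hgX f hf, hhY f hf, ← integral_sub (hint hX) (hint hY)]
  calc _ ≤ ∫ z, |f (X z) - f (Y z)| ∂Q := abs_integral_le_integral_abs
    _ ≤ ∫ z, (η + L * dist (X z) (Y z)) ∂Q := by
        refine integral_mono ((hint hX).sub (hint hY)).abs
          ((integrable_const _).add (hdi.const_mul _)) fun z => hmod _ _
    _ = η + L * ∫ z, dist (X z) (Y z) ∂Q := by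
        rw [integral_add (integrable_const _) (hdi.const_mul _), integral_const,
          integral_const_mul]
        simp
    _ ≤ _ := by gcongr

end Compare

/-! ### Strong couplings -/

section Coupling

/-- The marked graph without the initial opinions. -/
def MarkedGraph.dropInitial {A : Type u} {V : Type w} (g : MarkedGraph V (A × ℝ)) :
    MarkedGraph V A := fun i =>
  ((((g i).1.1.1.1, (g i).1.1.2), (g i).1.2), (g i).2)

/-- The initial opinions which are part of the generic attributes. -/
def MarkedGraph.initial {A : Type u} {V : Type w} (g : MarkedGraph V (A × ℝ)) : V → ℝ := fun i =>
  (g i).1.1.1.2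

theorem MarkedGraph.measurable_dropInitial {A : Type u} [MeasurableSpace A] {V : Type w}
    [MeasurableSpace V] :
    Measurable (dropInitial : MarkedGraph V (A × ℝ) → MarkedGraph V A) :=
  measurable_pi_lambda _ fun i => by unfold dropInitial; fun_prop

theorem MarkedGraph.measurable_initial {A : Type u} [MeasurableSpace A] {V : Type w}
    [MeasurableSpace V] :
    Measurable (initial : MarkedGraph V (A × ℝ) → V → ℝ) :=
  measurable_pi_lambda _ fun i => by unfold initial; fun_prop

/-- If conditional probabilities tend to one in probability, so do the probabilities. -/
theorem tendsto_measure_compl_of_condExp {Ω : ℕ → Type v} {m m0 : ∀ n, MeasurableSpace (Ω n)}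
    {Q : ∀ n, Measure (Ω n)} [∀ n, IsProbabilityMeasure (Q n)]
    {E : ∀ n, Set (Ω n)}
    (h : TendstoInProb Q (fun n => (Q n)[(E n).indicator (fun _ => (1 : ℝ)) | m n]) 1) :
    Tendsto (fun n => Q n (E n)ᶜ) atTop (𝓝 0) := by
  rw [ENNReal.tendsto_nhds_zero]
  intro δ hδ
  obtain ⟨γ, hγ0, hγδ⟩ : ∃ γ : ℝ, 0 < γ ∧ ENNReal.ofReal (2 * γ) ≤ δ ∧ γ < 1 := by
    obtain ⟨x, hx0, hxδ⟩ := ENNReal.lt_iff_exists_nnreal_btwn.1 hδ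
    have hx : 0 < (x : ℝ) := by exact_mod_cast hx0
    refine ⟨min (x / 2) (1 / 2), by positivity, ?_, by
      exact (min_le_right _ _).trans_lt (by norm_num)⟩
    refine le_trans (ENNReal.ofReal_le_ofReal (q := x) ?_) (by simpa using hxδ.le)
    linarith [min_le_left ((x : ℝ) / 2) (1 / 2)]
  have h1 := (ENNReal.tendsto_nhds_zero.1 (h γ hγ0)) (ENNReal.ofReal γ)
    (ENNReal.ofReal_pos.2 hγ0)
  filter_upwards [h1] with n hn
  refine le_trans ?_ hγδ.1
  set ind : Ω n → ℝ := (E n).indicator (fun _ => (1 : ℝ)) with hind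
  -- were the conditional probability a junk value, it would vanish identically
  have hne : (Q n)[ind | m n] ≠ 0 := by
    intro h0
    rw [h0] at hn
    have : {ω : Ω n | γ ≤ |(0 : Ω n → ℝ) ω - 1|} = Set.univ := by
      ext ω; simp [hγδ.2.le]
    rw [this, measure_univ] at hn
    exact absurd hn (not_le.2 (ENNReal.ofReal_lt_one.2 hγδ.2))
  have hm : m n ≤ m0 n := by
    by_contra hcon
    exact hne (condExp_of_not_le hcon)
  have hi : Integrable ind (Q n) := by
    by_contra hcon
    exact hne (condExp_of_not_integrable hcon)
  have hE : NullMeasurableSet (E n) (Q n) :=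
    (aemeasurable_indicator_const_iff (1 : ℝ)).1 hi.1.aemeasurable
  have hnn : 0 ≤ᵐ[Q n] (Q n)[ind | m n] :=
    condExp_nonneg (ae_of_all _ fun ω => Set.indicator_nonneg (fun _ _ => zero_le_one) ω)
  set S : Set (Ω n) := {ω | γ ≤ |(Q n)[ind | m n] ω - 1|} with hS
  have hSm : MeasurableSet S := by
    have hcm : Measurable ((Q n)[ind | m n]) := (stronglyMeasurable_condExp.mono hm).measurable
    exact measurableSet_le measurable_const (measurable_norm.comp (hcm.sub_const 1))
  have hreal : (Q n).real (E n)ᶜ ≤ γ + (Q n).real S := by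
    have e1 : ∫ ω, (Q n)[ind | m n] ω ∂(Q n) = (Q n).real (E n) := by
      rw [integral_condExp hm, hind, integral_indicator₀ hE]; simp
    have e2 : (Q n).real (E n)ᶜ = ∫ ω, (1 - (Q n)[ind | m n] ω) ∂(Q n) := by
      rw [integral_sub (integrable_const _) integrable_condExp, e1]
      rw [probReal_compl_eq_one_sub₀ hE]; simp
    rw [e2]
    calc _ ≤ ∫ ω, (γ + S.indicator (fun _ => (1 : ℝ)) ω) ∂(Q n) := by
          refine integral_mono_ae ((integrable_const _).sub integrable_condExp)
            ((integrable_const _).add ((integrable_const _).indicator hSm)) ?_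
          filter_upwards [hnn] with ω hω
          by_cases hωS : ω ∈ S
          · simp only [Set.indicator_of_mem hωS]
            have : (0 : ℝ) ≤ (Q n)[ind | m n] ω := hω
            linarith
          · simp only [Set.indicator_of_notMem hωS]
            have : |(Q n)[ind | m n] ω - 1| < γ := not_le.1 hωS
            linarith [neg_abs_le ((Q n)[ind | m n] ω - 1)]
      _ = γ + (Q n).real S := by
          rw [integral_add (integrable_const _) ((integrable_const _).indicator hSm),
            integral_indicator hSm]
          simp
  have hS2 : (Q n).real S ≤ γ := ENNReal.toReal_le_of_le_ofReal hγ0.le hn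
  rw [← ofReal_measureReal]
  exact ENNReal.ofReal_le_ofReal (by linarith)

variable {A : Type u} [MetricSpace A]

/-- For every depth and precision, two independent uniform vertices can be coupled with two
independent copies of a random marked graph in such a way that, with probability tending to one, the
in-components of the vertices are disjoint and close to those of the roots of the copies. The limit
is given by functions `h` (the graph) and `r` (the initial opinions) on a space `(H, Γ)`, so that
one notion covers limits with and without initial opinions. -/
def PairCoupling {Ω : ℕ → Type v} [∀ n, MeasurableSpace (Ω n)] (P : ∀ n, Measure (Ω n))
    (G : ∀ n, Ω n → MarkedGraph (Fin (n + 1)) A) (R0 : ∀ n, Ω n → Fin (n + 1) → ℝ)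
    {H : Type w} [MeasurableSpace H] (Γ : Measure H) (h : H → MarkedGraph ℕ A) (r : H → ℕ → ℝ) :
    Prop :=
  ∀ (k : ℕ) (ε : ℝ), 0 < ε →
    ∃ Q : ∀ n, Measure (Ω n × ((Fin (n + 1) × Fin (n + 1)) × (H × H))),
      (∀ n, (Q n).map (fun z => (z.1, z.2.1)) =
        (P n).prod ((unifVertex n).prod (unifVertex n))) ∧
      (∀ n, (Q n).map (fun z => z.2.2) = Γ.prod Γ) ∧
      Tendsto (fun n => Q n {z |
        ((G n z.1).withInitial (R0 n z.1)).Coupled z.2.1.1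
          ((h z.2.2.1).withInitial (r z.2.2.1)) 0 k ε ∧
        ((G n z.1).withInitial (R0 n z.1)).Coupled z.2.1.2
          ((h z.2.2.2).withInitial (r z.2.2.2)) 0 k ε ∧
        Disjoint ((G n z.1).inComp z.2.1.1 k) ((G n z.1).inComp z.2.1.2 k)}ᶜ) atTop (𝓝 0)

theorem MarkedGraph.Coupled.withInitial_zero {V : Type*} {V' : Type*} {g : MarkedGraph V A}
    {h : MarkedGraph V' A} {i : V} {o : V'} {k : ℕ} {ε : ℝ} (hcoup : g.Coupled i h o k ε) :
    (g.withInitial fun _ => 0).Coupled i (h.withInitial fun _ => 0) o k ε := by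
  obtain ⟨θ, h1, h2, h3, h4⟩ := hcoup
  refine ⟨θ, ?_, h2, ?_, ?_⟩
  · rwa [MarkedGraph.inComp_withInitial, MarkedGraph.inComp_withInitial]
  · rw [MarkedGraph.inComp_withInitial]; exact h3
  · rw [MarkedGraph.inComp_withInitial]
    intro a ha
    refine le_trans (le_of_eq ?_) (h4 a ha)
    unfold Mark.rho
    have : dist ((g.withInitial fun _ => 0).mark (θ a)).attr.1
        ((h.withInitial fun _ => 0).mark a).attr.1 =
        dist (g.mark (θ a)).attr.1 (h.mark a).attr.1 := by
      change max _ (dist (0 : ℝ) 0) = _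
      rw [dist_self]
      exact max_eq_left dist_nonneg
    rw [this]
    rfl

variable [MeasurableSpace A]

variable {Ω : ℕ → Type v} [∀ n, MeasurableSpace (Ω n)] {P : ∀ n, Measure (Ω n)}
  [∀ n, IsProbabilityMeasure (P n)] {F : ℕ → Type u} [∀ n, MeasurableSpace (F n)]
  {Y : ∀ n, Ω n → F n} {G : ∀ n, Ω n → MarkedGraph (Fin (n + 1)) A}

/-- The coupling of two vertices, with an unconditional probability. -/
theorem StrongCoupling.exists_pair {B : Type u} [MetricSpace B] [MeasurableSpace B]
    {G : ∀ n, Ω n → MarkedGraph (Fin (n + 1)) B}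
    {Γ : Measure (MarkedGraph ℕ B)} (hS : StrongCoupling P Y G Γ) (k : ℕ) {ε : ℝ} (hε : 0 < ε) :
    ∃ Q : ∀ n, Measure (Ω n × ((Fin (n + 1) × Fin (n + 1)) × (MarkedGraph ℕ B × MarkedGraph ℕ B))),
      (∀ n, (Q n).map (fun z => (z.1, z.2.1)) =
        (P n).prod ((unifVertex n).prod (unifVertex n))) ∧
      (∀ n, (Q n).map (fun z => z.2.2) = Γ.prod Γ) ∧
      Tendsto (fun n => Q n {z |
        (G n z.1).Coupled z.2.1.1 z.2.2.1 0 k ε ∧ (G n z.1).Coupled z.2.1.2 z.2.2.2 0 k ε ∧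
        Disjoint ((G n z.1).inComp z.2.1.1 k) ((G n z.1).inComp z.2.1.2 k)}ᶜ) atTop (𝓝 0) := by
  obtain ⟨Q, h1, h2, h3⟩ := hS.two_vertices k ε hε
  have : ∀ n, IsProbabilityMeasure (Q n) := fun n => by
    have : IsProbabilityMeasure ((Q n).map (fun z => (z.1, z.2.1))) := by
      rw [h1 n]; infer_instance
    exact Measure.isProbabilityMeasure_of_map (fun z => (z.1, z.2.1))
  exact ⟨Q, h1, h2, tendsto_measure_compl_of_condExp h3⟩

/-- Initial opinions that vanish on both sides cost nothing. -/
theorem StrongCoupling.pairCoupling_zero {Γ : Measure (MarkedGraph ℕ A)}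
    (hS : StrongCoupling P Y G Γ) :
    PairCoupling P G (fun _ _ _ => 0) Γ id (fun _ _ => 0) := by
  intro k ε hε
  obtain ⟨Q, h1, h2, h3⟩ := hS.exists_pair k hε
  refine ⟨Q, h1, h2, tendsto_of_tendsto_of_tendsto_of_le_of_le tendsto_const_nhds h3
    (fun _ => zero_le) fun n => measure_mono (Set.compl_subset_compl.2 ?_)⟩
  rintro z ⟨hz1, hz2, hz3⟩
  exact ⟨hz1.withInitial_zero, hz2.withInitial_zero, hz3⟩

theorem StrongCoupling.pairCoupling_initial {R0 : ∀ n, Ω n → Fin (n + 1) → ℝ}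
    {Γ : Measure (MarkedGraph ℕ (A × ℝ))}
    (hS : StrongCoupling P Y (fun n ω => (G n ω).withInitial (R0 n ω)) Γ) :
    PairCoupling P G R0 Γ MarkedGraph.dropInitial MarkedGraph.initial := by
  intro k ε hε
  obtain ⟨Q, h1, h2, h3⟩ := hS.exists_pair k hε
  simp only [MarkedGraph.inComp_withInitial] at h3
  exact ⟨Q, h1, h2, h3⟩

end Coupling

/-! ### Convergence of the empirical distribution of the opinions -/

section Empirical

variable {A : Type u} [MeasurableSpace A]

/-- The second moment of an average over a uniform vertex, as a mean over two independent uniform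
vertices. -/
theorem lintegral_sq_average_eq {Ω : Type v} [MeasurableSpace Ω] {P : Measure Ω}
    [IsProbabilityMeasure P] (ν : Kernel (Mark A) ℝ) [IsMarkovKernel ν] {c d : ℝ} {n : ℕ}
    {G : Ω → MarkedGraph (Fin (n + 1)) A} (hG : Measurable G) {R0 : Ω → Fin (n + 1) → ℝ}
    (hR0 : Measurable R0) {k : ℕ} {F : (Fin (k + 1) → ℝ) → ℝ} (hF : Measurable F) {B : ℝ}
    (hB : ∀ x, |F x| ≤ B) :
    ∫⁻ ω, ∫⁻ w, ENNReal.ofReal ((∫ i, F ((G ω).opinionPath c d (R0 ω) w k i) ∂unifVertex n) ^ 2)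
        ∂signalLaw ν (G ω) ∂P =
      ENNReal.ofReal (∫ z : Ω × (Fin (n + 1) × Fin (n + 1)),
        (∫ w, F ((G z.1).opinionPath c d (R0 z.1) w k z.2.1) *
          F ((G z.1).opinionPath c d (R0 z.1) w k z.2.2) ∂signalLaw ν (G z.1))
        ∂P.prod ((unifVertex n).prod (unifVertex n))) := by
  have hB0 : 0 ≤ B := (abs_nonneg _).trans (hB 0)
  have hFF : ∀ x y, ‖F x * F y‖ ≤ B * B := fun x y => by
    rw [Real.norm_eq_abs, abs_mul]
    exact mul_le_mul (hB x) (hB y) (abs_nonneg _) hB0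
  have hinner : ∀ ω, ∫⁻ w, ENNReal.ofReal
      ((∫ i, F ((G ω).opinionPath c d (R0 ω) w k i) ∂unifVertex n) ^ 2) ∂signalLaw ν (G ω) =
      ENNReal.ofReal (∫ ij : Fin (n + 1) × Fin (n + 1),
        (∫ w, F ((G ω).opinionPath c d (R0 ω) w k ij.1) *
          F ((G ω).opinionPath c d (R0 ω) w k ij.2) ∂signalLaw ν (G ω))
        ∂(unifVertex n).prod (unifVertex n)) := by
    intro ω
    have hm : Measurable fun p : (ℕ × Fin (n + 1) → ℝ) × Fin (n + 1) =>
        F ((G ω).opinionPath c d (R0 ω) p.1 k p.2) :=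
      hF.comp (MarkedGraph.measurable_opinionPath c d measurable_const measurable_const
        measurable_fst k measurable_snd)
    have hm2 : Measurable fun p : (ℕ × Fin (n + 1) → ℝ) × (Fin (n + 1) × Fin (n + 1)) =>
        F ((G ω).opinionPath c d (R0 ω) p.1 k p.2.1) *
          F ((G ω).opinionPath c d (R0 ω) p.1 k p.2.2) :=
      (hm.comp (measurable_fst.prodMk (measurable_fst.comp measurable_snd))).mul
        (hm.comp (measurable_fst.prodMk (measurable_snd.comp measurable_snd)))
    have hsq : ∀ w, (∫ i, F ((G ω).opinionPath c d (R0 ω) w k i) ∂unifVertex n) ^ 2 =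
        ∫ ij : Fin (n + 1) × Fin (n + 1), F ((G ω).opinionPath c d (R0 ω) w k ij.1) *
          F ((G ω).opinionPath c d (R0 ω) w k ij.2) ∂(unifVertex n).prod (unifVertex n) := by
      intro w
      rw [integral_prod_mul (fun i => F ((G ω).opinionPath c d (R0 ω) w k i))
        (fun i => F ((G ω).opinionPath c d (R0 ω) w k i)), sq]
    have hint : Integrable (Function.uncurry fun (w : ℕ × Fin (n + 1) → ℝ)
        (ij : Fin (n + 1) × Fin (n + 1)) => F ((G ω).opinionPath c d (R0 ω) w k ij.1) *
          F ((G ω).opinionPath c d (R0 ω) w k ij.2))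
        ((signalLaw ν (G ω)).prod ((unifVertex n).prod (unifVertex n))) :=
      Integrable.of_bound hm2.aestronglyMeasurable (B * B) (ae_of_all _ fun _ => hFF _ _)
    rw [← integral_integral_swap hint, ofReal_integral_eq_lintegral_ofReal]
    · exact lintegral_congr fun w => by rw [hsq w]
    · exact hint.integral_prod_left
    · exact ae_of_all _ fun w => by simp only [← hsq w]; exact sq_nonneg _
  have hmJ : Measurable fun z : Ω × (Fin (n + 1) × Fin (n + 1)) =>
      ∫ w, F ((G z.1).opinionPath c d (R0 z.1) w k z.2.1) *
          F ((G z.1).opinionPath c d (R0 z.1) w k z.2.2) ∂signalLaw ν (G z.1) := by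
    refine measurable_integral_signalLaw (hG.comp measurable_fst) ?_
    refine Measurable.mul ?_ ?_
    · exact hF.comp (MarkedGraph.measurable_opinionPath c d
        (hG.comp (measurable_fst.comp measurable_fst))
        (hR0.comp (measurable_fst.comp measurable_fst)) measurable_snd k
        (measurable_fst.comp (measurable_snd.comp measurable_fst)))
    · exact hF.comp (MarkedGraph.measurable_opinionPath c d
        (hG.comp (measurable_fst.comp measurable_fst))
        (hR0.comp (measurable_fst.comp measurable_fst)) measurable_snd k
        (measurable_snd.comp (measurable_snd.comp measurable_fst)))
  have hJi : Integrable (fun z : Ω × (Fin (n + 1) × Fin (n + 1)) =>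
      ∫ w, F ((G z.1).opinionPath c d (R0 z.1) w k z.2.1) *
          F ((G z.1).opinionPath c d (R0 z.1) w k z.2.2) ∂signalLaw ν (G z.1))
      (P.prod ((unifVertex n).prod (unifVertex n))) := by
    refine Integrable.of_bound hmJ.aestronglyMeasurable (B * B) (ae_of_all _ fun z => ?_)
    refine (norm_integral_le_of_norm_le_const (ae_of_all _ fun w => hFF _ _)).trans ?_
    simp
  rw [integral_prod _ hJi, ofReal_integral_eq_lintegral_ofReal hJi.integral_prod_left]
  · exact lintegral_congr hinner
  · refine ae_of_all _ fun ω => ?_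
    have h1 : ∀ w, 0 ≤ (∫ i, F ((G ω).opinionPath c d (R0 ω) w k i) ∂unifVertex n) ^ 2 :=
      fun w => sq_nonneg _
    have hm : Measurable fun p : (ℕ × Fin (n + 1) → ℝ) × Fin (n + 1) =>
        F ((G ω).opinionPath c d (R0 ω) p.1 k p.2) :=
      hF.comp (MarkedGraph.measurable_opinionPath c d measurable_const measurable_const
        measurable_fst k measurable_snd)
    have hint : Integrable (Function.uncurry fun (w : ℕ × Fin (n + 1) → ℝ)
        (ij : Fin (n + 1) × Fin (n + 1)) => F ((G ω).opinionPath c d (R0 ω) w k ij.1) *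
          F ((G ω).opinionPath c d (R0 ω) w k ij.2))
        ((signalLaw ν (G ω)).prod ((unifVertex n).prod (unifVertex n))) :=
      Integrable.of_bound ((hm.comp (measurable_fst.prodMk
        (measurable_fst.comp measurable_snd))).mul (hm.comp (measurable_fst.prodMk
        (measurable_snd.comp measurable_snd)))).aestronglyMeasurable (B * B)
        (ae_of_all _ fun _ => hFF _ _)
    simp only [Pi.zero_apply]
    rw [← integral_integral_swap hint]
    refine integral_nonneg fun w => ?_
    simp only [Pi.zero_apply]
    rw [integral_prod_mul (fun i => F ((G ω).opinionPath c d (R0 ω) w k i))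
        (fun i => F ((G ω).opinionPath c d (R0 ω) w k i))]
    exact mul_self_nonneg _

theorem abs_integral_sub_le_of_compl {α : Type*} [MeasurableSpace α] {Q : Measure α}
    [IsProbabilityMeasure Q] {X Y : α → ℝ} (hX : Integrable X Q) (hY : Integrable Y Q)
    {E : Set α} {a b : ℝ} (ha : 0 ≤ a) (hE : ∀ᵐ z ∂Q, z ∈ E → |X z - Y z| ≤ a)
    (hb : ∀ z, |X z - Y z| ≤ b) :
    |∫ z, X z ∂Q - ∫ z, Y z ∂Q| ≤ a + b * Q.real Eᶜ := by
  have hb0 : 0 ≤ b := by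
    obtain ⟨z⟩ : Nonempty α := nonempty_of_isProbabilityMeasure Q
    exact (abs_nonneg _).trans (hb z)
  set S := toMeasurable Q Eᶜ
  have hS : MeasurableSet S := measurableSet_toMeasurable _ _
  rw [← integral_sub hX hY]
  calc _ ≤ ∫ z, |X z - Y z| ∂Q := abs_integral_le_integral_abs
    _ ≤ ∫ z, (a + S.indicator (fun _ => b) z) ∂Q := by
        refine integral_mono_ae (hX.sub hY).abs
          ((integrable_const _).add ((integrable_const _).indicator hS)) ?_
        filter_upwards [hE] with z hz
        by_cases hzE : z ∈ E
        · have : 0 ≤ S.indicator (fun _ => b) z := Set.indicator_nonneg (fun _ _ => hb0) z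
          linarith [hz hzE]
        · rw [Set.indicator_of_mem (subset_toMeasurable Q _ hzE)]
          linarith [hb z]
    _ = a + b * Q.real Eᶜ := by
        rw [integral_add (integrable_const _) ((integrable_const _).indicator hS),
          integral_indicator hS]
        simp only [integral_const, probReal_univ, smul_eq_mul, one_mul,
          measureReal_restrict_apply_univ]
        rw [mul_comm, measureReal_def, measure_toMeasurable, ← measureReal_def]

variable [MetricSpace A] {Ω : ℕ → Type v} [∀ n, MeasurableSpace (Ω n)] {P : ∀ n, Measure (Ω n)}
  [∀ n, IsProbabilityMeasure (P n)]
  {G : ∀ n, Ω n → MarkedGraph (Fin (n + 1)) A} {R0 : ∀ n, Ω n → Fin (n + 1) → ℝ}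
  {H : Type w} [MeasurableSpace H] {Γ : Measure H} [IsProbabilityMeasure Γ]
  {h : H → MarkedGraph ℕ A} {r : H → ℕ → ℝ}

/-- The averages over the vertices of a function of the opinions concentrate at its mean at the root
of the limit: two uniform vertices have asymptotically independent opinions. -/
theorem PairCoupling.tendsto_average (hpair : PairCoupling P G R0 Γ h r)
    {ν : Kernel (Mark A) ℝ} [IsMarkovKernel ν] {K : ℝ≥0} {c d : ℝ}
    (hLip : ∀ x y : Mark A, wasserstein1 (ν x) (ν y) ≤ ENNReal.ofReal (K * Mark.rho x y))
    (hc : 0 ≤ c) (hd : 0 < d) (hcd : c + d ≤ 1)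
    (hG : ∀ n, Measurable (G n)) (hR0 : ∀ n, Measurable (R0 n))
    (hadm : ∀ n, ∀ᵐ ω ∂(P n), Admissible ν c d (G n ω))
    (hbdd : ∀ n, ∀ᵐ ω ∂(P n), ∀ i, |R0 n ω i| ≤ 1) (hh : Measurable h) (hr : Measurable r)
    {k : ℕ} {f : (Fin (k + 1) → ℝ) → ℝ} (hf : UniformContinuous f) {B : ℝ}
    (hB : ∀ x, |f x| ≤ B) :
    Tendsto (fun n => ∫⁻ ω, ∫⁻ w, ENNReal.ofReal
      ((∫ i, f ((G n ω).opinionPath c d (R0 n ω) w k i) ∂unifVertex n -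
        ∫ x, pathMean ν c d (h x) (r x) f 0 ∂Γ) ^ 2) ∂signalLaw ν (G n ω) ∂(P n))
      atTop (𝓝 0) := by
  set m := ∫ x, pathMean ν c d (h x) (r x) f 0 ∂Γ with hm
  set F : (Fin (k + 1) → ℝ) → ℝ := fun x => f x - m with hF
  have hfm : Measurable f := hf.continuous.measurable
  have hFm : Measurable F := hfm.sub_const m
  set b := B + |m|
  have hFb : ∀ x, |F x| ≤ b := fun x => (abs_sub _ _).trans (add_le_add (hB x) le_rfl)
  have hb0 : 0 ≤ b := (abs_nonneg _).trans (hFb 0)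
  -- centering
  have hcenter : ∀ n ω (w : ℕ × Fin (n + 1) → ℝ),
      ∫ i, f ((G n ω).opinionPath c d (R0 n ω) w k i) ∂unifVertex n - m =
      ∫ i, F ((G n ω).opinionPath c d (R0 n ω) w k i) ∂unifVertex n := by
    intro n ω w
    simp only [hF]
    rw [integral_sub Integrable.of_finite (integrable_const _)]
    simp
  have hpm : Measurable fun x => pathMean ν c d (h x) (r x) F 0 :=
    measurable_pathMean hh hr measurable_const hFm
  have hmean : ∫ x, pathMean ν c d (h x) (r x) F 0 ∂Γ = 0 := by
    have h1 : ∀ x, pathMean ν c d (h x) (r x) F 0 = pathMean ν c d (h x) (r x) f 0 - m := by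
      intro x
      have h2 : Integrable (fun w => f ((h x).opinionPath c d (r x) w k 0))
          (signalLaw ν (h x)) :=
        Integrable.of_bound (hfm.comp (MarkedGraph.measurable_opinionPath c d
          measurable_const measurable_const measurable_id k measurable_const)).aestronglyMeasurable
          B (ae_of_all _ fun _ => hB _)
      simp only [pathMean, hF]
      rw [integral_sub h2 (integrable_const _)]
      simp
    have h3 : Integrable (fun x => pathMean ν c d (h x) (r x) f 0) Γ :=
      Integrable.of_bound (measurable_pathMean hh hr measurable_const
        hfm).aestronglyMeasurable B (ae_of_all _ fun x => abs_pathMean_le hB _)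
    simp only [h1]
    rw [integral_sub h3 (integrable_const _), ← hm]
    simp
  simp only [hcenter]
  rw [ENNReal.tendsto_nhds_zero]
  intro δ hδ
  obtain ⟨γ, hγ0, hγδ⟩ : ∃ γ : ℝ, 0 < γ ∧ ENNReal.ofReal γ ≤ δ := by
    obtain ⟨x, hx0, hxδ⟩ := ENNReal.lt_iff_exists_nnreal_btwn.1 hδ
    exact ⟨x, by exact_mod_cast hx0, by simpa using hxδ.le⟩
  -- the modulus and the precision of the coupling
  obtain ⟨η, hη0, hη⟩ : ∃ η : ℝ, 0 < η ∧ 2 * b * η ≤ γ / 3 := by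
    refine ⟨γ / (6 * (b + 1)), by positivity, ?_⟩
    rw [mul_div_assoc', div_le_iff₀ (by positivity)]
    nlinarith
  obtain ⟨L, hL0, hL⟩ := exists_modulus hB hf hη0
  have hLF : ∀ x y, |F x - F y| ≤ η + L * dist x y := fun x y => by
    simp only [hF, sub_sub_sub_cancel_right]; exact hL x y
  have hM := pathConst_nonneg K k
  obtain ⟨ε, hε0, hε1, hε⟩ : ∃ ε : ℝ, 0 < ε ∧ ε < 1 ∧
      2 * b * (L * (pathConst K k * ε)) ≤ γ / 3 := by
    set q := 2 * b * (L * pathConst K k) with hq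
    have hq0 : 0 ≤ q := by positivity
    refine ⟨min (1 / 2) (γ / (3 * (q + 1))), by positivity,
      (min_le_left _ _).trans_lt (by norm_num), ?_⟩
    calc _ = q * min (1 / 2) (γ / (3 * (q + 1))) := by rw [hq]; ring
      _ ≤ q * (γ / (3 * (q + 1))) := by gcongr; exact min_le_right _ _
      _ ≤ γ / 3 := by
        rw [mul_div_assoc', div_le_div_iff₀ (by positivity) (by positivity)]
        nlinarith
  obtain ⟨Q, hQ1, hQ2, hQ3⟩ := hpair k ε hε0
  obtain ⟨ζ, hζ0, hζ⟩ : ∃ ζ : ℝ, 0 < ζ ∧ (b * b + b * b) * ζ ≤ γ / 3 := by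
    refine ⟨γ / (3 * (b * b + b * b + 1)), by positivity, ?_⟩
    rw [mul_div_assoc', div_le_div_iff₀ (by positivity) (by positivity)]
    nlinarith [mul_nonneg hb0 hb0]
  filter_upwards [ENNReal.tendsto_nhds_zero.1 hQ3 _ (ENNReal.ofReal_pos.2 hζ0)] with n hn
  have hQp : IsProbabilityMeasure (Q n) := by
    have : IsProbabilityMeasure ((Q n).map (fun z => (z.1, z.2.1))) := by
      rw [hQ1 n]; infer_instance
    exact Measure.isProbabilityMeasure_of_map (fun z => (z.1, z.2.1))
  refine le_trans ?_ hγδ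
  rw [lintegral_sq_average_eq ν (hG n) (hR0 n) hFm hFb]
  refine ENNReal.ofReal_le_ofReal ((le_abs_self _).trans ?_)
  -- the second moment is the mean of `J`, which equals `Z Z'` up to a small error where the
  -- coupling succeeds; the mean of `Z Z'` vanishes, since the two copies of the limit are independent
  let J : Ω n × (Fin (n + 1) × Fin (n + 1)) → ℝ := fun z =>
    ∫ w, F ((G n z.1).opinionPath c d (R0 n z.1) w k z.2.1) *
      F ((G n z.1).opinionPath c d (R0 n z.1) w k z.2.2) ∂signalLaw ν (G n z.1)
  have hJm : Measurable J := by
    refine measurable_integral_signalLaw ((hG n).comp measurable_fst) ?_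
    refine Measurable.mul ?_ ?_
    · exact hFm.comp (MarkedGraph.measurable_opinionPath c d
        ((hG n).comp (measurable_fst.comp measurable_fst))
        ((hR0 n).comp (measurable_fst.comp measurable_fst)) measurable_snd k
        (measurable_fst.comp (measurable_snd.comp measurable_fst)))
    · exact hFm.comp (MarkedGraph.measurable_opinionPath c d
        ((hG n).comp (measurable_fst.comp measurable_fst))
        ((hR0 n).comp (measurable_fst.comp measurable_fst)) measurable_snd k
        (measurable_snd.comp (measurable_snd.comp measurable_fst)))
  have hJb : ∀ z, |J z| ≤ b * b := by
    intro z
    have h1 := norm_integral_le_of_norm_le_const (μ := signalLaw ν (G n z.1)) (C := b * b)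
      (f := fun w => F ((G n z.1).opinionPath c d (R0 n z.1) w k z.2.1) *
        F ((G n z.1).opinionPath c d (R0 n z.1) w k z.2.2)) (ae_of_all _ fun w => by
          rw [Real.norm_eq_abs, abs_mul]
          exact mul_le_mul (hFb _) (hFb _) (abs_nonneg _) hb0)
    simpa [J] using h1
  let Z : H → ℝ := fun x => pathMean ν c d (h x) (r x) F 0
  have hZb : ∀ x, |Z x| ≤ b := fun x => abs_pathMean_le hFb _
  have hZZb : ∀ x y, |Z x * Z y| ≤ b * b := fun x y => by
    rw [abs_mul]; exact mul_le_mul (hZb _) (hZb _) (abs_nonneg _) hb0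
  have hmap1 : Measurable fun z : Ω n × ((Fin (n + 1) × Fin (n + 1)) × (H × H)) => (z.1, z.2.1) :=
    by fun_prop
  have hmap2 : Measurable fun z : Ω n × ((Fin (n + 1) × Fin (n + 1)) × (H × H)) => z.2.2 := by
    fun_prop
  have e1 : ∫ z, J z ∂(P n).prod ((unifVertex n).prod (unifVertex n)) =
      ∫ z, J (z.1, z.2.1) ∂Q n := by
    rw [← hQ1 n, integral_map hmap1.aemeasurable hJm.aestronglyMeasurable]
  have e2 : ∫ z, Z z.2.2.1 * Z z.2.2.2 ∂Q n = 0 := by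
    have : ∫ p : H × H, Z p.1 * Z p.2 ∂Γ.prod Γ = 0 := by
      rw [integral_prod_mul Z Z, hmean, zero_mul]
    rw [← this, ← hQ2 n, integral_map hmap2.aemeasurable]
    exact ((hpm.comp measurable_fst).mul (hpm.comp measurable_snd)).aestronglyMeasurable
  have hgood : ∀ᵐ z ∂Q n, Admissible ν c d (G n z.1) ∧ ∀ i, |R0 n z.1 i| ≤ 1 := by
    have h1 : (Q n).map Prod.fst = P n := by
      have : (fun z : Ω n × ((Fin (n + 1) × Fin (n + 1)) × (H × H)) => z.1) =
          Prod.fst ∘ fun z => (z.1, z.2.1) := rfl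
      change (Q n).map (fun z => z.1) = P n
      rw [this, ← Measure.map_map measurable_fst hmap1, hQ1 n, Measure.map_fst_prod]
      simp
    have h2 := (hadm n).and (hbdd n)
    rw [← h1] at h2
    exact ae_of_ae_map measurable_fst.aemeasurable h2
  have hmain := abs_integral_sub_le_of_compl (Q := Q n) (X := fun z => J (z.1, z.2.1))
    (Y := fun z => Z z.2.2.1 * Z z.2.2.2)
    (Integrable.of_bound (hJm.comp hmap1).aestronglyMeasurable (b * b)
      (ae_of_all _ fun _ => hJb _))
    (Integrable.of_bound ((hpm.comp (measurable_fst.comp hmap2)).mul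
      (hpm.comp (measurable_snd.comp hmap2))).aestronglyMeasurable (b * b)
      (ae_of_all _ fun _ => hZZb _ _))
    (a := 2 * b * (η + L * (pathConst K k * ε))) (b := b * b + b * b) (by positivity) ?_
    (fun z => (abs_sub _ _).trans (add_le_add (hJb _) (hZZb _ _))) (E := {z |
        ((G n z.1).withInitial (R0 n z.1)).Coupled z.2.1.1
          ((h z.2.2.1).withInitial (r z.2.2.1)) 0 k ε ∧
        ((G n z.1).withInitial (R0 n z.1)).Coupled z.2.1.2
          ((h z.2.2.2).withInitial (r z.2.2.2)) 0 k ε ∧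
        Disjoint ((G n z.1).inComp z.2.1.1 k) ((G n z.1).inComp z.2.1.2 k)})
  · rw [e1]
    rw [e2, sub_zero] at hmain
    refine hmain.trans ?_
    have hr1 : (Q n).real {z |
        ((G n z.1).withInitial (R0 n z.1)).Coupled z.2.1.1
          ((h z.2.2.1).withInitial (r z.2.2.1)) 0 k ε ∧
        ((G n z.1).withInitial (R0 n z.1)).Coupled z.2.1.2
          ((h z.2.2.2).withInitial (r z.2.2.2)) 0 k ε ∧
        Disjoint ((G n z.1).inComp z.2.1.1 k) ((G n z.1).inComp z.2.1.2 k)}ᶜ ≤ ζ :=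
      ENNReal.toReal_le_of_le_ofReal hζ0.le hn
    have := mul_le_mul_of_nonneg_left hr1 (show 0 ≤ b * b + b * b by positivity)
    linarith
  · filter_upwards [hgood] with z hz hzE
    obtain ⟨hz1, hz2, hz3⟩ := hzE
    have hJ : J (z.1, z.2.1) = pathMean ν c d (G n z.1) (R0 n z.1) F z.2.1.1 *
        pathMean ν c d (G n z.1) (R0 n z.1) F z.2.1.2 := integral_mul_opinionPath hz3 hFm
    have c1 := abs_pathMean_sub_le hLip hc hd hcd hz.1 hz.2 hε0 hε1 hz1 hFm hFb hL0 hLF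
    have c2 := abs_pathMean_sub_le hLip hc hd hcd hz.1 hz.2 hε0 hε1 hz2 hFm hFb hL0 hLF
    rw [hJ]
    set x1 := pathMean ν c d (G n z.1) (R0 n z.1) F z.2.1.1
    set x2 := pathMean ν c d (G n z.1) (R0 n z.1) F z.2.1.2
    have hx1 : |x1| ≤ b := abs_pathMean_le hFb _
    have : x1 * x2 - Z z.2.2.1 * Z z.2.2.2 =
        x1 * (x2 - Z z.2.2.2) + (x1 - Z z.2.2.1) * Z z.2.2.2 := by ring
    rw [this]
    refine (abs_add_le _ _).trans ?_
    rw [abs_mul, abs_mul]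
    have t1 := mul_le_mul hx1 c2 (abs_nonneg _) hb0
    have t2 := mul_le_mul c1 (hZb z.2.2.2) (abs_nonneg _) ((abs_nonneg _).trans c1)
    linarith

end Empirical

/-! ### Coupling a uniform vertex with a sample of the limit law -/

section SoftDensity

variable {ι : Type*} [Fintype ι]

/-- The density of a coupling that keeps two samples in the same cell of a soft partition as often
as possible: `p` and `q` are the masses of the cells, `s` and `t` the degrees to which the two
samples belong to them. The first summand puts the mass `min (p j) (q j)` on the event that both
samples belong to cell `j`, the second one is the product of the remaining masses. -/
noncomputable def softDensity (p q s t : ι → ℝ) : ℝ :=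
  ∑ j, s j * t j * (min (p j) (q j) / (p j * q j)) +
    (1 - ∑ j, s j * (min (p j) (q j) / p j)) * (1 - ∑ j, t j * (min (p j) (q j) / q j)) /
      (1 - ∑ j, min (p j) (q j))

theorem softDensity_comm (p q s t : ι → ℝ) : softDensity p q s t = softDensity q p t s := by
  unfold softDensity
  simp only [min_comm, mul_comm]

variable {p q s t : ι → ℝ}

theorem sum_min_le_one (hp1 : ∑ j, p j = 1) : ∑ j, min (p j) (q j) ≤ 1 :=
  hp1 ▸ Finset.sum_le_sum fun _ _ => min_le_left _ _

theorem one_sub_sum_min_le (hp1 : ∑ j, p j = 1) :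
    1 - ∑ j, min (p j) (q j) ≤ ∑ j, |p j - q j| := by
  rw [← hp1, ← Finset.sum_sub_distrib]
  refine Finset.sum_le_sum fun j _ => ?_
  rcases min_cases (p j) (q j) with ⟨h, -⟩ | ⟨h, -⟩ <;> rw [h]
  · simp
  · exact le_abs_self _

theorem sum_mul_min_div_le_one (hq : ∀ j, 0 ≤ q j) (ht : ∀ j, 0 ≤ t j) (ht1 : ∑ j, t j ≤ 1) :
    ∑ j, t j * (min (p j) (q j) / q j) ≤ 1 :=
  (Finset.sum_le_sum fun j _ => mul_le_of_le_one_right (ht j)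
    (div_le_one_of_le₀ (min_le_right _ _) (hq j))).trans ht1

theorem remainder_nonneg (hp : ∀ j, 0 ≤ p j) (hp1 : ∑ j, p j = 1) (hq : ∀ j, 0 ≤ q j)
    (hs : ∀ j, 0 ≤ s j) (hs1 : ∑ j, s j ≤ 1) (ht : ∀ j, 0 ≤ t j) (ht1 : ∑ j, t j ≤ 1) :
    0 ≤ (1 - ∑ j, s j * (min (p j) (q j) / p j)) * (1 - ∑ j, t j * (min (p j) (q j) / q j)) /
      (1 - ∑ j, min (p j) (q j)) := by
  refine div_nonneg (mul_nonneg ?_ ?_) (sub_nonneg.2 (sum_min_le_one hp1))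
  · have := sum_mul_min_div_le_one (p := q) hp hs hs1
    simp only [min_comm (q _)] at this
    linarith
  · linarith [sum_mul_min_div_le_one (p := p) hq ht ht1]

theorem diagonal_nonneg {ι : Type*} {p q s t : ι → ℝ} (hp : ∀ j, 0 ≤ p j) (hq : ∀ j, 0 ≤ q j)
    (hs : ∀ j, 0 ≤ s j) (ht : ∀ j, 0 ≤ t j) (j : ι) :
    0 ≤ s j * t j * (min (p j) (q j) / (p j * q j)) :=
  mul_nonneg (mul_nonneg (hs j) (ht j))
    (div_nonneg (le_min (hp j) (hq j)) (mul_nonneg (hp j) (hq j)))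

theorem softDensity_nonneg (hp : ∀ j, 0 ≤ p j) (hp1 : ∑ j, p j = 1) (hq : ∀ j, 0 ≤ q j)
    (hs : ∀ j, 0 ≤ s j) (hs1 : ∑ j, s j ≤ 1) (ht : ∀ j, 0 ≤ t j) (ht1 : ∑ j, t j ≤ 1) :
    0 ≤ softDensity p q s t :=
  add_nonneg (Finset.sum_nonneg fun j _ => diagonal_nonneg hp hq hs ht j)
    (remainder_nonneg hp hp1 hq hs hs1 ht ht1)

theorem measurable_softDensity {α : Type*} [MeasurableSpace α] {p q s t : α → ι → ℝ}
    (hp : Measurable p) (hq : Measurable q) (hs : Measurable s) (ht : Measurable t) :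
    Measurable fun x => softDensity (p x) (q x) (s x) (t x) := by
  unfold softDensity
  fun_prop

variable {E : Type*} [MeasurableSpace E] {Λ : Measure E} [IsProbabilityMeasure Λ]
  {φ : E → ι → ℝ}

theorem integrable_cell {ι : Type*} {φ : E → ι → ℝ} (hφ : Measurable φ) (h0 : ∀ x j, 0 ≤ φ x j)
    (h1 : ∀ x j, φ x j ≤ 1)
    (j : ι) : Integrable (fun x => φ x j) Λ :=
  Integrable.of_bound ((measurable_pi_apply j).comp hφ).aestronglyMeasurable 1
    (ae_of_all _ fun x => by rw [Real.norm_eq_abs, abs_of_nonneg (h0 x j)]; exact h1 x j)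

theorem integrable_remainder (hφ : Measurable φ) (h0 : ∀ x j, 0 ≤ φ x j)
    (h1 : ∀ x j, φ x j ≤ 1) (a : ι → ℝ) : Integrable (fun x => 1 - ∑ j, φ x j * a j) Λ :=
  (integrable_const _).sub
    (integrable_finsetSum _ fun j _ => (integrable_cell hφ h0 h1 j).mul_const _)

theorem integrable_softDensity (hφ : Measurable φ) (h0 : ∀ x j, 0 ≤ φ x j)
    (h1 : ∀ x j, φ x j ≤ 1) (p q s : ι → ℝ) :
    Integrable (fun x => softDensity p q s (φ x)) Λ :=
  (integrable_finsetSum _ fun j _ => ((integrable_cell hφ h0 h1 j).const_mul _).mul_const _).add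
    (((integrable_remainder hφ h0 h1 _).const_mul _).div_const _)

theorem integral_one_sub_sum (hφ : Measurable φ) (h0 : ∀ x j, 0 ≤ φ x j)
    (h1 : ∀ x j, φ x j ≤ 1) (hp : ∀ j, 0 ≤ p j) (hq : ∀ j, q j = ∫ x, φ x j ∂Λ) :
    ∫ x, (1 - ∑ j, φ x j * (min (p j) (q j) / q j)) ∂Λ = 1 - ∑ j, min (p j) (q j) := by
  have hi : ∀ j, Integrable (fun x => φ x j) Λ := integrable_cell hφ h0 h1
  have hq0 : ∀ j, 0 ≤ q j := fun j => hq j ▸ integral_nonneg fun x => h0 x j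
  rw [integral_sub (integrable_const _) (integrable_finsetSum _ fun j _ => (hi j).mul_const _),
    integral_finsetSum _ fun j _ => (hi j).mul_const _]
  simp only [integral_mul_const, ← hq, integral_const, probReal_univ, smul_eq_mul, mul_one]
  congr 1
  refine Finset.sum_congr rfl fun j _ => ?_
  rcases eq_or_ne (q j) 0 with h | h
  · simp [h, hp j]
  · field_simp

/-- The coupling density integrates to one over the second sample. -/
theorem integral_softDensity (hφ : Measurable φ) (h0 : ∀ x j, 0 ≤ φ x j)
    (h1 : ∀ x j, φ x j ≤ 1) (hp : ∀ j, 0 ≤ p j) (hp1 : ∑ j, p j = 1)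
    (hq : ∀ j, q j = ∫ x, φ x j ∂Λ) (hs1 : ∑ j, s j = 1) (hps : ∀ j, p j = 0 → s j = 0) :
    ∫ x, softDensity p q s (φ x) ∂Λ = 1 := by
  have hi : ∀ j, Integrable (fun x => φ x j) Λ := integrable_cell hφ h0 h1
  have hq0 : ∀ j, 0 ≤ q j := fun j => hq j ▸ integral_nonneg fun x => h0 x j
  unfold softDensity
  rw [integral_add (integrable_finsetSum _ fun j _ => ((hi j).const_mul _).mul_const _)
    (((integrable_remainder hφ h0 h1 _).const_mul _).div_const _),
    integral_finsetSum _ fun j _ => ((hi j).const_mul _).mul_const _,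
    integral_div, integral_const_mul, integral_one_sub_sum hφ h0 h1 hp hq]
  simp only [integral_mul_const, integral_const_mul, ← hq]
  have e1 : ∀ j, s j * q j * (min (p j) (q j) / (p j * q j)) = s j * (min (p j) (q j) / p j) := by
    intro j
    rcases eq_or_ne (q j) 0 with h | h
    · simp [h, hp j]
    · rcases eq_or_ne (p j) 0 with h' | h'
      · simp [h']
      · field_simp
  simp only [e1]
  rcases eq_or_ne (1 - ∑ j, min (p j) (q j)) 0 with h | h
  · -- without remaining mass the masses of the cells agree
    have h2 : ∑ j, (p j - min (p j) (q j)) = 0 := by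
      rw [Finset.sum_sub_distrib, hp1, h]
    have h3 : ∀ j, p j - min (p j) (q j) = 0 := fun j =>
      (Finset.sum_eq_zero_iff_of_nonneg fun j _ => sub_nonneg.2 (min_le_left _ _)).1 h2 j
        (Finset.mem_univ j)
    have h4 : ∀ j, s j * (min (p j) (q j) / p j) = s j := by
      intro j
      rw [← sub_eq_zero.1 (h3 j)]
      rcases eq_or_ne (p j) 0 with h' | h'
      · simp [hps j h']
      · rw [div_self h', mul_one]
    simp only [h4, hs1, h]
    simp
  · rw [mul_div_assoc, div_self h]; ring

end SoftDensity

section Marginals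

variable {Ω V E : Type*} [MeasurableSpace Ω] [MeasurableSpace V] [MeasurableSpace E]
  {P : Measure Ω} {U : Measure V} {Λ : Measure E} [SFinite U] [SFinite Λ]
  {h : Ω × (V × E) → ℝ≥0∞}

theorem map_withDensity_fst (hh : Measurable h)
    (h1 : ∀ᵐ ω ∂P, ∀ᵐ i ∂U, ∫⁻ x, h (ω, i, x) ∂Λ = 1) :
    ((P.prod (U.prod Λ)).withDensity h).map (fun z => (z.1, z.2.1)) = P.prod U := by
  have hm : Measurable fun z : Ω × (V × E) => (z.1, z.2.1) := by fun_prop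
  refine Measure.ext_of_lintegral _ fun f hf => ?_
  have hfm := hf.comp hm
  rw [lintegral_map hf hm]
  change ∫⁻ z, (f ∘ fun z : Ω × (V × E) => (z.1, z.2.1)) z ∂_ = _
  rw [lintegral_withDensity_eq_lintegral_mul _ hh hfm,
    lintegral_prod _ (hh.mul hfm).aemeasurable, lintegral_prod _ hf.aemeasurable]
  refine lintegral_congr_ae (h1.mono fun ω hω => ?_)
  simp only [Pi.mul_apply]
  rw [lintegral_prod _ (by fun_prop)]
  refine lintegral_congr_ae (hω.mono fun i hi => ?_)
  simp only [Function.comp]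
  rw [lintegral_mul_const _ (by fun_prop), hi, one_mul]

theorem map_withDensity_snd (hh : Measurable h)
    (h1 : ∀ᵐ ω ∂P, ∀ᵐ x ∂Λ, ∫⁻ i, h (ω, i, x) ∂U = 1) :
    ((P.prod (U.prod Λ)).withDensity h).map (fun z => (z.1, z.2.2)) = P.prod Λ := by
  have hm : Measurable fun z : Ω × (V × E) => (z.1, z.2.2) := by fun_prop
  refine Measure.ext_of_lintegral _ fun f hf => ?_
  have hfm := hf.comp hm
  rw [lintegral_map hf hm]
  change ∫⁻ z, (f ∘ fun z : Ω × (V × E) => (z.1, z.2.2)) z ∂_ = _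
  rw [lintegral_withDensity_eq_lintegral_mul _ hh hfm,
    lintegral_prod _ (hh.mul hfm).aemeasurable, lintegral_prod _ hf.aemeasurable]
  refine lintegral_congr_ae (h1.mono fun ω hω => ?_)
  simp only [Pi.mul_apply]
  rw [lintegral_prod_symm _ (by fun_prop)]
  refine lintegral_congr_ae (hω.mono fun i hi => ?_)
  simp only [Function.comp]
  rw [lintegral_mul_const _ (by fun_prop), hi, one_mul]

end Marginals

/-- A compact set has a continuous partition of unity into functions with small supports. -/
theorem exists_soft_partition {E : Type*} [PseudoMetricSpace E] {S : Set E} (hS : IsCompact S)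
    {r : ℝ} (hr : 0 < r) :
    ∃ (N : ℕ) (φ : E → Fin N → ℝ), (∀ j, Continuous fun x => φ x j) ∧ (∀ x j, 0 ≤ φ x j) ∧
      (∀ x, ∑ j, φ x j ≤ 1) ∧ (∀ x ∈ S, ∑ j, φ x j = 1) ∧
      ∀ x y j, φ x j ≠ 0 → φ y j ≠ 0 → dist x y ≤ 2 * r := by
  obtain ⟨T, -, hTfin, hT⟩ := hS.finite_cover_balls (e := r / 2) (by positivity)
  set N := hTfin.toFinset.card
  let e : Fin N → E := fun j => (hTfin.toFinset.equivFin.symm j : E)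
  -- tent functions at the points of a finite net, normalised by their sum where it is not too small
  let ψ : E → Fin N → ℝ := fun x j => max 0 (r - dist x (e j))
  have hψ0 : ∀ x j, 0 ≤ ψ x j := fun x j => le_max_left _ _
  have hψc : ∀ j, Continuous fun x => ψ x j := fun j => by fun_prop
  have hden : ∀ x, 0 < max (∑ j, ψ x j) (r / 2) := fun x => lt_max_of_lt_right (by positivity)
  have hsupp : ∀ x j, ψ x j / max (∑ j, ψ x j) (r / 2) ≠ 0 → dist x (e j) ≤ r := by
    intro x j hx
    by_contra hcon
    push Not at hcon
    exact hx (by simp [ψ, hcon.le])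
  refine ⟨N, fun x j => ψ x j / max (∑ j, ψ x j) (r / 2), fun j => ?_, fun x j => ?_,
    fun x => ?_, fun x hx => ?_, fun x y j hx hy => ?_⟩
  · exact (hψc j).div ((continuous_finsetSum _ fun j _ => hψc j).max continuous_const)
      fun x => (hden x).ne'
  · exact div_nonneg (hψ0 x j) (hden x).le
  · rw [← Finset.sum_div]
    exact div_le_one_of_le₀ (le_max_left _ _) (hden x).le
  · rw [← Finset.sum_div]
    obtain ⟨y, hyT, hy⟩ := Set.mem_iUnion₂.1 (hT hx)
    have h1 : r / 2 ≤ ∑ j, ψ x j := by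
      let j := hTfin.toFinset.equivFin ⟨y, hTfin.mem_toFinset.2 hyT⟩
      have h2 : r / 2 ≤ ψ x j := by
        have : e j = y := by simp [e, j]
        simp only [ψ, this]
        rw [Metric.mem_ball] at hy
        exact le_max_of_le_right (by linarith)
      exact h2.trans (Finset.single_le_sum (fun j _ => hψ0 x j) (Finset.mem_univ j))
    rw [max_eq_left h1]
    exact div_self (by linarith)
  · have := dist_triangle_right x y (e j)
    linarith [hsupp x j hx, hsupp y j hy]

section SoftCoupling

variable {E : Type*} [MetricSpace E] [MeasurableSpace E] [BorelSpace E]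
  [SecondCountableTopology E]

/-- A coupling of a sample with law `U`, seen through a random function `X ω`, with a sample of law
`Λ`; it only costs the size of the cells of a soft partition and the differences of their masses. -/
theorem exists_soft_coupling {Ω V : Type*} [MeasurableSpace Ω] [MeasurableSpace V] {P : Measure Ω}
    [IsProbabilityMeasure P] {U : Measure V} [IsProbabilityMeasure U] {X : Ω → V → E}
    (hX : Measurable (Function.uncurry X)) {S : Set E} (hXS : ∀ᵐ ω ∂P, ∀ i, X ω i ∈ S)
    {Λ : Measure E} [IsProbabilityMeasure Λ] (hΛS : ∀ᵐ x ∂Λ, x ∈ S)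
    {D : ℝ} (hD0 : 0 ≤ D) (hD : ∀ x ∈ S, ∀ y ∈ S, dist x y ≤ D) {N : ℕ} {φ : E → Fin N → ℝ}
    (hφc : ∀ j, Continuous fun x => φ x j) (hφ0 : ∀ x j, 0 ≤ φ x j)
    (hφ1 : ∀ x, ∑ j, φ x j ≤ 1) (hφS : ∀ x ∈ S, ∑ j, φ x j = 1) {r : ℝ} (hr : 0 ≤ r)
    (hφr : ∀ x y j, φ x j ≠ 0 → φ y j ≠ 0 → dist x y ≤ r) :
    ∃ Q : Measure (Ω × (V × E)), Q.map (fun z => (z.1, z.2.1)) = P.prod U ∧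
      Q.map (fun z => (z.1, z.2.2)) = P.prod Λ ∧
      ∫⁻ z, ENNReal.ofReal (dist (X z.1 z.2.1) z.2.2) ∂Q ≤ ENNReal.ofReal r +
        ENNReal.ofReal D * ∑ j, ∫⁻ ω, ENNReal.ofReal
          |∫ i, φ (X ω i) j ∂U - ∫ x, φ x j ∂Λ| ∂P := by
  have hφm : Measurable φ := measurable_pi_lambda _ fun j => (hφc j).measurable
  have hφle : ∀ x j, φ x j ≤ 1 := fun x j =>
    (Finset.single_le_sum (fun j _ => hφ0 x j) (Finset.mem_univ j)).trans (hφ1 x)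
  let p : Ω → Fin N → ℝ := fun ω j => ∫ i, φ (X ω i) j ∂U
  let q : Fin N → ℝ := fun j => ∫ x, φ x j ∂Λ
  have hXω : ∀ ω, Measurable (X ω) := fun ω => hX.comp measurable_prodMk_left
  have hpm : Measurable p := measurable_pi_lambda _ fun j =>
    (StronglyMeasurable.integral_prod_right (f := fun ω i => φ (X ω i) j)
      (((measurable_pi_apply j).comp (hφm.comp hX)).stronglyMeasurable)).measurable
  have hiX : ∀ ω j, Integrable (fun i => φ (X ω i) j) U := fun ω =>
    integrable_cell (φ := fun i => φ (X ω i)) (hφm.comp (hXω ω)) (fun _ => hφ0 _) (fun _ => hφle _)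
  have hiΛ : ∀ j, Integrable (fun x => φ x j) Λ := integrable_cell hφm hφ0 hφle
  have hp0 : ∀ ω j, 0 ≤ p ω j := fun ω j => integral_nonneg fun i => hφ0 _ j
  have hq0 : ∀ j, 0 ≤ q j := fun j => integral_nonneg fun x => hφ0 x j
  have hp1 : ∀ ω, (∀ i, X ω i ∈ S) → ∑ j, p ω j = 1 := by
    intro ω hω
    simp only [p]
    rw [← integral_finsetSum _ fun j _ => hiX ω j]
    simp [fun i => hφS _ (hω i)]
  have hq1 : ∑ j, q j = 1 := by
    simp only [q]
    rw [← integral_finsetSum _ fun j _ => hiΛ j,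
      integral_congr_ae (g := fun _ => (1 : ℝ)) (hΛS.mono fun x hx => hφS x hx)]
    simp
  -- for each `ω`, a density with respect to the product of the two laws
  let h : Ω × (V × E) → ℝ≥0∞ := fun z =>
    ENNReal.ofReal (softDensity (p z.1) q (φ (X z.1 z.2.1)) (φ z.2.2))
  have hXz : Measurable fun z : Ω × (V × E) => φ (X z.1 z.2.1) :=
    hφm.comp (hX.comp (measurable_fst.prodMk (measurable_fst.comp measurable_snd)))
  have hhm : Measurable h := ENNReal.measurable_ofReal.comp
    (measurable_softDensity (hpm.comp measurable_fst) measurable_const hXz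
      (hφm.comp (measurable_snd.comp measurable_snd)))
  have hnn : ∀ ω, (∀ i, X ω i ∈ S) → ∀ i x,
      0 ≤ softDensity (p ω) q (φ (X ω i)) (φ x) := fun ω hω i x =>
    softDensity_nonneg (hp0 ω) (hp1 ω hω) hq0 (hφ0 _) (hφ1 _) (hφ0 _) (hφ1 _)
  have hmarg1 : ∀ᵐ ω ∂P, ∀ᵐ i ∂U, ∫⁻ x, h (ω, i, x) ∂Λ = 1 := by
    filter_upwards [hXS] with ω hω
    have hzero : ∀ᵐ i ∂U, ∀ j, p ω j = 0 → φ (X ω i) j = 0 := by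
      refine ae_all_iff.2 fun j => ?_
      by_cases hj : p ω j = 0
      · filter_upwards [(integral_eq_zero_iff_of_nonneg (fun i => hφ0 _ j) (hiX ω j)).1 hj]
          with i hi _ using hi
      · exact ae_of_all _ fun _ h => absurd h hj
    filter_upwards [hzero] with i hz
    rw [← ofReal_integral_eq_lintegral_ofReal (integrable_softDensity hφm hφ0 hφle _ _ _)
      (ae_of_all _ fun x => hnn ω hω i x)]
    rw [integral_softDensity hφm hφ0 hφle (hp0 ω) (hp1 ω hω) (fun _ => rfl) (hφS _ (hω i)) hz,
      ENNReal.ofReal_one]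
  have hmarg2 : ∀ᵐ ω ∂P, ∀ᵐ x ∂Λ, ∫⁻ i, h (ω, i, x) ∂U = 1 := by
    filter_upwards [hXS] with ω hω
    have hzero : ∀ᵐ x ∂Λ, ∀ j, q j = 0 → φ x j = 0 := by
      refine ae_all_iff.2 fun j => ?_
      by_cases hj : q j = 0
      · filter_upwards [(integral_eq_zero_iff_of_nonneg (fun i => hφ0 _ j)
          (hiΛ j)).1 hj] with i hi _ using hi
      · exact ae_of_all _ fun _ h => absurd h hj
    filter_upwards [hzero, hΛS] with x hz hxS
    have hnn' := fun i => hnn ω hω i x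
    simp only [h]
    simp only [softDensity_comm (p ω)] at hnn' ⊢
    rw [← ofReal_integral_eq_lintegral_ofReal (integrable_softDensity
      (φ := fun i => φ (X ω i)) (hφm.comp (hXω ω)) (fun _ => hφ0 _) (fun _ => hφle _) _ _ _)
      (ae_of_all _ hnn'),
      integral_softDensity (φ := fun i => φ (X ω i)) (hφm.comp (hXω ω)) (fun _ => hφ0 _)
        (fun _ => hφle _) hq0 hq1 (fun _ => rfl) (hφS _ hxS) hz, ENNReal.ofReal_one]
  refine ⟨(P.prod (U.prod Λ)).withDensity h, map_withDensity_fst hhm hmarg1,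
    map_withDensity_snd hhm hmarg2, ?_⟩
  have hdm : Measurable fun z : Ω × (V × E) => ENNReal.ofReal (dist (X z.1 z.2.1) z.2.2) :=
    ENNReal.measurable_ofReal.comp ((hX.comp (measurable_fst.prodMk
      (measurable_fst.comp measurable_snd))).dist (measurable_snd.comp measurable_snd))
  let a : Ω → V → ℝ := fun ω i => 1 - ∑ j, φ (X ω i) j * (min (p ω j) (q j) / p ω j)
  let b : Ω → E → ℝ := fun ω x => 1 - ∑ j, φ x j * (min (p ω j) (q j) / q j)
  let ρ : Ω → ℝ := fun ω => 1 - ∑ j, min (p ω j) (q j)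
  -- the cost for fixed `ω`: the diagonal part stays in a cell, the remainder has mass `ρ ω`
  have hω : ∀ᵐ ω ∂P, ∫⁻ z, h (ω, z) * ENNReal.ofReal (dist (X ω z.1) z.2) ∂U.prod Λ ≤
      ENNReal.ofReal r + ENNReal.ofReal D * ENNReal.ofReal (ρ ω) := by
    filter_upwards [hXS, hmarg1] with ω hω hm1
    have hρ0 : 0 ≤ ρ ω := sub_nonneg.2 (sum_min_le_one (hp1 ω hω))
    have hrem : ∀ i x, 0 ≤ a ω i * b ω x / ρ ω := fun i x =>
      remainder_nonneg (hp0 ω) (hp1 ω hω) hq0 (hφ0 _) (hφ1 _) (hφ0 _) (hφ1 _)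
    have ham : Measurable (a ω) := by
      have := hφm.comp (hXω ω)
      have h2 : ∀ j, Measurable fun i => φ (X ω i) j := fun j => (measurable_pi_apply j).comp this
      exact measurable_const.sub (Finset.measurable_sum _ fun j _ => (h2 j).mul_const _)
    have hbm : Measurable (b ω) := by
      have h2 : ∀ j, Measurable fun i => φ i j := fun j => (measurable_pi_apply j).comp hφm
      exact measurable_const.sub (Finset.measurable_sum _ fun j _ => (h2 j).mul_const _)
    have hai : Integrable (a ω) U := integrable_remainder (φ := fun i => φ (X ω i))
      (hφm.comp (hXω ω)) (fun _ => hφ0 _) (fun _ => hφle _) _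
    have hbi : Integrable (b ω) Λ := integrable_remainder hφm hφ0 hφle _
    have hrm : Measurable fun z : V × E => ENNReal.ofReal (a ω z.1 * b ω z.2 / ρ ω) := by
      fun_prop
    have hhω : Measurable fun z => h (ω, z) := hhm.comp measurable_prodMk_left
    have hΛS' : ∀ᵐ z ∂U.prod Λ, z.2 ∈ S := by
      have : (U.prod Λ).map Prod.snd = Λ := by rw [Measure.map_snd_prod]; simp
      rw [← this] at hΛS
      exact ae_of_ae_map measurable_snd.aemeasurable hΛS
    calc _ ≤ ∫⁻ z, (h (ω, z) * ENNReal.ofReal r +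
            ENNReal.ofReal D * ENNReal.ofReal (a ω z.1 * b ω z.2 / ρ ω)) ∂U.prod Λ := by
          refine lintegral_mono_ae (hΛS'.mono fun z hz => ?_)
          simp only [h]
          rw [← ENNReal.ofReal_mul (hnn ω hω _ _), ← ENNReal.ofReal_mul (hnn ω hω _ _),
            ← ENNReal.ofReal_mul hD0, ← ENNReal.ofReal_add (mul_nonneg (hnn ω hω _ _) hr)
            (mul_nonneg hD0 (hrem _ _))]
          refine ENNReal.ofReal_le_ofReal ?_
          have hdD := hD _ (hω z.1) _ hz
          have hdiag : (∑ j, φ (X ω z.1) j * φ z.2 j * (min (p ω j) (q j) / (p ω j * q j))) *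
              dist (X ω z.1) z.2 ≤
              (∑ j, φ (X ω z.1) j * φ z.2 j * (min (p ω j) (q j) / (p ω j * q j))) * r := by
            rw [Finset.sum_mul, Finset.sum_mul]
            refine Finset.sum_le_sum fun j _ => ?_
            by_cases h1 : φ (X ω z.1) j = 0
            · simp [h1]
            by_cases h2 : φ z.2 j = 0
            · simp [h2]
            exact mul_le_mul_of_nonneg_left (hφr _ _ j h1 h2)
              (diagonal_nonneg (hp0 ω) hq0 (hφ0 _) (hφ0 _) j)
          have hsd : softDensity (p ω) q (φ (X ω z.1)) (φ z.2) =
              ∑ j, φ (X ω z.1) j * φ z.2 j * (min (p ω j) (q j) / (p ω j * q j)) +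
                a ω z.1 * b ω z.2 / ρ ω := rfl
          rw [hsd]
          have h3 := mul_le_mul_of_nonneg_left hdD (hrem z.1 z.2)
          have h4 := mul_nonneg (hrem z.1 z.2) hr
          linarith
      _ = ENNReal.ofReal r + ENNReal.ofReal D *
            ∫⁻ z, ENNReal.ofReal (a ω z.1 * b ω z.2 / ρ ω) ∂U.prod Λ := by
          rw [lintegral_add_left (hhω.mul_const _), lintegral_mul_const _ hhω,
            lintegral_const_mul _ hrm, lintegral_prod _ hhω.aemeasurable,
            lintegral_congr_ae hm1]
          simp
      _ ≤ _ := by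
          gcongr
          rw [← ofReal_integral_eq_lintegral_ofReal ((hai.mul_prod hbi).div_const _)
            (ae_of_all _ fun z => hrem _ _)]
          refine ENNReal.ofReal_le_ofReal ?_
          have e1 : ∫ i, a ω i ∂U = ρ ω := by
            have := integral_one_sub_sum (Λ := U) (φ := fun i => φ (X ω i)) (p := q) (q := p ω)
              (hφm.comp (hXω ω)) (fun _ => hφ0 _) (fun _ => hφle _) hq0 (fun _ => rfl)
            simp only [min_comm (q _)] at this
            exact this
          have e2 : ∫ x, b ω x ∂Λ = ρ ω :=
            integral_one_sub_sum hφm hφ0 hφle (hp0 ω) (fun _ => rfl)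
          rw [integral_div, integral_prod_mul, e1, e2]
          rcases eq_or_ne (ρ ω) 0 with h0 | h0
          · simp [h0]
          · rw [mul_div_assoc, div_self h0, mul_one]
  rw [lintegral_withDensity_eq_lintegral_mul _ hhm hdm,
    lintegral_prod _ (hhm.mul hdm).aemeasurable]
  simp only [Pi.mul_apply]
  have hpj : ∀ j, Measurable fun ω => ENNReal.ofReal |p ω j - q j| := fun j => by
    have := (measurable_pi_apply j).comp hpm
    exact ENNReal.measurable_ofReal.comp (measurable_norm.comp (this.sub_const _))
  calc _ ≤ ∫⁻ ω, (ENNReal.ofReal r +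
        ENNReal.ofReal D * ∑ j, ENNReal.ofReal |p ω j - q j|) ∂P := by
        refine lintegral_mono_ae ?_
        filter_upwards [hω, hXS] with ω h1 h2
        refine h1.trans ?_
        rw [← ENNReal.ofReal_sum_of_nonneg fun _ _ => abs_nonneg _]
        gcongr
        exact one_sub_sum_min_le (hp1 ω h2)
    _ = _ := by
        rw [lintegral_add_left measurable_const, lintegral_const_mul _
          (Finset.measurable_sum _ fun j _ => hpj j), lintegral_finsetSum _ fun j _ => hpj j]
        simp [p, q]

/-- Convergence of second moments implies convergence of first absolute moments. -/
theorem tendsto_lintegral_abs_of_sq {Ω : ℕ → Type v} [∀ n, MeasurableSpace (Ω n)]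
    {P : ∀ n, Measure (Ω n)} [∀ n, IsProbabilityMeasure (P n)] {Z : ∀ n, Ω n → ℝ}
    (h : Tendsto (fun n => ∫⁻ ω, ENNReal.ofReal (Z n ω ^ 2) ∂P n) atTop (𝓝 0)) :
    Tendsto (fun n => ∫⁻ ω, ENNReal.ofReal |Z n ω| ∂P n) atTop (𝓝 0) := by
  rw [ENNReal.tendsto_nhds_zero]
  intro δ hδ
  obtain ⟨γ, hγ0, hγδ⟩ := ENNReal.lt_iff_exists_nnreal_btwn.1 hδ
  have hγ : 0 < (γ : ℝ) := by exact_mod_cast hγ0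
  set η : ℝ := γ / 2 with hη
  have hη0 : 0 < η := by positivity
  filter_upwards [ENNReal.tendsto_nhds_zero.1 h (ENNReal.ofReal (η * η))
    (ENNReal.ofReal_pos.2 (by positivity))] with n hn
  calc _ ≤ ∫⁻ ω, (ENNReal.ofReal η + ENNReal.ofReal η⁻¹ * ENNReal.ofReal (Z n ω ^ 2)) ∂P n := by
        refine lintegral_mono fun ω => ?_
        rw [← ENNReal.ofReal_mul (by positivity), ← ENNReal.ofReal_add hη0.le (by positivity)]
        refine ENNReal.ofReal_le_ofReal ?_
        have h1 : |Z n ω| * η ≤ η * η + |Z n ω| ^ 2 := by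
          nlinarith [sq_nonneg (|Z n ω| - η), sq_nonneg (|Z n ω| + η), abs_nonneg (Z n ω)]
        rw [sq_abs] at h1
        rw [← div_eq_inv_mul, ← sub_le_iff_le_add', le_div_iff₀ hη0]
        linarith
    _ = ENNReal.ofReal η + ENNReal.ofReal η⁻¹ * ∫⁻ ω, ENNReal.ofReal (Z n ω ^ 2) ∂P n := by
        rw [lintegral_add_left measurable_const, lintegral_const_mul' _ _ ENNReal.ofReal_ne_top]
        simp
    _ ≤ ENNReal.ofReal η + ENNReal.ofReal η⁻¹ * ENNReal.ofReal (η * η) := by gcongr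
    _ = ENNReal.ofReal γ := by
        rw [← ENNReal.ofReal_mul (by positivity), ← ENNReal.ofReal_add hη0.le (by positivity)]
        congr 1
        rw [hη]; field_simp; norm_num
    _ ≤ δ := by simpa using hγδ.le

/-- The limit coupling for cells of diameter at most `1 / (m + 1)`. -/
theorem exists_limit_coupling_of_cells {Ω : ℕ → Type v} [∀ n, MeasurableSpace (Ω n)]
    {P : ∀ n, Measure (Ω n)} [∀ n, IsProbabilityMeasure (P n)]
    {X : ∀ n, Ω n → Fin (n + 1) → E} (hX : ∀ n, Measurable (X n)) {S : Set E} (hS : IsCompact S)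
    (hXS : ∀ n, ∀ᵐ ω ∂(P n), ∀ i, X n ω i ∈ S)
    {Λ : Measure E} [IsProbabilityMeasure Λ] (hΛS : ∀ᵐ x ∂Λ, x ∈ S)
    (hemp : ∀ f : E → ℝ, Continuous f → Tendsto (fun n => ∫⁻ ω, ENNReal.ofReal
      ((∫ i, f (X n ω i) ∂unifVertex n - ∫ x, f x ∂Λ) ^ 2) ∂P n) atTop (𝓝 0)) (m : ℕ) :
    ∃ Q : ∀ n, Measure (Ω n × (Fin (n + 1) × E)),
      (∀ n, (Q n).map (fun z => (z.1, z.2.1)) = (P n).prod (unifVertex n)) ∧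
      (∀ n, (Q n).map (fun z => (z.1, z.2.2)) = (P n).prod Λ) ∧
      ∀ᶠ n in atTop, ∫⁻ z, ENNReal.ofReal (dist (X n z.1 z.2.1) z.2.2) ∂Q n ≤
        ENNReal.ofReal (2 / ((m : ℝ) + 1)) := by
  have hXu : ∀ n, Measurable (Function.uncurry (X n)) := fun n =>
    measurable_eval_countable (F := fun z : Ω n × Fin (n + 1) => X n z.1)
      ((hX n).comp measurable_fst) measurable_snd
  have hD : ∀ x ∈ S, ∀ y ∈ S, dist x y ≤ Metric.diam S := fun x hx y hy =>
    Metric.dist_le_diam_of_mem hS.isBounded hx hy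
  set r : ℝ := 1 / ((m : ℝ) + 1) / 2 with hr
  have hr0 : 0 < r := by positivity
  obtain ⟨N, φ, h1, h2, h3, h4, h5⟩ := exists_soft_partition hS hr0
  choose Q hQ1 hQ2 hQ3 using fun n => exists_soft_coupling (P := P n)
    (U := unifVertex n) (hXu n) (hXS n) hΛS
    Metric.diam_nonneg hD h1 h2 h3 h4 (by positivity) h5
  refine ⟨Q, hQ1, hQ2, ?_⟩
  have hlim : Tendsto (fun n => ENNReal.ofReal (Metric.diam S) * ∑ j, ∫⁻ ω, ENNReal.ofReal
      |∫ i, φ (X n ω i) j ∂unifVertex n - ∫ x, φ x j ∂Λ| ∂P n) atTop (𝓝 0) := by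
    have h8 : ∀ j, Tendsto (fun n => ∫⁻ ω, ENNReal.ofReal
        |∫ i, φ (X n ω i) j ∂unifVertex n - ∫ x, φ x j ∂Λ| ∂P n) atTop (𝓝 0) := fun j =>
      tendsto_lintegral_abs_of_sq (P := P)
        (Z := fun n ω => ∫ i, φ (X n ω i) j ∂unifVertex n - ∫ x, φ x j ∂Λ)
        (hemp (fun x => φ x j) (h1 j))
    have h6 : Tendsto (fun n => ∑ j, ∫⁻ ω, ENNReal.ofReal
        |∫ i, φ (X n ω i) j ∂unifVertex n - ∫ x, φ x j ∂Λ| ∂P n) atTop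
        (𝓝 (∑ j : Fin N, 0)) :=
      tendsto_finsetSum _ fun j _ => h8 j
    rw [Finset.sum_const_zero] at h6
    have h7 := ENNReal.Tendsto.const_mul (a := ENNReal.ofReal (Metric.diam S)) h6
      (Or.inr ENNReal.ofReal_ne_top)
    rwa [mul_zero] at h7
  have hpos : (0 : ℝ) < 1 / ((m : ℝ) + 1) := by positivity
  filter_upwards [ENNReal.tendsto_nhds_zero.1 hlim _ (ENNReal.ofReal_pos.2 hpos)] with n hn
  refine (hQ3 n).trans ((add_le_add le_rfl hn).trans (le_of_eq ?_))
  rw [← ENNReal.ofReal_add (by positivity) hpos.le, hr]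
  congr 1
  ring
/-- If the empirical distributions of `X n` converge to `Λ`, then the value of `X n` at a uniform
vertex can be coupled with a sample of `Λ`, independent of everything else, at a cost that tends to
zero. -/
theorem exists_limit_coupling {Ω : ℕ → Type v} [∀ n, MeasurableSpace (Ω n)]
    {P : ∀ n, Measure (Ω n)} [∀ n, IsProbabilityMeasure (P n)]
    {X : ∀ n, Ω n → Fin (n + 1) → E} (hX : ∀ n, Measurable (X n)) {S : Set E} (hS : IsCompact S)
    (hXS : ∀ n, ∀ᵐ ω ∂(P n), ∀ i, X n ω i ∈ S)
    {Λ : Measure E} [IsProbabilityMeasure Λ] (hΛS : ∀ᵐ x ∂Λ, x ∈ S)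
    (hemp : ∀ f : E → ℝ, Continuous f → Tendsto (fun n => ∫⁻ ω, ENNReal.ofReal
      ((∫ i, f (X n ω i) ∂unifVertex n - ∫ x, f x ∂Λ) ^ 2) ∂P n) atTop (𝓝 0)) :
    ∃ Q : ∀ n, Measure (Ω n × (Fin (n + 1) × E)),
      (∀ n, (Q n).map (fun z => (z.1, z.2.1)) = (P n).prod (unifVertex n)) ∧
      (∀ n, (Q n).map (fun z => (z.1, z.2.2)) = (P n).prod Λ) ∧
      Tendsto (fun n => ∫⁻ z, ENNReal.ofReal (dist (X n z.1 z.2.1) z.2.2) ∂Q n) atTop (𝓝 0) := by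
  choose Q hQ1 hQ2 hQ3 using
    exists_limit_coupling_of_cells hX hS hXS hΛS hemp
  -- for each `n`, the best of the first couplings
  have hmin : ∀ n : ℕ, ∃ m ∈ Finset.range (n + 1), ∀ m' ∈ Finset.range (n + 1),
      ∫⁻ z, ENNReal.ofReal (dist (X n z.1 z.2.1) z.2.2) ∂Q m n ≤
      ∫⁻ z, ENNReal.ofReal (dist (X n z.1 z.2.1) z.2.2) ∂Q m' n := fun n =>
    Finset.exists_min_image _ _ ⟨0, by simp⟩
  choose M hM1 hM2 using hmin
  refine ⟨fun n => Q (M n) n, fun n => hQ1 _ n, fun n => hQ2 _ n, ?_⟩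
  rw [ENNReal.tendsto_nhds_zero]
  intro δ hδ
  obtain ⟨γ, hγ0, hγδ⟩ := ENNReal.lt_iff_exists_nnreal_btwn.1 hδ
  have hγ : 0 < (γ : ℝ) := by exact_mod_cast hγ0
  obtain ⟨m, hm⟩ := exists_nat_one_div_lt (show (0 : ℝ) < γ / 2 by positivity)
  filter_upwards [hQ3 m, eventually_ge_atTop m] with n hn hmn
  refine (hM2 n m (by simp; omega)).trans (hn.trans ?_)
  refine le_trans (ENNReal.ofReal_le_ofReal (q := γ) ?_) (by simpa using hγδ.le)
  have : 2 / ((m : ℝ) + 1) = 2 * (1 / ((m : ℝ) + 1)) := by ring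
  rw [this]; linarith

end SoftCoupling

/-! ### Weak limits of couplings on `[-1, 1]` -/

section WeakLimits

open scoped BoundedContinuousFunction

/-- Probability measures carried by a fixed compact set converge along an ultrafilter. -/
theorem exists_tendsto_of_isCompact {E : Type*} [TopologicalSpace E] [T2Space E] [NormalSpace E]
    [MeasurableSpace E] [BorelSpace E] {ι : Type*} (l : Ultrafilter ι) {τ : ι → Measure E}
    [∀ i, IsProbabilityMeasure (τ i)] {S : Set E} (hS : IsCompact S)
    (hτ : ∀ᶠ i in (l : Filter ι), ∀ᵐ z ∂τ i, z ∈ S) :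
    ∃ π : Measure E, IsProbabilityMeasure π ∧ (∀ᵐ z ∂π, z ∈ S) ∧
      ∀ f : E →ᵇ ℝ, Tendsto (fun i => ∫ z, f z ∂τ i) l (𝓝 (∫ z, f z ∂π)) := by
  have hK := isCompact_setOfPred_probabilityMeasure_mass_eq_compl_isCompact_le (E := E)
    (u := fun _ => 0) (K := fun _ => S) tendsto_const_nhds (fun _ => hS) (Or.inl inferInstance)
  let T : ι → ProbabilityMeasure E := fun i => ⟨τ i, inferInstance⟩
  have hnull : ∀ μ : ProbabilityMeasure E, μ Sᶜ ≤ 0 ↔ ∀ᵐ z ∂(μ : Measure E), z ∈ S := by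
    intro μ
    rw [ae_iff, ← ENNReal.coe_le_coe, ProbabilityMeasure.ennreal_coeFn_eq_coeFn_toMeasure,
      ENNReal.coe_zero, nonpos_iff_eq_zero]
    rfl
  have hmem : ∀ᶠ i in (l : Filter ι), T i ∈ {μ : ProbabilityMeasure E | ∀ _ : ℕ, μ Sᶜ ≤ 0} :=
    hτ.mono fun i hi _ => (hnull (T i)).2 hi
  obtain ⟨π, hπ, hlim⟩ := hK.ultrafilter_le_nhds (l.map T) (le_principal_iff.2 hmem)
  refine ⟨π, inferInstance, (hnull π).1 (hπ 0), ?_⟩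
  have h := (ProbabilityMeasure.tendsto_iff_forall_integral_tendsto (F := (l : Filter ι))
    (μs := T) (μ := π)).1 hlim
  exact h

/-- Couplings on `[-1, 1]²` of points at distance at most `D` pass to weak limits of the
marginals. -/
theorem exists_coupling_of_tendsto {ι : Type*} {l : Filter ι} [NeBot l] {τ : ι → Measure (ℝ × ℝ)}
    [∀ i, IsProbabilityMeasure (τ i)] {μ μ' : Measure ℝ} [IsProbabilityMeasure μ]
    [IsProbabilityMeasure μ'] {D : ℝ}
    (hI : ∀ᶠ i in l, ∀ᵐ z ∂τ i, z ∈ Set.Icc (-1 : ℝ) 1 ×ˢ Set.Icc (-1 : ℝ) 1)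
    (hD : ∀ᶠ i in l, ∀ᵐ z ∂τ i, |z.1 - z.2| ≤ D)
    (h1 : ∀ f : ℝ →ᵇ ℝ, Tendsto (fun i => ∫ z, f z.1 ∂τ i) l (𝓝 (∫ x, f x ∂μ)))
    (h2 : ∀ f : ℝ →ᵇ ℝ, Tendsto (fun i => ∫ z, f z.2 ∂τ i) l (𝓝 (∫ x, f x ∂μ'))) :
    ∃ π : Measure (ℝ × ℝ), π.map Prod.fst = μ ∧ π.map Prod.snd = μ' ∧
      ∀ᵐ z ∂π, |z.1 - z.2| ≤ D := by
  have hU : (Ultrafilter.of l : Filter ι) ≤ l := Ultrafilter.of_le l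
  obtain ⟨π, hπ, -, hlim⟩ := exists_tendsto_of_isCompact (Ultrafilter.of l)
    (isCompact_Icc.prod isCompact_Icc) (hI.filter_mono hU)
  refine ⟨π, ?_, ?_, ?_⟩
  · have : IsProbabilityMeasure (π.map Prod.fst) :=
      Measure.isProbabilityMeasure_map measurable_fst.aemeasurable
    refine ext_of_forall_integral_eq_of_IsFiniteMeasure fun f => ?_
    rw [integral_map measurable_fst.aemeasurable f.continuous.aestronglyMeasurable]
    exact tendsto_nhds_unique (hlim (f.compContinuous ⟨Prod.fst, continuous_fst⟩))
      ((h1 f).mono_left hU)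
  · have : IsProbabilityMeasure (π.map Prod.snd) :=
      Measure.isProbabilityMeasure_map measurable_snd.aemeasurable
    refine ext_of_forall_integral_eq_of_IsFiniteMeasure fun f => ?_
    rw [integral_map measurable_snd.aemeasurable f.continuous.aestronglyMeasurable]
    exact tendsto_nhds_unique (hlim (f.compContinuous ⟨Prod.snd, continuous_snd⟩))
      ((h2 f).mono_left hU)
  · -- a bounded test function that vanishes exactly where the distance is at most `D`
    let φ : ℝ × ℝ → ℝ := fun z => min 1 (max 0 (|z.1 - z.2| - D))
    have hφc : Continuous φ := by fun_prop
    have hφ0 : ∀ z, 0 ≤ φ z := fun z => le_min zero_le_one (le_max_left _ _)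
    have hφ1 : ∀ z, ‖φ z‖ ≤ 1 := fun z => by
      rw [Real.norm_eq_abs, abs_of_nonneg (hφ0 z)]; exact min_le_left _ _
    let F : (ℝ × ℝ) →ᵇ ℝ := BoundedContinuousFunction.ofNormedAddCommGroup φ hφc 1 hφ1
    have hz : Tendsto (fun i => ∫ z, F z ∂τ i) (Ultrafilter.of l) (𝓝 0) := by
      refine tendsto_const_nhds.congr' ?_
      filter_upwards [hD.filter_mono hU] with i hi
      symm
      refine integral_eq_zero_of_ae (hi.mono fun z hz => ?_)
      change φ z = 0
      simp only [φ, max_eq_left (sub_nonpos.2 hz)]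
      exact min_eq_right zero_le_one
    have hint : ∫ z, φ z ∂π = 0 := tendsto_nhds_unique (hlim F) hz
    have hφi : Integrable φ π := Integrable.of_bound hφc.aestronglyMeasurable 1 (ae_of_all _ hφ1)
    filter_upwards [(integral_eq_zero_iff_of_nonneg hφ0 hφi).1 hint] with z hz
    by_contra hcon
    push Not at hcon
    have : 0 < φ z := lt_min zero_lt_one (lt_max_of_lt_right (sub_pos.2 hcon))
    exact this.ne' hz

theorem wasserstein1_le_of_ae {μ μ' : Measure ℝ} {π : Measure (ℝ × ℝ)} [IsProbabilityMeasure π]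
    (h1 : π.map Prod.fst = μ) (h2 : π.map Prod.snd = μ') {D : ℝ}
    (hD : ∀ᵐ z ∂π, |z.1 - z.2| ≤ D) : wasserstein1 μ μ' ≤ ENNReal.ofReal D := by
  refine (iInf₂_le π ⟨h1, h2⟩).trans ?_
  calc ∫⁻ z, edist z.1 z.2 ∂π ≤ ∫⁻ _, ENNReal.ofReal D ∂π := by
        refine lintegral_mono_ae (hD.mono fun z hz => ?_)
        rw [edist_dist, Real.dist_eq]
        exact ENNReal.ofReal_le_ofReal hz
    _ = ENNReal.ofReal D := by simp

end WeakLimits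

/-! ### Convergence in probability -/

section InProbability

theorem tendstoInProb_of_lintegral {Ω : ℕ → Type v} [∀ n, MeasurableSpace (Ω n)]
    {P : ∀ n, Measure (Ω n)} {Z : ∀ n, Ω n → ℝ} {a : ℝ}
    (hZ : ∀ n, AEMeasurable (Z n) (P n))
    (h : Tendsto (fun n => ∫⁻ ω, ENNReal.ofReal |Z n ω - a| ∂P n) atTop (𝓝 0)) :
    TendstoInProb P Z a := by
  intro δ hδ
  have h2 := ENNReal.Tendsto.div_const h (b := ENNReal.ofReal δ)
    (Or.inr (ENNReal.ofReal_pos.2 hδ).ne')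
  rw [ENNReal.zero_div] at h2
  refine tendsto_of_tendsto_of_tendsto_of_le_of_le tendsto_const_nhds h2 (fun _ => zero_le)
    fun n => ?_
  have hm : AEMeasurable (fun ω => ENNReal.ofReal |Z n ω - a|) (P n) :=
    ENNReal.measurable_ofReal.comp_aemeasurable
      (measurable_norm.comp_aemeasurable ((hZ n).sub_const a))
  refine le_trans (measure_mono fun ω hω => ?_) (meas_ge_le_lintegral_div hm
    (ENNReal.ofReal_pos.2 hδ).ne' ENNReal.ofReal_ne_top)
  exact ENNReal.ofReal_le_ofReal hω

/-- Conditional expectations of variables that tend to zero in mean tend to zero in probability. -/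
theorem tendstoInProb_condExp {Ω : ℕ → Type v} {m m0 : ∀ n, MeasurableSpace (Ω n)}
    {P : ∀ n, Measure (Ω n)} {Z : ∀ n, Ω n → ℝ}
    (h : Tendsto (fun n => ∫⁻ ω, ENNReal.ofReal |Z n ω| ∂P n) atTop (𝓝 0)) :
    TendstoInProb P (fun n => (P n)[Z n | m n]) 0 := by
  refine tendstoInProb_of_lintegral (fun n => integrable_condExp.1.aemeasurable) ?_
  refine tendsto_of_tendsto_of_tendsto_of_le_of_le tendsto_const_nhds h (fun _ => zero_le)
    fun n => ?_
  have h1 := eLpNorm_condExp_le_eLpNorm (μ := P n) (m := m n) (Z n) le_rfl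
  simp only [eLpNorm_one_eq_lintegral_enorm, Real.enorm_eq_ofReal_abs] at h1
  simpa using h1

/-- Convergence to zero in probability of finitely many sequences is uniform. -/
theorem TendstoInProb.iSup {Ω : ℕ → Type v} [∀ n, MeasurableSpace (Ω n)]
    {P : ∀ n, Measure (Ω n)} {ι : Type*} [Fintype ι] [Nonempty ι] {Z : ∀ n, ι → Ω n → ℝ}
    (h : ∀ r, TendstoInProb P (fun n => Z n r) 0) :
    TendstoInProb P (fun n ω => ⨆ r, Z n r ω) 0 := by
  intro δ hδ
  have h2 : Tendsto (fun n => ∑ r, P n {ω | δ ≤ |Z n r ω - 0|}) atTop (𝓝 (∑ _r : ι, 0)) :=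
    tendsto_finsetSum _ fun r _ => h r δ hδ
  rw [Finset.sum_const_zero] at h2
  refine tendsto_of_tendsto_of_tendsto_of_le_of_le tendsto_const_nhds h2 (fun _ => zero_le)
    fun n => le_trans (measure_mono ?_) (measure_iUnion_fintype_le _ _)
  intro ω hω
  obtain ⟨r, hr⟩ := exists_eq_ciSup_of_finite (f := fun r => Z n r ω)
  refine Set.mem_iUnion.2 ⟨r, ?_⟩
  simp only [Set.mem_ofPred_eq] at hω ⊢
  rwa [← hr] at hω

end InProbability

/-! ### Signals on a fixed marked graph and stationary laws -/

section Stationary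

variable {A : Type u} [MeasurableSpace A] {V : Type w} {ν : Kernel (Mark A) ℝ} [IsMarkovKernel ν]
  {c d : ℝ} {g : MarkedGraph V A}

theorem ae_signal_le [Countable V] [MeasurableSpace V] (hg : Admissible ν c d g) :
    ∀ᵐ w ∂signalLaw ν g, ∀ t v, |w (t, v)| ≤ d + c - (g.mark v).totalWeight := by
  refine ae_all_iff.2 fun t => ae_all_iff.2 fun v => ?_
  have h1 := hg.signal_le v
  have h2 : (signalLaw ν g).map (fun w => w (t, v)) = ν (g.mark v) :=
    Measure.infinitePi_map_eval (fun p : ℕ × V => ν (g.mark p.2)) (t, v)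
  rw [← h2] at h1
  exact ae_of_ae_map (measurable_pi_apply _).aemeasurable h1

theorem map_shift_signalLaw [MeasurableSpace V] (m : ℕ) :
    (signalLaw ν g).map (fun w p => w (m + p.1, p.2)) = signalLaw ν g := by
  have hinj : Function.Injective fun p : ℕ × V => (m + p.1, p.2) := by
    rintro ⟨s, v⟩ ⟨t, v'⟩ h
    simpa using h
  exact Measure.map_infinitePi_infinitePi_of_inj (P := fun p : ℕ × V => ν (g.mark p.2)) hinj

/-- The signals of the first step are independent of the later ones, which have the same law as
all the signals. -/
theorem map_split_signalLaw [MeasurableSpace V] [Fintype V] :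
    (signalLaw ν g).map (fun w => ((fun v => w (0, v)), fun p : ℕ × V => w (1 + p.1, p.2))) =
      (Measure.pi fun v => ν (g.mark v)).prod (signalLaw ν g) := by
  have h₁ : Function.Injective fun v : V => ((0 : ℕ), v) := fun v v' h => congrArg Prod.snd h
  have h₂ : Function.Injective fun p : ℕ × V => (1 + p.1, p.2) := by
    rintro ⟨s, v⟩ ⟨t, v'⟩ h
    simpa using h
  have hdisj : Disjoint (Set.range fun v : V => ((0 : ℕ), v))
      (Set.range fun p : ℕ × V => (1 + p.1, p.2)) := by
    rw [Set.disjoint_left]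
    rintro _ ⟨v, rfl⟩ ⟨p, hp⟩
    have := congrArg Prod.fst hp
    simp at this
  have h := infinitePi_map_prodMk (fun p : ℕ × V => ν (g.mark p.2)) h₁ h₂ hdisj
  rw [← Measure.infinitePi_eq_pi]
  exact h

variable [Fintype V] [MeasurableSpace V]

theorem ae_abs_opinion_sub_le (hg : Admissible ν c d g) (hc : 0 ≤ c) (hcd : c + d ≤ 1)
    (x : V → ℝ) (k : ℕ) : ∀ᵐ w ∂signalLaw ν g,
      (∀ i, |g.opinion c d (fun _ => 0) w k i| ≤ 1) ∧
      ∀ i, |g.opinion c d x w k i - g.opinion c d (fun _ => 0) w k i| ≤ (1 - d) ^ k * ‖x‖ := by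
  filter_upwards [ae_signal_le hg] with w hw
  refine ⟨fun i => MarkedGraph.abs_opinion_le_one hcd (by simp) hw k i, fun i =>
    MarkedGraph.abs_opinion_sub_le hg.hasWeightSum hc hcd (fun i => ?_) k i⟩
  simpa using norm_le_pi_norm x i

variable [MeasurableSingletonClass V]

/-- A stationary law is preserved by any number of steps. -/
theorem IsStationaryLaw.map_opinion {π : Measure (V → ℝ)} (hπ : IsStationaryLaw ν c d g π)
    (k : ℕ) : (π.prod (signalLaw ν g)).map (fun z => g.opinion c d z.1 z.2 k) = π := by
  have := hπ.1
  have hav : Measurable fun z : (V → ℝ) × (V → ℝ) => fun i => g.avg c d z.1 i + z.2 i := by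
    have h := MarkedGraph.measurable_avg c d (measurable_const (a := g))
      (measurable_fst : Measurable (Prod.fst : (V → ℝ) × (V → ℝ) → V → ℝ))
    exact h.add measurable_snd
  have hstep : Measurable fun z : (V → ℝ) × (ℕ × V → ℝ) =>
      (g.opinion c d z.1 z.2 1, fun p : ℕ × V => z.2 (1 + p.1, p.2)) := by
    refine (MarkedGraph.measurable_opinion c d measurable_const measurable_fst measurable_snd
      1).prodMk ?_
    fun_prop
  -- one step of the dynamics, together with the shift of the signals, preserves the product law
  have hone : (π.prod (signalLaw ν g)).map (fun z =>
      (g.opinion c d z.1 z.2 1, fun p : ℕ × V => z.2 (1 + p.1, p.2))) =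
      π.prod (signalLaw ν g) := by
    refine Measure.ext_of_lintegral _ fun f hf => ?_
    have hfin : Measurable fun z : (V → ℝ) × ((V → ℝ) × (ℕ × V → ℝ)) =>
        f ((fun i => g.avg c d z.1 i + z.2.1 i), z.2.2) :=
      hf.comp ((hav.comp (measurable_fst.prodMk (measurable_fst.comp measurable_snd))).prodMk
        (measurable_snd.comp measurable_snd))
    have hfs : Measurable fun z : (V → ℝ) × (ℕ × V → ℝ) =>
        f (g.opinion c d z.1 z.2 1, fun p : ℕ × V => z.2 (1 + p.1, p.2)) := hf.comp hstep
    rw [lintegral_map hf hstep, lintegral_prod _ hfs.aemeasurable]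
    have e1 : ∀ x : V → ℝ, ∫⁻ w, f (g.opinion c d x w 1, fun p : ℕ × V => w (1 + p.1, p.2))
        ∂signalLaw ν g = ∫⁻ y, ∫⁻ w', f ((fun i => g.avg c d x i + y i), w') ∂signalLaw ν g
          ∂Measure.pi fun v => ν (g.mark v) := by
      intro x
      have hfx := hfin.comp (measurable_prodMk_left (x := x))
      have h3 := lintegral_map hfx (show Measurable fun w : ℕ × V → ℝ =>
        ((fun v => w (0, v)), fun p : ℕ × V => w (1 + p.1, p.2)) by fun_prop)
        (μ := signalLaw ν g)
      rw [map_split_signalLaw, lintegral_prod _ hfx.aemeasurable] at h3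
      exact h3.symm
    simp only [e1]
    have hgm : Measurable fun x : V → ℝ => ∫⁻ w', f (x, w') ∂signalLaw ν g :=
      Measurable.lintegral_prod_right hf
    rw [lintegral_prod _ hf.aemeasurable]
    conv_rhs => rw [← hπ.2]
    have hga : Measurable fun z : (V → ℝ) × (V → ℝ) =>
        ∫⁻ w', f ((fun i => g.avg c d z.1 i + z.2 i), w') ∂signalLaw ν g := hgm.comp hav
    rw [lintegral_map hgm hav, lintegral_prod _ hga.aemeasurable]
  induction k with
  | zero =>
    change (π.prod (signalLaw ν g)).map Prod.fst = π
    rw [Measure.map_fst_prod]; simp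
  | succ k ih =>
    have hk : Measurable fun z : (V → ℝ) × (ℕ × V → ℝ) => g.opinion c d z.1 z.2 k :=
      MarkedGraph.measurable_opinion c d measurable_const measurable_fst measurable_snd k
    calc _ = (π.prod (signalLaw ν g)).map ((fun z => g.opinion c d z.1 z.2 k) ∘ fun z =>
          (g.opinion c d z.1 z.2 1, fun p : ℕ × V => z.2 (1 + p.1, p.2))) := by
          congr 1
          funext z
          rw [add_comm k 1, MarkedGraph.opinion_add]
          rfl
      _ = π := by rw [← Measure.map_map hk hstep, hone, ih]

/-- Stationary opinions lie in `[-1, 1]`: the part outside contracts. -/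
theorem IsStationaryLaw.ae_abs_le_one {π : Measure (V → ℝ)} (hπ : IsStationaryLaw ν c d g π)
    (hg : Admissible ν c d g) (hc : 0 ≤ c) (hd : 0 < d) (hcd : c + d ≤ 1) :
    ∀ᵐ x ∂π, ∀ i, |x i| ≤ 1 := by
  have := hπ.1
  have hd0 : 0 ≤ 1 - d := by linarith
  let φ : (V → ℝ) → ℝ := fun x => min 1 (max 0 (‖x‖ - 1))
  have hφc : Continuous φ := by fun_prop
  have hφ0 : ∀ z, 0 ≤ φ z := fun z => le_min zero_le_one (le_max_left _ _)
  have hφ1 : ∀ z, ‖φ z‖ ≤ 1 := fun z => by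
    rw [Real.norm_eq_abs, abs_of_nonneg (hφ0 z)]; exact min_le_left _ _
  have hφi : Integrable φ π := Integrable.of_bound hφc.aestronglyMeasurable 1 (ae_of_all _ hφ1)
  let ψ : ℕ → (V → ℝ) → ℝ := fun k x => min 1 ((1 - d) ^ k * ‖x‖)
  have hψc : ∀ k, Continuous (ψ k) := fun k => by fun_prop
  have hψ0 : ∀ k z, 0 ≤ ψ k z := fun k z => le_min zero_le_one (by positivity)
  have hψ1 : ∀ k z, ‖ψ k z‖ ≤ 1 := fun k z => by
    rw [Real.norm_eq_abs, abs_of_nonneg (hψ0 k z)]; exact min_le_left _ _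
  -- after `k` steps the opinions exceed `1` by at most `(1 - d) ^ k * ‖x‖`
  have hle : ∀ k, ∫ x, φ x ∂π ≤ ∫ x, ψ k x ∂π := by
    intro k
    have hk : Measurable fun z : (V → ℝ) × (ℕ × V → ℝ) => g.opinion c d z.1 z.2 k :=
      MarkedGraph.measurable_opinion c d measurable_const measurable_fst measurable_snd k
    have hi1 : Integrable (fun z : (V → ℝ) × (ℕ × V → ℝ) => φ (g.opinion c d z.1 z.2 k))
        (π.prod (signalLaw ν g)) :=
      Integrable.of_bound (hφc.measurable.comp hk).aestronglyMeasurable 1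
        (ae_of_all _ fun _ => hφ1 _)
    conv_lhs => rw [← hπ.map_opinion k]
    rw [integral_map hk.aemeasurable hφc.aestronglyMeasurable, integral_prod _ hi1]
    refine integral_mono hi1.integral_prod_left (Integrable.of_bound
      (hψc k).aestronglyMeasurable 1 (ae_of_all _ (hψ1 k))) fun x => ?_
    have h2 : ∫ w, φ (g.opinion c d x w k) ∂signalLaw ν g ≤ ∫ _, ψ k x ∂signalLaw ν g := by
      refine integral_mono_ae (Integrable.of_bound (hφc.measurable.comp
        (hk.comp measurable_prodMk_left)).aestronglyMeasurable 1 (ae_of_all _ fun _ => hφ1 _))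
        (integrable_const _) ?_
      filter_upwards [ae_abs_opinion_sub_le hg hc hcd x k] with w hw
      refine min_le_min le_rfl (max_le (by positivity) ?_)
      rw [sub_le_iff_le_add]
      refine (pi_norm_le_iff_of_nonneg (by positivity)).2 fun i => ?_
      rw [Real.norm_eq_abs]
      calc |g.opinion c d x w k i| = |(g.opinion c d x w k i - g.opinion c d (fun _ => 0) w k i) +
            g.opinion c d (fun _ => 0) w k i| := by rw [sub_add_cancel]
        _ ≤ _ := (abs_add_le _ _).trans (add_le_add (hw.2 i) (hw.1 i))
    simpa using h2
  have hlim : Tendsto (fun k => ∫ x, ψ k x ∂π) atTop (𝓝 (∫ _, (0 : ℝ) ∂π)) := by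
    refine tendsto_integral_of_dominated_convergence (fun _ => 1)
      (fun k => (hψc k).aestronglyMeasurable) (integrable_const _)
      (fun k => ae_of_all _ (hψ1 k)) (ae_of_all _ fun x => ?_)
    have h1 : Tendsto (fun k => (1 - d) ^ k * ‖x‖) atTop (𝓝 (0 * ‖x‖)) :=
      (tendsto_pow_atTop_nhds_zero_of_lt_one hd0 (by linarith)).mul_const _
    have h2 := (tendsto_const_nhds (x := (1 : ℝ))).min h1
    simpa [ψ] using h2
  rw [integral_zero] at hlim
  have hzero : ∫ x, φ x ∂π = 0 :=
    le_antisymm (ge_of_tendsto' hlim hle) (integral_nonneg hφ0)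
  filter_upwards [(integral_eq_zero_iff_of_nonneg hφ0 hφi).1 hzero] with x hx i
  refine le_trans (norm_le_pi_norm x i) ?_
  by_contra hcon
  push Not at hcon
  have : 0 < φ x := lt_min zero_lt_one (lt_max_of_lt_right (sub_pos.2 hcon))
  exact this.ne' hx

end Stationary

/-! ### Random marked graphs with signals -/

section WithSignals

variable {A : Type u} [MeasurableSpace A] {V : Type w} [MeasurableSpace V]
  (ν : Kernel (Mark A) ℝ) [IsMarkovKernel ν] {Ω : Type v} [MeasurableSpace Ω]

/-- The extension of a probability space with a random marked graph by signals which are, given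
everything else, independent with the laws prescribed by the marks. -/
noncomputable def withSignals (P : Measure Ω) (G : Ω → MarkedGraph V A) (hG : Measurable G) :
    Measure (Ω × (ℕ × V → ℝ)) :=
  P ⊗ₘ (signalKernel ν).comap G hG

variable {P : Measure Ω} {G : Ω → MarkedGraph V A} (hG : Measurable G)

instance [IsProbabilityMeasure P] : IsProbabilityMeasure (withSignals ν P G hG) := by
  unfold withSignals; infer_instance

variable {ν}

theorem ae_withSignals_signal_le [MetricSpace A] [Countable V] {c d : ℝ}
    (hadm : ∀ᵐ ω ∂P, Admissible ν c d (G ω)) :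
    ∀ᵐ z ∂withSignals ν P G hG, ∀ t v, |z.2 (t, v)| ≤ d + c - ((G z.1).mark v).totalWeight := by
  refine Measure.ae_compProd_of_ae_ae ?_ ?_
  · simp only [Set.ofPred_forall]
    refine MeasurableSet.iInter fun t => MeasurableSet.iInter fun v => measurableSet_le ?_ ?_
    · exact measurable_norm.comp ((measurable_pi_apply (t, v)).comp measurable_snd)
    · have hmk : Measurable fun z : Ω × (ℕ × V → ℝ) => (G z.1).mark v :=
        (MarkedGraph.measurable_mark v).comp (hG.comp measurable_fst)
      exact measurable_const.sub (measurable_sum_range (Mark.measurable_deg.comp hmk)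
        fun r => (Mark.measurable_weight r).comp hmk)
  · exact hadm.mono fun ω hω => ae_signal_le hω

variable [IsProbabilityMeasure P]

theorem lintegral_withSignals {F : Ω × (ℕ × V → ℝ) → ℝ≥0∞} (hF : Measurable F) :
    ∫⁻ p, F p ∂withSignals ν P G hG = ∫⁻ ω, ∫⁻ w, F (ω, w) ∂signalLaw ν (G ω) ∂P :=
  Measure.lintegral_compProd hF

theorem integral_withSignals {F : Ω × (ℕ × V → ℝ) → ℝ} (hF : Measurable F) {B : ℝ}
    (hB : ∀ p, |F p| ≤ B) :
    ∫ p, F p ∂withSignals ν P G hG = ∫ ω, ∫ w, F (ω, w) ∂signalLaw ν (G ω) ∂P :=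
  Measure.integral_compProd (Integrable.of_bound hF.aestronglyMeasurable B
    (ae_of_all _ fun _ => hB _))

theorem map_fst_withSignals : (withSignals ν P G hG).map Prod.fst = P :=
  Measure.fst_compProd P _

theorem ae_withSignals_of_ae {p : Ω → Prop} (hp : ∀ᵐ ω ∂P, p ω) :
    ∀ᵐ z ∂withSignals ν P G hG, p z.1 := by
  have h1 := map_fst_withSignals (P := P) (ν := ν) hG
  exact ae_of_ae_map measurable_fst.aemeasurable (by rw [h1]; exact hp)

variable [Countable V]

/-- In an opinion process, the graph, the initial opinions and the signals have the joint law of the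
extension by signals. -/
theorem IsOpinionProcess.map_eq {r0 : Ω → V → ℝ} {W : Ω → ℕ × V → ℝ}
    (hO : IsOpinionProcess ν P G r0 W) :
    P.map (fun ω => (G ω, r0 ω, W ω)) =
      (withSignals ν P G hG).map (fun z => (G z.1, r0 z.1, z.2)) := by
  have hX : Measurable fun ω => (G ω, r0 ω) := hG.prodMk hO.measurable_initial
  have hW := hO.measurable_signal
  have hm1 : Measurable fun ω => (G ω, r0 ω, W ω) :=
    hG.prodMk (hO.measurable_initial.prodMk hW)
  have hm2 : Measurable fun z : Ω × (ℕ × V → ℝ) => (G z.1, r0 z.1, z.2) :=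
    (hG.comp measurable_fst).prodMk ((hO.measurable_initial.comp measurable_fst).prodMk
      measurable_snd)
  refine Measure.ext_of_lintegral _ fun f hf => ?_
  let f' : (MarkedGraph V A × (V → ℝ)) × (ℕ × V → ℝ) → ℝ≥0∞ := fun z => f (z.1.1, z.1.2, z.2)
  have hf' : Measurable f' := hf.comp ((measurable_fst.comp measurable_fst).prodMk
    ((measurable_snd.comp measurable_fst).prodMk measurable_snd))
  rw [lintegral_map hf hm1, lintegral_map hf hm2]
  have e1 : ∫⁻ ω, f (G ω, r0 ω, W ω) ∂P =
      ∫⁻ z, f' z ∂(P.map (fun ω => (G ω, r0 ω)) ⊗ₘ condDistrib W (fun ω => (G ω, r0 ω)) P) := by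
    rw [compProd_map_condDistrib hW.aemeasurable, lintegral_map hf' (hX.prodMk hW)]
  have e2 : Measurable fun x => ∫⁻ w, f' (x, w) ∂condDistrib W (fun ω => (G ω, r0 ω)) P x :=
    Measurable.lintegral_kernel_prod_right' hf'
  rw [e1, Measure.lintegral_compProd hf', lintegral_map e2 hX]
  refine Eq.trans ?_ (lintegral_withSignals hG (hf.comp hm2)).symm
  exact lintegral_congr_ae (hO.condDistrib_signal.mono fun ω hω => by
    simp only [hω, f']; rfl)

/-- The extension by signals carries an opinion process. -/
theorem isOpinionProcess_withSignals {r0 : Ω → V → ℝ} (hr : Measurable r0) :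
    IsOpinionProcess ν (withSignals ν P G hG) (fun z => G z.1) (fun z => r0 z.1) Prod.snd := by
  have hX : Measurable fun z : Ω × (ℕ × V → ℝ) => (G z.1, r0 z.1) :=
    (hG.comp measurable_fst).prodMk (hr.comp measurable_fst)
  refine ⟨hG.comp measurable_fst, hr.comp measurable_fst, measurable_snd, ?_⟩
  let κ : Kernel (MarkedGraph V A × (V → ℝ)) (ℕ × V → ℝ) :=
    (signalKernel ν).comap Prod.fst measurable_fst
  have h := condDistrib_ae_eq_of_measure_eq_compProd (μ := withSignals ν P G hG)
    (fun z => (G z.1, r0 z.1)) (Y := Prod.snd) measurable_snd.aemeasurable (κ := κ) ?_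
  · exact ae_of_ae_map hX.aemeasurable h
  refine Measure.ext_of_lintegral _ fun f hf => ?_
  have hfm : Measurable fun z : Ω × (ℕ × V → ℝ) => f ((G z.1, r0 z.1), z.2) :=
    hf.comp (hX.prodMk measurable_snd)
  have e2 : Measurable fun x => ∫⁻ w, f (x, w) ∂κ x := Measurable.lintegral_kernel_prod_right' hf
  have e3 : Measurable fun ω => ∫⁻ w, f ((G ω, r0 ω), w) ∂signalLaw ν (G ω) :=
    e2.comp (hG.prodMk hr)
  rw [lintegral_map hf (hX.prodMk measurable_snd), lintegral_withSignals hG hfm,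
    Measure.lintegral_compProd hf, lintegral_map e2 hX]
  conv_lhs => rw [← map_fst_withSignals (P := P) (ν := ν) hG]
  rw [lintegral_map e3 measurable_fst]
  rfl

end WithSignals

/-! ### The limit law of the opinions -/

/-- A continuous function on a compact set which is a uniformly continuous retract extends to a
bounded uniformly continuous function. -/
theorem exists_uniformContinuous_extension {E : Type*} [PseudoMetricSpace E] {S : Set E}
    (hS : IsCompact S) {ρ : E → E} (hρ : UniformContinuous ρ) (hρS : ∀ x, ρ x ∈ S)
    (hρid : ∀ x ∈ S, ρ x = x) {f : E → ℝ} (hf : ContinuousOn f S) :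
    ∃ (f' : E → ℝ) (B : ℝ), UniformContinuous f' ∧ (∀ x, |f' x| ≤ B) ∧ ∀ x ∈ S, f' x = f x := by
  have : CompactSpace S := isCompact_iff_compactSpace.1 hS
  obtain ⟨B, hB⟩ := hS.exists_bound_of_continuousOn hf
  refine ⟨fun x => f (ρ x), B, ?_, fun x => hB _ (hρS x), fun x hx => congrArg f (hρid x hx)⟩
  have h1 : UniformContinuous (S.domRestrict f) :=
    CompactSpace.uniformContinuous_of_continuous hf.domRestrict
  exact h1.comp (hρ.subtype_mk hρS)

/-- The projection of `ℝ` onto `[-1, 1]`. -/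
noncomputable def clamp (x : ℝ) : ℝ := Set.projIcc (-1 : ℝ) 1 (by norm_num) x

theorem uniformContinuous_clamp : UniformContinuous clamp :=
  uniformContinuous_subtype_val.comp (LipschitzWith.projIcc (by norm_num)).uniformContinuous

theorem abs_clamp_le (x : ℝ) : |clamp x| ≤ 1 := abs_le.2 (Set.projIcc (-1 : ℝ) 1 _ x).2

theorem clamp_of_abs_le {x : ℝ} (hx : |x| ≤ 1) : clamp x = x :=
  congrArg Subtype.val (Set.projIcc_of_mem (by norm_num) (abs_le.1 hx))

theorem exists_extension_path {k : ℕ} {f : (Fin (k + 1) → ℝ) → ℝ}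
    (hf : ContinuousOn f (Metric.closedBall 0 1)) :
    ∃ (f' : (Fin (k + 1) → ℝ) → ℝ) (B : ℝ), UniformContinuous f' ∧ (∀ x, |f' x| ≤ B) ∧
      ∀ x ∈ Metric.closedBall 0 1, f' x = f x := by
  refine exists_uniformContinuous_extension (isCompact_closedBall _ _)
    (ρ := fun x r => clamp (x r)) ?_ ?_ ?_ hf
  · exact uniformContinuous_pi.2 fun r =>
      uniformContinuous_clamp.comp (Pi.uniformContinuous_proj _ r)
  · intro x
    rw [mem_closedBall_zero_iff]
    exact (pi_norm_le_iff_of_nonneg zero_le_one).2 fun r => abs_clamp_le _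
  · intro x hx
    rw [mem_closedBall_zero_iff] at hx
    funext r
    exact clamp_of_abs_le ((norm_le_pi_norm x r).trans hx)

theorem exists_extension_real {f : ℝ → ℝ} (hf : ContinuousOn f (Set.Icc (-1) 1)) :
    ∃ (f' : ℝ → ℝ) (B : ℝ), UniformContinuous f' ∧ (∀ x, |f' x| ≤ B) ∧
      ∀ x, |x| ≤ 1 → f' x = f x := by
  obtain ⟨f', B, h1, h2, h3⟩ := exists_uniformContinuous_extension (isCompact_Icc)
    uniformContinuous_clamp (fun x => abs_le.1 (abs_clamp_le x))
    (fun x hx => clamp_of_abs_le (abs_le.2 hx)) hf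
  exact ⟨f', B, h1, h2, fun x hx => h3 x (abs_le.1 hx)⟩

section PathLaw

variable {A : Type u} [MeasurableSpace A] (ν : Kernel (Mark A) ℝ) [IsMarkovKernel ν]
  {H : Type w} [MeasurableSpace H]

/-- The joint law of the opinions of the root of the limit graph at the times `0, …, k`. -/
noncomputable def pathLaw (c d : ℝ) (Γ : Measure H) {h : H → MarkedGraph ℕ A}
    (hh : Measurable h) (r : H → ℕ → ℝ) (k : ℕ) : Measure (Fin (k + 1) → ℝ) :=
  (withSignals ν Γ h hh).map fun z => (h z.1).opinionPath c d (r z.1) z.2 k 0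

/-- The law of the opinion of the root of the limit graph at time `k`. -/
noncomputable def rootLaw (c d : ℝ) (Γ : Measure H) {h : H → MarkedGraph ℕ A}
    (hh : Measurable h) (r : H → ℕ → ℝ) (k : ℕ) : Measure ℝ :=
  (pathLaw ν c d Γ hh r k).map fun x => x (Fin.last k)

variable {ν} {c d : ℝ} {Γ : Measure H} {h : H → MarkedGraph ℕ A}
  (hh : Measurable h) {r : H → ℕ → ℝ}

theorem measurable_rootPath (hh : Measurable h) (hr : Measurable r) (k : ℕ) :
    Measurable fun z : H × (ℕ × ℕ → ℝ) => (h z.1).opinionPath c d (r z.1) z.2 k 0 :=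
  MarkedGraph.measurable_opinionPath c d (hh.comp measurable_fst) (hr.comp measurable_fst)
    measurable_snd k measurable_const

theorem integral_rootLaw {k : ℕ} {f : ℝ → ℝ} (hf : Measurable f) :
    ∫ x, f x ∂rootLaw ν c d Γ hh r k = ∫ x, f (x (Fin.last k)) ∂pathLaw ν c d Γ hh r k := by
  rw [rootLaw, integral_map (measurable_pi_apply _).aemeasurable hf.aestronglyMeasurable]

theorem rootLaw_eq_map (hr : Measurable r) (k : ℕ) : rootLaw ν c d Γ hh r k =
    (withSignals ν Γ h hh).map fun z => (h z.1).opinion c d (r z.1) z.2 k 0 := by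
  rw [rootLaw, pathLaw, Measure.map_map (measurable_pi_apply _) (measurable_rootPath hh hr k)]
  rfl

variable [IsProbabilityMeasure Γ]

theorem isProbabilityMeasure_pathLaw (hr : Measurable r) (k : ℕ) :
    IsProbabilityMeasure (pathLaw ν c d Γ hh r k) :=
  Measure.isProbabilityMeasure_map (measurable_rootPath hh hr k).aemeasurable

theorem isProbabilityMeasure_rootLaw (hr : Measurable r) (k : ℕ) :
    IsProbabilityMeasure (rootLaw ν c d Γ hh r k) :=
  have := isProbabilityMeasure_pathLaw (ν := ν) (c := c) (d := d) (Γ := Γ) hh hr k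
  Measure.isProbabilityMeasure_map (measurable_pi_apply _).aemeasurable

theorem integral_pathLaw (hr : Measurable r) {k : ℕ} {f : (Fin (k + 1) → ℝ) → ℝ}
    (hf : Measurable f) {B : ℝ} (hB : ∀ x, |f x| ≤ B) :
    ∫ x, f x ∂pathLaw ν c d Γ hh r k = ∫ x, pathMean ν c d (h x) (r x) f 0 ∂Γ := by
  have hm := measurable_rootPath (c := c) (d := d) hh hr k
  rw [pathLaw, integral_map hm.aemeasurable hf.aestronglyMeasurable]
  exact integral_withSignals hh (hf.comp hm) fun _ => hB _

end PathLaw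

/-! ### Convergence of the empirical distributions at finite times -/

section Concentration

/-- The standing assumptions on opinion dynamics on the finite graphs `G n` with initial opinions
`R0 n`, and on the limit graph `h` with initial opinions `r`, both of them functions on `(H, Γ)`. -/
structure CoupledOpinions {A : Type u} [MetricSpace A] [MeasurableSpace A]
    (ν : Kernel (Mark A) ℝ) (K : ℝ≥0) (c d : ℝ) {Ω : ℕ → Type v} [∀ n, MeasurableSpace (Ω n)]
    (P : ∀ n, Measure (Ω n)) (G : ∀ n, Ω n → MarkedGraph (Fin (n + 1)) A)
    (R0 : ∀ n, Ω n → Fin (n + 1) → ℝ) {H : Type w} [MeasurableSpace H] (Γ : Measure H)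
    (h : H → MarkedGraph ℕ A) (r : H → ℕ → ℝ) : Prop where
  lipschitz : ∀ x y : Mark A, wasserstein1 (ν x) (ν y) ≤ ENNReal.ofReal (K * Mark.rho x y)
  c_nonneg : 0 ≤ c
  d_pos : 0 < d
  add_le : c + d ≤ 1
  measurable_graph : ∀ n, Measurable (G n)
  measurable_initial : ∀ n, Measurable (R0 n)
  measurable_limit : Measurable h
  measurable_limitInitial : Measurable r
  admissible : ∀ n, ∀ᵐ ω ∂(P n), Admissible ν c d (G n ω)
  initial_le : ∀ n, ∀ᵐ ω ∂(P n), ∀ i, |R0 n ω i| ≤ 1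
  pairCoupling : PairCoupling P G R0 Γ h r

variable {A : Type u} [MetricSpace A] [MeasurableSpace A]
  {ν : Kernel (Mark A) ℝ} {K : ℝ≥0} {c d : ℝ} {Ω : ℕ → Type v}
  [∀ n, MeasurableSpace (Ω n)] {P : ∀ n, Measure (Ω n)}
  {G : ∀ n, Ω n → MarkedGraph (Fin (n + 1)) A}
  {R0 : ∀ n, Ω n → Fin (n + 1) → ℝ} {H : Type w} [MeasurableSpace H] {Γ : Measure H}
  {h : H → MarkedGraph ℕ A} {r : H → ℕ → ℝ}

namespace CoupledOpinions

theorem measurable_opinionPath (X : CoupledOpinions ν K c d P G R0 Γ h r) (n k : ℕ)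
    (i : Fin (n + 1)) : Measurable fun z : Ω n × (ℕ × Fin (n + 1) → ℝ) =>
      (G n z.1).opinionPath c d (R0 n z.1) z.2 k i :=
  MarkedGraph.measurable_opinionPath c d ((X.measurable_graph n).comp measurable_fst)
    ((X.measurable_initial n).comp measurable_fst) measurable_snd k measurable_const

theorem measurable_opinion (X : CoupledOpinions ν K c d P G R0 Γ h r) (n k : ℕ) :
    Measurable fun z : Ω n × (ℕ × Fin (n + 1) → ℝ) =>
      (G n z.1).opinion c d (R0 n z.1) z.2 k :=
  MarkedGraph.measurable_opinion c d ((X.measurable_graph n).comp measurable_fst)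
    ((X.measurable_initial n).comp measurable_fst) measurable_snd k

theorem measurable_average (X : CoupledOpinions ν K c d P G R0 Γ h r) (n : ℕ) {k : ℕ}
    {f : (Fin (k + 1) → ℝ) → ℝ} (hf : Measurable f) :
    Measurable fun z : Ω n × (ℕ × Fin (n + 1) → ℝ) =>
      ∫ i, f ((G n z.1).opinionPath c d (R0 n z.1) z.2 k i) ∂unifVertex n := by
  simp only [integral_unifVertex]
  exact (Finset.measurable_sum _ fun i _ => hf.comp (X.measurable_opinionPath n k i)).const_mul _

variable [IsMarkovKernel ν] [∀ n, IsProbabilityMeasure (P n)]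

theorem ae_abs_opinion_le_one (X : CoupledOpinions ν K c d P G R0 Γ h r) (n : ℕ) :
    ∀ᵐ z ∂withSignals ν (P n) (G n) (X.measurable_graph n),
      ∀ k i, |(G n z.1).opinion c d (R0 n z.1) z.2 k i| ≤ 1 := by
  filter_upwards [ae_withSignals_signal_le (X.measurable_graph n) (X.admissible n),
    ae_withSignals_of_ae (ν := ν) (X.measurable_graph n) (X.initial_le n)] with z hz hz0 k i
  exact MarkedGraph.abs_opinion_le_one X.add_le hz0 hz k i

theorem ae_opinionPath_mem (X : CoupledOpinions ν K c d P G R0 Γ h r) (n k : ℕ) :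
    ∀ᵐ z ∂withSignals ν (P n) (G n) (X.measurable_graph n),
      ∀ i, (G n z.1).opinionPath c d (R0 n z.1) z.2 k i ∈ Metric.closedBall 0 1 := by
  filter_upwards [X.ae_abs_opinion_le_one n] with z hz i
  rw [mem_closedBall_zero_iff]
  exact (pi_norm_le_iff_of_nonneg zero_le_one).2 fun t => hz t i

variable [IsProbabilityMeasure Γ]

/-- Convergence of averages in mean square, for bounded uniformly continuous test functions. -/
theorem tendsto_sq_of_uniformContinuous (X : CoupledOpinions ν K c d P G R0 Γ h r) {k : ℕ}
    {f : (Fin (k + 1) → ℝ) → ℝ} (hf : UniformContinuous f) {B : ℝ} (hB : ∀ x, |f x| ≤ B) :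
    Tendsto (fun n => ∫⁻ z, ENNReal.ofReal
      ((∫ i, f ((G n z.1).opinionPath c d (R0 n z.1) z.2 k i) ∂unifVertex n -
        ∫ x, f x ∂pathLaw ν c d Γ X.measurable_limit r k) ^ 2)
          ∂withSignals ν (P n) (G n) (X.measurable_graph n)) atTop (𝓝 0) := by
  have hfm := hf.continuous.measurable
  have h1 := X.pairCoupling.tendsto_average X.lipschitz X.c_nonneg X.d_pos X.add_le
    X.measurable_graph X.measurable_initial X.admissible X.initial_le X.measurable_limit
    X.measurable_limitInitial hf hB
  rw [integral_pathLaw X.measurable_limit X.measurable_limitInitial hfm hB]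
  refine h1.congr fun n => (lintegral_withSignals _ ?_).symm
  exact ENNReal.measurable_ofReal.comp (((X.measurable_average n hfm).sub_const _).pow_const 2)

/-- The opinions of the root of the limit graph stay in `[-1, 1]`. -/
theorem ae_pathLaw_mem (X : CoupledOpinions ν K c d P G R0 Γ h r) (k : ℕ) :
    ∀ᵐ x ∂pathLaw ν c d Γ X.measurable_limit r k, x ∈ Metric.closedBall 0 1 := by
  have := isProbabilityMeasure_pathLaw (ν := ν) (c := c) (d := d) (Γ := Γ) X.measurable_limit
    X.measurable_limitInitial k
  -- a bounded test function that vanishes on the ball only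
  let φ : (Fin (k + 1) → ℝ) → ℝ := fun x => Set.projIcc (0 : ℝ) 1 zero_le_one (‖x‖ - 1)
  have hφu : UniformContinuous φ := uniformContinuous_subtype_val.comp
    ((LipschitzWith.projIcc zero_le_one).uniformContinuous.comp
      (uniformContinuous_norm.sub uniformContinuous_const))
  have hφ0 : ∀ x, 0 ≤ φ x := fun x => (Set.projIcc (0 : ℝ) 1 _ _).2.1
  have hφ1 : ∀ x, |φ x| ≤ 1 := fun x => by
    rw [abs_of_nonneg (hφ0 x)]; exact (Set.projIcc (0 : ℝ) 1 _ _).2.2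
  have hφz : ∀ x, φ x = 0 ↔ x ∈ Metric.closedBall 0 1 := fun x => by
    rw [mem_closedBall_zero_iff]
    constructor
    · intro hx
      by_contra! hlt
      have h2 : Set.projIcc (0 : ℝ) 1 zero_le_one (‖x‖ - 1) = ⟨0, by simp⟩ := Subtype.ext hx
      have := (Set.projIcc_eq_left (zero_lt_one' ℝ)).1 h2
      linarith
    · intro hx
      exact congrArg Subtype.val (Set.projIcc_of_le_left zero_le_one (by linarith))
  have h1 := X.tendsto_sq_of_uniformContinuous hφu hφ1
  set m := ∫ x, φ x ∂pathLaw ν c d Γ X.measurable_limit r k with hm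
  have h2 : ∀ n, ∫⁻ z, ENNReal.ofReal
      ((∫ i, φ ((G n z.1).opinionPath c d (R0 n z.1) z.2 k i) ∂unifVertex n - m) ^ 2)
        ∂withSignals ν (P n) (G n) (X.measurable_graph n) = ENNReal.ofReal (m ^ 2) := by
    intro n
    rw [lintegral_congr_ae (g := fun _ => ENNReal.ofReal (m ^ 2))]
    · simp
    filter_upwards [X.ae_opinionPath_mem n k] with z hz
    simp [(hφz _).2 (hz _)]
  simp only [h2] at h1
  have h3 := tendsto_nhds_unique h1 tendsto_const_nhds
  have h4 : m = 0 := by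
    have h3 := ENNReal.ofReal_eq_zero.1 h3.symm
    exact pow_eq_zero_iff (two_ne_zero) |>.1 (le_antisymm h3 (sq_nonneg m))
  have h5 := (integral_eq_zero_iff_of_nonneg hφ0 (Integrable.of_bound
    hφu.continuous.aestronglyMeasurable 1 (ae_of_all _ hφ1))).1 (hm ▸ h4)
  exact h5.mono fun x hx => (hφz x).1 hx

theorem ae_rootLaw_le (X : CoupledOpinions ν K c d P G R0 Γ h r) (k : ℕ) :
    ∀ᵐ x ∂rootLaw ν c d Γ X.measurable_limit r k, |x| ≤ 1 := by
  refine (ae_map_iff (measurable_pi_apply _).aemeasurable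
    (measurableSet_le measurable_norm measurable_const)).2 ?_
  exact (X.ae_pathLaw_mem k).mono fun x hx =>
    (norm_le_pi_norm x _).trans (mem_closedBall_zero_iff.1 hx)

/-- Convergence of averages in mean square. -/
theorem tendsto_sq (X : CoupledOpinions ν K c d P G R0 Γ h r) {k : ℕ}
    {f : (Fin (k + 1) → ℝ) → ℝ} (hf : Continuous f) :
    Tendsto (fun n => ∫⁻ z, ENNReal.ofReal
      ((∫ i, f ((G n z.1).opinionPath c d (R0 n z.1) z.2 k i) ∂unifVertex n -
        ∫ x, f x ∂pathLaw ν c d Γ X.measurable_limit r k) ^ 2)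
          ∂withSignals ν (P n) (G n) (X.measurable_graph n)) atTop (𝓝 0) := by
  obtain ⟨f', B, hf'u, hf'B, hff'⟩ := exists_extension_path hf.continuousOn
  have h1 := X.tendsto_sq_of_uniformContinuous hf'u hf'B
  have h2 : ∫ x, f' x ∂pathLaw ν c d Γ X.measurable_limit r k =
      ∫ x, f x ∂pathLaw ν c d Γ X.measurable_limit r k :=
    integral_congr_ae ((X.ae_pathLaw_mem k).mono fun x hx => hff' x hx)
  rw [h2] at h1
  refine h1.congr fun n => lintegral_congr_ae ?_
  filter_upwards [X.ae_opinionPath_mem n k] with z hz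
  simp only [hff' _ (hz _)]

theorem tendsto_sq_opinion (X : CoupledOpinions ν K c d P G R0 Γ h r) (k : ℕ)
    {f : ℝ → ℝ} (hf : Continuous f) :
    Tendsto (fun n => ∫⁻ z, ENNReal.ofReal
      ((∫ i, f ((G n z.1).opinion c d (R0 n z.1) z.2 k i) ∂unifVertex n -
        ∫ x, f x ∂rootLaw ν c d Γ X.measurable_limit r k) ^ 2)
          ∂withSignals ν (P n) (G n) (X.measurable_graph n)) atTop (𝓝 0) := by
  rw [integral_rootLaw _ hf.measurable]
  exact X.tendsto_sq (f := fun x => f (x (Fin.last k))) (by fun_prop)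

theorem tendsto_mean_opinion (X : CoupledOpinions ν K c d P G R0 Γ h r) (k : ℕ)
    (f : BoundedContinuousFunction ℝ ℝ) :
    Tendsto (fun n => ∫ z, ∫ i, f ((G n z.1).opinion c d (R0 n z.1) z.2 k i) ∂unifVertex n
      ∂withSignals ν (P n) (G n) (X.measurable_graph n)) atTop
      (𝓝 (∫ x, f x ∂rootLaw ν c d Γ X.measurable_limit r k)) := by
  have h1 := tendsto_lintegral_abs_of_sq (X.tendsto_sq_opinion k f.continuous)
  set m := ∫ x, f x ∂rootLaw ν c d Γ X.measurable_limit r k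
  rw [tendsto_iff_dist_tendsto_zero]
  have h2 := (ENNReal.tendsto_toReal ENNReal.zero_ne_top).comp h1
  refine squeeze_zero (fun _ => dist_nonneg) (fun n => ?_) h2
  have hm : Measurable fun z : Ω n × (ℕ × Fin (n + 1) → ℝ) =>
      ∫ i, f ((G n z.1).opinion c d (R0 n z.1) z.2 k i) ∂unifVertex n :=
    X.measurable_average n (f := fun x => f (x (Fin.last k))) (by fun_prop)
  have hb : ∀ z : Ω n × (ℕ × Fin (n + 1) → ℝ),
      ‖∫ i, f ((G n z.1).opinion c d (R0 n z.1) z.2 k i) ∂unifVertex n‖ ≤ ‖f‖ := fun z => by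
    simpa using norm_integral_le_of_norm_le_const (μ := unifVertex n)
      (ae_of_all _ fun i => f.norm_coe_le_norm ((G n z.1).opinion c d (R0 n z.1) z.2 k i))
  have hi := Integrable.of_bound (μ := withSignals ν (P n) (G n) (X.measurable_graph n))
    hm.aestronglyMeasurable ‖f‖ (ae_of_all _ hb)
  have e1 : (∫ z, ∫ i, f ((G n z.1).opinion c d (R0 n z.1) z.2 k i) ∂unifVertex n
      ∂withSignals ν (P n) (G n) (X.measurable_graph n)) - m =
      ∫ z, (∫ i, f ((G n z.1).opinion c d (R0 n z.1) z.2 k i) ∂unifVertex n - m)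
        ∂withSignals ν (P n) (G n) (X.measurable_graph n) := by
    rw [integral_sub hi (integrable_const _)]
    simp
  rw [Real.dist_eq, e1]
  refine abs_integral_le_integral_abs.trans (le_of_eq ?_)
  exact integral_eq_lintegral_of_nonneg_ae (ae_of_all _ fun _ => abs_nonneg _)
    (hm.sub_const m).abs.aestronglyMeasurable

end CoupledOpinions

end Concentration

/-! ### The limit of the laws at large times -/

theorem map_shift_withSignals {A : Type u} [MeasurableSpace A] {V : Type w} [MeasurableSpace V]
    {ν : Kernel (Mark A) ℝ} [IsMarkovKernel ν] {Ω : Type v} [MeasurableSpace Ω] {P : Measure Ω}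
    [IsProbabilityMeasure P] {G : Ω → MarkedGraph V A} (hG : Measurable G) (m : ℕ) :
    (withSignals ν P G hG).map (fun z => (z.1, fun p : ℕ × V => z.2 (m + p.1, p.2))) =
      withSignals ν P G hG := by
  have hs : Measurable fun w : ℕ × V → ℝ => fun p : ℕ × V => w (m + p.1, p.2) := by fun_prop
  have hm : Measurable fun z : Ω × (ℕ × V → ℝ) => (z.1, fun p : ℕ × V => z.2 (m + p.1, p.2)) :=
    measurable_fst.prodMk (hs.comp measurable_snd)
  refine Measure.ext_of_lintegral _ fun f hf => ?_
  rw [lintegral_map hf hm, lintegral_withSignals hG hf]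
  refine (lintegral_withSignals hG (hf.comp hm)).trans ?_
  refine lintegral_congr fun ω => ?_
  have hfω : Measurable fun w => f (ω, w) := hf.comp measurable_prodMk_left
  conv_rhs => rw [← map_shift_signalLaw (ν := ν) (g := G ω) m]
  exact (lintegral_map hfω hs).symm

section Limit

variable {A : Type u} [MetricSpace A] [MeasurableSpace A]
  {ν : Kernel (Mark A) ℝ} [IsMarkovKernel ν] {K : ℝ≥0} {c d : ℝ} {Ω : ℕ → Type v}
  [∀ n, MeasurableSpace (Ω n)] {P : ∀ n, Measure (Ω n)} [∀ n, IsProbabilityMeasure (P n)]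
  {G : ∀ n, Ω n → MarkedGraph (Fin (n + 1)) A}
  {R0 : ∀ n, Ω n → Fin (n + 1) → ℝ} {H : Type w} [MeasurableSpace H] {Γ : Measure H}
  [IsProbabilityMeasure Γ] {h : H → MarkedGraph ℕ A} {r : H → ℕ → ℝ}
  {R1 : ∀ n, Ω n → Fin (n + 1) → ℝ} {H' : Type w} [MeasurableSpace H'] {Γ' : Measure H'}
  [IsProbabilityMeasure Γ'] {h' : H' → MarkedGraph ℕ A} {r' : H' → ℕ → ℝ}

namespace CoupledOpinions

/-- The limit laws of opinions with different initial opinions and different starting times are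
close. The coupling is a weak limit of couplings on the finite graphs, in which the same signals
drive both opinions: the signals of the steps `j, …, j + k - 1` of one are those of the first `k`
steps of the other. -/
theorem exists_coupling_rootLaw (X : CoupledOpinions ν K c d P G R0 Γ h r)
    (Y : CoupledOpinions ν K c d P G R1 Γ' h' r') (j k : ℕ) :
    ∃ π : Measure (ℝ × ℝ), π.map Prod.fst = rootLaw ν c d Γ X.measurable_limit r k ∧
      π.map Prod.snd = rootLaw ν c d Γ' Y.measurable_limit r' (j + k) ∧
      ∀ᵐ z ∂π, |z.1 - z.2| ≤ (1 - d) ^ k * 2 := by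
  have := isProbabilityMeasure_rootLaw (ν := ν) (c := c) (d := d) (Γ := Γ) X.measurable_limit
    X.measurable_limitInitial k
  have := isProbabilityMeasure_rootLaw (ν := ν) (c := c) (d := d) (Γ := Γ') Y.measurable_limit
    Y.measurable_limitInitial (j + k)
  -- `x n ∘ sh n` and `y n` are the two opinions, and `τ n` is their joint law at a uniform vertex
  let sh : ∀ n, Ω n × (ℕ × Fin (n + 1) → ℝ) → Ω n × (ℕ × Fin (n + 1) → ℝ) :=
    fun n z => (z.1, fun p => z.2 (j + p.1, p.2))
  have hsh : ∀ n, Measurable (sh n) := fun n => by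
    refine measurable_fst.prodMk ?_
    have : Measurable fun w : ℕ × Fin (n + 1) → ℝ => fun p : ℕ × Fin (n + 1) =>
        w (j + p.1, p.2) := by
      fun_prop
    exact this.comp measurable_snd
  let x : ∀ n, Ω n × (ℕ × Fin (n + 1) → ℝ) → Fin (n + 1) → ℝ :=
    fun n z => (G n z.1).opinion c d (R0 n z.1) z.2 k
  let y : ∀ n, Ω n × (ℕ × Fin (n + 1) → ℝ) → Fin (n + 1) → ℝ :=
    fun n z => (G n z.1).opinion c d (R1 n z.1) z.2 (j + k)
  have hx : ∀ n, Measurable (x n) := fun n => X.measurable_opinion n k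
  have hy : ∀ n, Measurable (y n) := fun n => Y.measurable_opinion n (j + k)
  let μ : ∀ n, Measure (Ω n × (ℕ × Fin (n + 1) → ℝ)) := fun n =>
    withSignals ν (P n) (G n) (X.measurable_graph n)
  have hev : ∀ {n} {F : Ω n × (ℕ × Fin (n + 1) → ℝ) → Fin (n + 1) → ℝ}, Measurable F →
      Measurable fun p : (Ω n × (ℕ × Fin (n + 1) → ℝ)) × Fin (n + 1) => F p.1 p.2 :=
    fun {n F} hF => measurable_eval_countable (F := fun p : _ × Fin (n + 1) => F p.1)
      (hF.comp measurable_fst) measurable_snd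
  have hpm : ∀ n, Measurable fun p : (Ω n × (ℕ × Fin (n + 1) → ℝ)) × Fin (n + 1) =>
      (x n (sh n p.1) p.2, y n p.1 p.2) := fun n =>
    (hev ((hx n).comp (hsh n))).prodMk (hev (hy n))
  let τ : ∀ n, Measure (ℝ × ℝ) := fun n => ((μ n).prod (unifVertex n)).map
    fun p => (x n (sh n p.1) p.2, y n p.1 p.2)
  have hτ : ∀ n, IsProbabilityMeasure (τ n) := fun n =>
    Measure.isProbabilityMeasure_map (hpm n).aemeasurable
  have hae : ∀ n, ∀ᵐ p ∂(μ n).prod (unifVertex n), |x n (sh n p.1) p.2| ≤ 1 ∧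
      |y n p.1 p.2| ≤ 1 ∧ |x n (sh n p.1) p.2 - y n p.1 p.2| ≤ (1 - d) ^ k * 2 := by
    intro n
    have h0 : ∀ᵐ z ∂μ n, ∀ i, |x n (sh n z) i| ≤ 1 ∧
        |y n z i| ≤ 1 ∧ |x n (sh n z) i - y n z i| ≤ (1 - d) ^ k * 2 := by
      have hX := X.ae_abs_opinion_le_one n
      rw [← map_shift_withSignals (X.measurable_graph n) j] at hX
      filter_upwards [ae_of_ae_map (hsh n).aemeasurable hX, Y.ae_abs_opinion_le_one n,
        ae_withSignals_of_ae (ν := ν) (X.measurable_graph n) (X.initial_le n),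
        ae_withSignals_of_ae (ν := ν) (X.measurable_graph n) (X.admissible n)]
        with z hz1 hz2 hz3 hz4 i
      refine ⟨hz1 k i, hz2 (j + k) i, ?_⟩
      change |(G n z.1).opinion c d (R0 n z.1) (fun p => z.2 (j + p.1, p.2)) k i -
        (G n z.1).opinion c d (R1 n z.1) z.2 (j + k) i| ≤ _
      rw [MarkedGraph.opinion_add]
      refine MarkedGraph.abs_opinion_sub_le hz4.hasWeightSum X.c_nonneg X.add_le (fun i => ?_) k i
      have := (abs_sub (R0 n z.1 i) ((G n z.1).opinion c d (R1 n z.1) z.2 j i)).trans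
        (add_le_add (hz3 i) (hz2 j i))
      linarith
    have h1 : ∀ᵐ p ∂(μ n).prod (unifVertex n), ∀ i, |x n (sh n p.1) i| ≤ 1 ∧
        |y n p.1 i| ≤ 1 ∧ |x n (sh n p.1) i - y n p.1 i| ≤ (1 - d) ^ k * 2 :=
      Measure.quasiMeasurePreserving_fst.ae h0
    exact h1.mono fun p hp => hp p.2
  -- the mean of a function of one of the two opinions
  have hint : ∀ (n : ℕ) (f : BoundedContinuousFunction ℝ ℝ)
      (F : Ω n × (ℕ × Fin (n + 1) → ℝ) → Fin (n + 1) → ℝ), Measurable F →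
      ∫ p, f (F p.1 p.2) ∂(μ n).prod (unifVertex n) =
        ∫ z, ∫ i, f (F z i) ∂unifVertex n ∂μ n := fun n f F hF =>
    integral_prod _ (Integrable.of_bound
      (f.continuous.measurable.comp (hev hF)).aestronglyMeasurable ‖f‖
      (ae_of_all _ fun _ => f.norm_coe_le_norm _))
  refine exists_coupling_of_tendsto (l := atTop) (τ := τ) (.of_forall fun n => ?_)
    (.of_forall fun n => ?_) (fun f => ?_) fun f => ?_
  · refine (ae_map_iff (hpm n).aemeasurable
      (measurableSet_Icc.prod measurableSet_Icc)).2 ((hae n).mono fun p hp => ?_)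
    exact ⟨abs_le.1 hp.1, abs_le.1 hp.2.1⟩
  · exact (ae_map_iff (hpm n).aemeasurable (measurableSet_le
      (measurable_norm.comp (measurable_fst.sub measurable_snd)) measurable_const)).2
      ((hae n).mono fun p hp => hp.2.2)
  · refine (X.tendsto_mean_opinion k f).congr fun n => ?_
    have e1 : ∫ z, f z.1 ∂τ n = ∫ p, f (x n (sh n p.1) p.2) ∂(μ n).prod (unifVertex n) :=
      integral_map (hpm n).aemeasurable
        (f.continuous.measurable.comp measurable_fst).aestronglyMeasurable
    have e2 := hint n f (fun z => x n (sh n z)) ((hx n).comp (hsh n))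
    rw [e1, e2]
    have hF : StronglyMeasurable fun z => ∫ i, f (x n z i) ∂unifVertex n :=
      StronglyMeasurable.integral_prod_right'
        (f.continuous.measurable.comp (hev (hx n))).stronglyMeasurable
    conv_lhs => rw [← map_shift_withSignals (ν := ν) (P := P n) (X.measurable_graph n) j]
    exact integral_map (hsh n).aemeasurable hF.aestronglyMeasurable
  · refine (Y.tendsto_mean_opinion (j + k) f).congr fun n => ?_
    have e1 : ∫ z, f z.2 ∂τ n = ∫ p, f (y n p.1 p.2) ∂(μ n).prod (unifVertex n) :=
      integral_map (hpm n).aemeasurable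
        (f.continuous.measurable.comp measurable_snd).aestronglyMeasurable
    rw [e1, hint n f (y n) (hy n)]

/-- The coupling of the limit law at time `k` with a limit point of the limit laws. -/
theorem exists_coupling_limit (X : CoupledOpinions ν K c d P G R0 Γ h r)
    (Y : CoupledOpinions ν K c d P G R1 Γ' h' r') {l : Filter ℕ} [l.NeBot] (hl : l ≤ atTop)
    {μ : Measure ℝ} [IsProbabilityMeasure μ]
    (hμ : ∀ f : BoundedContinuousFunction ℝ ℝ, Tendsto
      (fun m => ∫ x, f x ∂rootLaw ν c d Γ' Y.measurable_limit r' m) l (𝓝 (∫ x, f x ∂μ))) (k : ℕ) :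
    ∃ π : Measure (ℝ × ℝ), π.map Prod.fst = rootLaw ν c d Γ X.measurable_limit r k ∧
      π.map Prod.snd = μ ∧ ∀ᵐ z ∂π, |z.1 - z.2| ≤ (1 - d) ^ k * 2 := by
  have := isProbabilityMeasure_rootLaw (ν := ν) (c := c) (d := d) (Γ := Γ) X.measurable_limit
    X.measurable_limitInitial k
  choose π h1 h2 h3 using fun j => X.exists_coupling_rootLaw Y j k
  have hπ : ∀ j, IsProbabilityMeasure (π j) := fun j => by
    have h4 : IsProbabilityMeasure ((π j).map Prod.fst) := by rw [h1 j]; infer_instance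
    exact Measure.isProbabilityMeasure_of_map Prod.fst
  -- along `l`, the limit point is compared at the times `m = (m - k) + k`
  refine exists_coupling_of_tendsto (l := l) (τ := fun m => π (m - k)) (.of_forall fun m => ?_)
    (.of_forall fun m => h3 _) (fun f => ?_) fun f => ?_
  · have a1 := X.ae_rootLaw_le k
    have a2 := Y.ae_rootLaw_le (m - k + k)
    rw [← h1 (m - k)] at a1
    rw [← h2 (m - k)] at a2
    filter_upwards [ae_of_ae_map measurable_fst.aemeasurable a1,
      ae_of_ae_map measurable_snd.aemeasurable a2] with z hz1 hz2
    exact ⟨abs_le.1 hz1, abs_le.1 hz2⟩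
  · refine tendsto_const_nhds.congr fun m => ?_
    rw [← h1 (m - k), integral_map measurable_fst.aemeasurable
      f.continuous.measurable.aestronglyMeasurable]
  · refine (hμ f).congr' (hl (eventually_ge_atTop k |>.mono fun m hm => ?_))
    have e : m - k + k = m := Nat.sub_add_cancel hm
    have h4 := h2 (m - k)
    rw [e] at h4
    rw [← h4, integral_map measurable_snd.aemeasurable
      f.continuous.measurable.aestronglyMeasurable]

end CoupledOpinions

/-- A probability measure within distance `(1 - d) ^ k * 2` of the laws `ρ k` is their limit. -/
theorem tendsto_integral_of_coupling {d : ℝ} (hd : 0 < d) (hd1 : d ≤ 1) {ρ : ℕ → Measure ℝ}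
    {μ : Measure ℝ} [IsProbabilityMeasure μ]
    (hπ : ∀ k, ∃ π : Measure (ℝ × ℝ), π.map Prod.fst = ρ k ∧ π.map Prod.snd = μ ∧
      ∀ᵐ z ∂π, |z.1 - z.2| ≤ (1 - d) ^ k * 2)
    {f : ℝ → ℝ} (hf : UniformContinuous f) {B : ℝ} (hB : ∀ x, |f x| ≤ B) :
    Tendsto (fun k => ∫ x, f x ∂ρ k) atTop (𝓝 (∫ x, f x ∂μ)) := by
  rw [Metric.tendsto_atTop]
  intro η hη
  obtain ⟨L, hL0, hL⟩ := exists_modulus hB hf (half_pos hη)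
  have hlim : Tendsto (fun k => η / 2 + L * ((1 - d) ^ k * 2)) atTop (𝓝 (η / 2 + L * (0 * 2))) :=
    tendsto_const_nhds.add (((tendsto_pow_atTop_nhds_zero_of_lt_one (by linarith)
      (by linarith)).mul_const 2).const_mul L)
  obtain ⟨N, hN⟩ := eventually_atTop.1 (hlim.eventually_lt_const
    (u := η) (by linarith))
  refine ⟨N, fun k hk => lt_of_le_of_lt ?_ (hN k hk)⟩
  obtain ⟨π, h1, h2, h3⟩ := hπ k
  have : IsProbabilityMeasure π := by
    have h4 : IsProbabilityMeasure (π.map Prod.snd) := by rw [h2]; infer_instance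
    exact Measure.isProbabilityMeasure_of_map Prod.snd
  have hfm := hf.continuous.measurable
  have hi1 : Integrable (fun z : ℝ × ℝ => f z.1) π := Integrable.of_bound
    (hfm.comp measurable_fst).aestronglyMeasurable B (ae_of_all _ fun _ => hB _)
  have hi2 : Integrable (fun z : ℝ × ℝ => f z.2) π := Integrable.of_bound
    (hfm.comp measurable_snd).aestronglyMeasurable B (ae_of_all _ fun _ => hB _)
  rw [← h1, ← h2, integral_map measurable_fst.aemeasurable hfm.aestronglyMeasurable,
    integral_map measurable_snd.aemeasurable hfm.aestronglyMeasurable, Real.dist_eq,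
    ← integral_sub hi1 hi2]
  have h5 := norm_integral_le_of_norm_le_const (μ := π) (f := fun z => f z.1 - f z.2)
    (C := η / 2 + L * ((1 - d) ^ k * 2)) (h3.mono fun z hz => (hL z.1 z.2).trans
      (add_le_add le_rfl (mul_le_mul_of_nonneg_left hz hL0)))
  simpa using h5

end Limit

/-! ### The stationary opinions -/

theorem lintegral_comp_eq_condDistrib {Ω α β : Type*} [MeasurableSpace Ω] [MeasurableSpace α]
    [MeasurableSpace β] [StandardBorelSpace β] [Nonempty β] {P : Measure Ω} [IsFiniteMeasure P]
    {X : Ω → α} {R : Ω → β} (hX : Measurable X) (hR : Measurable R) {φ : β → ℝ≥0∞}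
    (hφ : Measurable φ) :
    ∫⁻ ω, φ (R ω) ∂P = ∫⁻ ω, ∫⁻ r, φ r ∂condDistrib R X P (X ω) ∂P := by
  have h1 : ∫⁻ ω, φ (R ω) ∂P = ∫⁻ z, φ z.2 ∂P.map (fun ω => (X ω, R ω)) :=
    (lintegral_map (hφ.comp measurable_snd) (hX.prodMk hR)).symm
  rw [h1, ← compProd_map_condDistrib hR.aemeasurable]
  exact (Measure.lintegral_compProd (hφ.comp measurable_snd)).trans
    (lintegral_map hφ.lintegral_kernel hX)

section Stationary

variable {A : Type u} [MeasurableSpace A]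
  {ν : Kernel (Mark A) ℝ} [IsMarkovKernel ν] {c d : ℝ}

/-- Stationary opinions lie in `[-1, 1]`. -/
theorem ae_abs_le_one_of_isStationaryLaw {V : Type*} [Fintype V] [MeasurableSpace V]
    [MeasurableSingletonClass V] {Ω : Type v} [MeasurableSpace Ω] {P : Measure Ω}
    [IsProbabilityMeasure P] {G : Ω → MarkedGraph V A} (hG : Measurable G) {R : Ω → V → ℝ}
    (hR : Measurable R) (hadm : ∀ᵐ ω ∂P, Admissible ν c d (G ω))
    (hst : ∀ᵐ ω ∂P, IsStationaryLaw ν c d (G ω) (condDistrib R G P (G ω)))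
    (hc : 0 ≤ c) (hd : 0 < d) (hcd : c + d ≤ 1) : ∀ᵐ ω ∂P, ∀ i, |R ω i| ≤ 1 := by
  have hs : MeasurableSet {x : V → ℝ | ∀ i, |x i| ≤ 1} := by
    simp only [Set.ofPred_forall]
    exact MeasurableSet.iInter fun i =>
      measurableSet_le (measurable_norm.comp (measurable_pi_apply i)) measurable_const
  have h1 := lintegral_comp_eq_condDistrib (P := P) hG hR
    (φ := {x : V → ℝ | ∀ i, |x i| ≤ 1}ᶜ.indicator 1) (measurable_one.indicator hs.compl)
  have h2 : ∫⁻ ω, ∫⁻ x, {x : V → ℝ | ∀ i, |x i| ≤ 1}ᶜ.indicator 1 x ∂condDistrib R G P (G ω) ∂P =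
      ∫⁻ _, 0 ∂P := by
    refine lintegral_congr_ae ?_
    filter_upwards [hadm, hst] with ω h3 h4
    rw [lintegral_indicator_one hs.compl]
    exact h4.ae_abs_le_one h3 hc hd hcd
  rw [h2, lintegral_zero] at h1
  filter_upwards [(lintegral_eq_zero_iff ((measurable_one.indicator hs.compl).comp hR)).1 h1]
    with ω hω
  by_contra hn
  simp [Set.indicator_of_mem (show R ω ∈ {x : V → ℝ | ∀ i, |x i| ≤ 1}ᶜ from hn)] at hω

/-- Stationary opinions have the law of the opinions at time `k` started from them, which hardly
depend on the initial opinions and may be replaced by those started from zero. -/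
theorem IsStationaryLaw.lintegral_average_le {n : ℕ} {g : MarkedGraph (Fin (n + 1)) A}
    {π : Measure (Fin (n + 1) → ℝ)} (hπ : IsStationaryLaw ν c d g π) (hg : Admissible ν c d g)
    (hc : 0 ≤ c) (hd : 0 < d) (hd1 : d ≤ 1) (hcd : c + d ≤ 1) {f : ℝ → ℝ} (hf : Measurable f)
    {η L : ℝ} (hL : 0 ≤ L) (hmod : ∀ x y, |f x - f y| ≤ η + L * dist x y)
    (k : ℕ) (a m : ℝ) :
    ∫⁻ x, ENNReal.ofReal ((∫ i, f (x i) ∂unifVertex n - a) ^ 2) ∂π ≤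
      ENNReal.ofReal (2 * (η + L * (1 - d) ^ k + |m - a|) ^ 2) +
        2 * ∫⁻ w, ENNReal.ofReal
          ((∫ i, f (g.opinion c d (fun _ => 0) w k i) ∂unifVertex n - m) ^ 2) ∂signalLaw ν g := by
  have := hπ.1
  have hd0 : 0 ≤ (1 - d) ^ k := pow_nonneg (by linarith) k
  have hav : Measurable fun x : Fin (n + 1) → ℝ => ∫ i, f (x i) ∂unifVertex n := by
    simp only [integral_unifVertex]
    exact (Finset.measurable_sum _ fun i _ => hf.comp (measurable_pi_apply i)).const_mul _
  have hφ : Measurable fun x : Fin (n + 1) → ℝ =>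
      ENNReal.ofReal ((∫ i, f (x i) ∂unifVertex n - a) ^ 2) :=
    ENNReal.measurable_ofReal.comp ((hav.sub_const a).pow_const 2)
  have hop : Measurable fun z : (Fin (n + 1) → ℝ) × (ℕ × Fin (n + 1) → ℝ) =>
      g.opinion c d z.1 z.2 k :=
    MarkedGraph.measurable_opinion c d measurable_const measurable_fst measurable_snd k
  conv_lhs => rw [← hπ.map_opinion k]
  rw [lintegral_map hφ hop]
  refine (lintegral_prod _ (hφ.comp hop).aemeasurable).trans_le ?_
  set T := ∫⁻ w, ENNReal.ofReal
    ((∫ i, f (g.opinion c d (fun _ => 0) w k i) ∂unifVertex n - m) ^ 2) ∂signalLaw ν g with hT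
  set e := η + L * (1 - d) ^ k + |m - a| with he
  calc _ ≤ ∫⁻ _, (ENNReal.ofReal (2 * e ^ 2) + 2 * T) ∂π := by
        refine lintegral_mono_ae ?_
        filter_upwards [hπ.ae_abs_le_one hg hc hd hcd] with x hx
        have hx1 : ‖x‖ ≤ 1 := (pi_norm_le_iff_of_nonneg zero_le_one).2 hx
        have hm2 : Measurable fun w : ℕ × Fin (n + 1) → ℝ => ENNReal.ofReal
            ((∫ i, f (g.opinion c d (fun _ => 0) w k i) ∂unifVertex n - m) ^ 2) :=
          ENNReal.measurable_ofReal.comp (((hav.comp (hop.comp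
            (measurable_const.prodMk measurable_id))).sub_const m).pow_const 2)
        calc _ ≤ ∫⁻ w, (ENNReal.ofReal (2 * e ^ 2) + 2 * ENNReal.ofReal
              ((∫ i, f (g.opinion c d (fun _ => 0) w k i) ∂unifVertex n - m) ^ 2))
                ∂signalLaw ν g := by
              refine lintegral_mono_ae ?_
              filter_upwards [ae_abs_opinion_sub_le hg hc hcd x k] with w hw
              rw [← ENNReal.ofReal_ofNat 2, ← ENNReal.ofReal_mul (by norm_num),
                ← ENNReal.ofReal_add (by positivity) (by positivity)]
              refine ENNReal.ofReal_le_ofReal ?_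
              have h1 : |∫ i, f (g.opinion c d x w k i) ∂unifVertex n -
                  ∫ i, f (g.opinion c d (fun _ => 0) w k i) ∂unifVertex n| ≤
                  η + L * (1 - d) ^ k := by
                rw [← integral_sub Integrable.of_finite Integrable.of_finite]
                have h2 := norm_integral_le_of_norm_le_const (μ := unifVertex n)
                  (f := fun i => f (g.opinion c d x w k i) -
                    f (g.opinion c d (fun _ => 0) w k i)) (C := η + L * (1 - d) ^ k)
                  (ae_of_all _ fun i => (hmod _ _).trans (add_le_add le_rfl
                    (mul_le_mul_of_nonneg_left ((hw.2 i).trans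
                      (mul_le_of_le_one_right hd0 hx1)) hL)))
                simpa using h2
              set a1 := ∫ i, f (g.opinion c d x w k i) ∂unifVertex n
              set a0 := ∫ i, f (g.opinion c d (fun _ => 0) w k i) ∂unifVertex n
              -- `a1 - a` is the sum of `a1 - a0 + (m - a)`, at most `e`, and of `a0 - m`
              have h3 : |a1 - a0 + (m - a)| ≤ e :=
                (abs_add_le _ _).trans (add_le_add h1 le_rfl)
              have h4 : (a1 - a0 + (m - a)) ^ 2 ≤ e ^ 2 := sq_le_sq' (abs_le.1 h3).1 (abs_le.1 h3).2
              have h5 : a1 - a = (a1 - a0 + (m - a)) + (a0 - m) := by ring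
              change (a1 - a) ^ 2 ≤ _
              rw [h5]
              nlinarith [add_sq_le (a := a1 - a0 + (m - a)) (b := a0 - m)]
          _ = ENNReal.ofReal (2 * e ^ 2) + 2 * T := by
              rw [lintegral_add_left measurable_const, lintegral_const_mul _ hm2]
              simp [hT]
    _ = _ := by simp

variable [MetricSpace A] {K : ℝ≥0} {Ω : ℕ → Type v}
  [∀ n, MeasurableSpace (Ω n)] {P : ∀ n, Measure (Ω n)} [∀ n, IsProbabilityMeasure (P n)]
  {G : ∀ n, Ω n → MarkedGraph (Fin (n + 1)) A} {H : Type w} [MeasurableSpace H] {Γ : Measure H}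
  [IsProbabilityMeasure Γ] {h : H → MarkedGraph ℕ A} {r : H → ℕ → ℝ}

/-- Convergence of averages over stationary opinions in mean square. -/
theorem CoupledOpinions.tendsto_sq_stationary
    (Y : CoupledOpinions ν K c d P G (fun _ _ _ => 0) Γ h r) (hd1 : d ≤ 1)
    {R : ∀ n, Ω n → Fin (n + 1) → ℝ} (hR : ∀ n, Measurable (R n))
    (hst : ∀ n, ∀ᵐ ω ∂(P n),
      IsStationaryLaw ν c d (G n ω) (condDistrib (R n) (G n) (P n) (G n ω)))
    {a : ℝ} {f : ℝ → ℝ} (hf : UniformContinuous f) {B : ℝ} (hB : ∀ x, |f x| ≤ B)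
    (ha : Tendsto (fun k => ∫ x, f x ∂rootLaw ν c d Γ Y.measurable_limit r k) atTop (𝓝 a)) :
    Tendsto (fun n => ∫⁻ ω, ENNReal.ofReal
      ((∫ i, f (R n ω i) ∂unifVertex n - a) ^ 2) ∂P n) atTop (𝓝 0) := by
  have hfm := hf.continuous.measurable
  rw [ENNReal.tendsto_nhds_zero]
  intro δ hδ
  obtain ⟨γ, hγ0, hγδ⟩ := ENNReal.lt_iff_exists_nnreal_btwn.1 hδ
  have hγ : 0 < (γ : ℝ) := by exact_mod_cast hγ0
  obtain ⟨η, hη0, hη1, hη2⟩ : ∃ η : ℝ, 0 < η ∧ η ≤ 1 ∧ 16 * η ≤ γ :=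
    ⟨min 1 (γ / 16), by positivity, min_le_left _ _, by
      linarith [min_le_right (1 : ℝ) (γ / 16)]⟩
  obtain ⟨L, hL0, hL⟩ := exists_modulus hB hf hη0
  have hlim : Tendsto (fun k => η + L * (1 - d) ^ k +
      |∫ x, f x ∂rootLaw ν c d Γ Y.measurable_limit r k - a|) atTop (𝓝 (η + L * 0 + |a - a|)) :=
    (tendsto_const_nhds.add ((tendsto_pow_atTop_nhds_zero_of_lt_one (by linarith)
      (by linarith [Y.d_pos])).const_mul L)).add (ha.sub_const a).abs
  -- a time `k` at which the error, apart from the fluctuations of the averages, is small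
  obtain ⟨k, hk⟩ := (hlim.eventually_lt_const (u := 2 * η) (by simp; linarith)).exists
  set m := ∫ x, f x ∂rootLaw ν c d Γ Y.measurable_limit r k with hm
  have he0 : 0 ≤ η + L * (1 - d) ^ k + |m - a| := by
    have : 0 ≤ (1 - d) ^ k := pow_nonneg (by linarith) k
    positivity
  filter_upwards [ENNReal.tendsto_nhds_zero.1 (Y.tendsto_sq_opinion k hf.continuous)
    (ENNReal.ofReal (γ / 4)) (ENNReal.ofReal_pos.2 (by positivity))] with n hn
  have hav : Measurable fun x : Fin (n + 1) → ℝ => ∫ i, f (x i) ∂unifVertex n := by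
    simp only [integral_unifVertex]
    exact (Finset.measurable_sum _ fun i _ => hfm.comp (measurable_pi_apply i)).const_mul _
  have hφ : Measurable fun x : Fin (n + 1) → ℝ =>
      ENNReal.ofReal ((∫ i, f (x i) ∂unifVertex n - a) ^ 2) :=
    ENNReal.measurable_ofReal.comp ((hav.sub_const a).pow_const 2)
  have hψ : Measurable fun z : Ω n × (ℕ × Fin (n + 1) → ℝ) => ENNReal.ofReal
      ((∫ i, f ((G n z.1).opinion c d (fun _ => 0) z.2 k i) ∂unifVertex n - m) ^ 2) :=
    ENNReal.measurable_ofReal.comp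
      (((hav.comp (Y.measurable_opinion n k)).sub_const m).pow_const 2)
  rw [lintegral_withSignals _ hψ] at hn
  calc _ = ∫⁻ ω, ∫⁻ x, ENNReal.ofReal ((∫ i, f (x i) ∂unifVertex n - a) ^ 2)
          ∂condDistrib (R n) (G n) (P n) (G n ω) ∂P n :=
        lintegral_comp_eq_condDistrib (Y.measurable_graph n) (hR n) hφ
    _ ≤ ∫⁻ ω, (ENNReal.ofReal (2 * (η + L * (1 - d) ^ k + |m - a|) ^ 2) +
          2 * ∫⁻ w, ENNReal.ofReal ((∫ i, f ((G n ω).opinion c d (fun _ => 0) w k i)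
            ∂unifVertex n - m) ^ 2) ∂signalLaw ν (G n ω)) ∂P n := by
        refine lintegral_mono_ae ?_
        filter_upwards [hst n, Y.admissible n] with ω h1 h2
        exact h1.lintegral_average_le h2 Y.c_nonneg Y.d_pos hd1 Y.add_le hfm hL0 hL k a m
    _ = ENNReal.ofReal (2 * (η + L * (1 - d) ^ k + |m - a|) ^ 2) +
          2 * ∫⁻ ω, ∫⁻ w, ENNReal.ofReal ((∫ i, f ((G n ω).opinion c d (fun _ => 0) w k i)
            ∂unifVertex n - m) ^ 2) ∂signalLaw ν (G n ω) ∂P n := by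
        rw [lintegral_add_left measurable_const, lintegral_const_mul' _ _ (by simp)]
        simp
    _ ≤ ENNReal.ofReal (γ / 2) + 2 * ENNReal.ofReal (γ / 4) := by
        refine add_le_add (ENNReal.ofReal_le_ofReal ?_) (mul_le_mul_right hn 2)
        nlinarith
    _ = γ := by
        rw [← ENNReal.ofReal_ofNat 2, ← ENNReal.ofReal_mul (by norm_num),
          ← ENNReal.ofReal_add (by positivity) (by positivity)]
        rw [show (γ : ℝ) / 2 + 2 * (γ / 4) = γ by ring, ENNReal.ofReal_coe_nnreal]
    _ ≤ δ := hγδ.le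

end Stationary

/-! ### Limit couplings and averages -/

section Transfer

/-- Independence of everything on the original space implies independence of the attributes. -/
theorem isLimitCoupling_of_map_eq {Ω : Type v} [MeasurableSpace Ω] {F : Type u}
    [MeasurableSpace F] {E : Type w} [MeasurableSpace E] {n : ℕ} {P : Measure Ω} [SFinite P]
    {Y : Ω → F} (hY : Measurable Y) {Λ : Measure E} [SFinite Λ]
    {Q : Measure (Ω × (Fin (n + 1) × E))}
    (h1 : Q.map (fun z => (z.1, z.2.1)) = P.prod (unifVertex n))
    (h2 : Q.map (fun z => (z.1, z.2.2)) = P.prod Λ) : IsLimitCoupling P Y Λ Q := by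
  refine ⟨h1, ?_⟩
  have h3 : (P.map Y).prod Λ = (P.prod Λ).map (Prod.map Y id) := by
    rw [← Measure.map_prod_map P Λ hY measurable_id, Measure.map_id]
  rw [h3, ← h2, Measure.map_map (hY.prodMap measurable_id) (by fun_prop)]
  rfl

theorem aestronglyMeasurable_of_continuousOn {μ : Measure ℝ} (hμ : ∀ᵐ x ∂μ, |x| ≤ 1) {f : ℝ → ℝ}
    (hf : ContinuousOn f (Set.Icc (-1) 1)) : AEStronglyMeasurable f μ := by
  obtain ⟨f', B, hu, -, he⟩ := exists_extension_real hf
  exact hu.continuous.aestronglyMeasurable.congr (hμ.mono fun x hx => he x hx)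

variable {Ω : ℕ → Type v} [∀ n, MeasurableSpace (Ω n)] {P : ∀ n, Measure (Ω n)}
  {X : ∀ n, Ω n → Fin (n + 1) → ℝ} {Λ : Measure ℝ}

/-- For opinions in `[-1, 1]`, convergence of averages extends from bounded uniformly continuous
test functions to all functions which are continuous on `[-1, 1]`. -/
theorem tendsto_sq_of_continuousOn (hX1 : ∀ n, ∀ᵐ ω ∂P n, ∀ i, |X n ω i| ≤ 1)
    (hΛ : ∀ᵐ x ∂Λ, |x| ≤ 1)
    (hemp : ∀ (f : ℝ → ℝ) (B : ℝ), UniformContinuous f → (∀ x, |f x| ≤ B) →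
      Tendsto (fun n => ∫⁻ ω, ENNReal.ofReal
        ((∫ i, f (X n ω i) ∂unifVertex n - ∫ x, f x ∂Λ) ^ 2) ∂P n) atTop (𝓝 0))
    {f : ℝ → ℝ} (hf : ContinuousOn f (Set.Icc (-1) 1)) :
    Tendsto (fun n => ∫⁻ ω, ENNReal.ofReal
      ((∫ i, f (X n ω i) ∂unifVertex n - ∫ x, f x ∂Λ) ^ 2) ∂P n) atTop (𝓝 0) := by
  obtain ⟨f', B, hu, hB, he⟩ := exists_extension_real hf
  have h1 := hemp f' B hu hB
  rw [integral_congr_ae (hΛ.mono fun x hx => he x hx)] at h1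
  refine h1.congr fun n => lintegral_congr_ae ?_
  filter_upwards [hX1 n] with ω hω
  simp only [he _ (hω _)]

theorem tendstoInProb_average [∀ n, IsProbabilityMeasure (P n)] (hX : ∀ n, Measurable (X n))
    (hX1 : ∀ n, ∀ᵐ ω ∂P n, ∀ i, |X n ω i| ≤ 1) (hΛ : ∀ᵐ x ∂Λ, |x| ≤ 1)
    (hemp : ∀ (f : ℝ → ℝ) (B : ℝ), UniformContinuous f → (∀ x, |f x| ≤ B) →
      Tendsto (fun n => ∫⁻ ω, ENNReal.ofReal
        ((∫ i, f (X n ω i) ∂unifVertex n - ∫ x, f x ∂Λ) ^ 2) ∂P n) atTop (𝓝 0))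
    {f : ℝ → ℝ} (hf : ContinuousOn f (Set.Icc (-1) 1)) :
    TendstoInProb P (fun n ω => 1 / ((n : ℝ) + 1) * ∑ i, f (X n ω i)) (∫ x, f x ∂Λ) := by
  have h1 := tendsto_lintegral_abs_of_sq (tendsto_sq_of_continuousOn hX1 hΛ hemp hf)
  simp only [integral_unifVertex] at h1
  refine tendstoInProb_of_lintegral (fun n => ?_) h1
  obtain ⟨f', B, hu, -, he⟩ := exists_extension_real hf
  have h2 : Measurable fun ω => 1 / ((n : ℝ) + 1) * ∑ i, f' (X n ω i) :=
    (Finset.measurable_sum _ fun i _ =>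
      hu.continuous.measurable.comp ((measurable_pi_apply i).comp (hX n))).const_mul _
  refine h2.aemeasurable.congr ?_
  filter_upwards [hX1 n] with ω hω
  simp only [he _ (hω _)]

end Transfer

section FiniteGraphs

variable {A : Type u} [MetricSpace A] [MeasurableSpace A]
  {ν : Kernel (Mark A) ℝ} [IsMarkovKernel ν] {K : ℝ≥0} {c d : ℝ} {Ω : ℕ → Type v}
  [∀ n, MeasurableSpace (Ω n)] {P : ∀ n, Measure (Ω n)} [∀ n, IsProbabilityMeasure (P n)]
  {G : ∀ n, Ω n → MarkedGraph (Fin (n + 1)) A}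
  {R0 : ∀ n, Ω n → Fin (n + 1) → ℝ} {H : Type w} [MeasurableSpace H] {Γ : Measure H}
  {h : H → MarkedGraph ℕ A} {r : H → ℕ → ℝ}
  {W : ∀ n, Ω n → ℕ × Fin (n + 1) → ℝ}

namespace CoupledOpinions

/-- Opinion processes on the finite graphs have the same law whatever space carries the signals. -/
theorem lintegral_process (X : CoupledOpinions ν K c d P G R0 Γ h r)
    {n : ℕ} (hO : IsOpinionProcess ν (P n) (G n) (R0 n) (W n)) {k : ℕ}
    {φ : (Fin (n + 1) → Fin (k + 1) → ℝ) → ℝ≥0∞} (hφ : Measurable φ) :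
    ∫⁻ ω, φ ((G n ω).opinionPath c d (R0 n ω) (W n ω) k) ∂P n =
      ∫⁻ z, φ ((G n z.1).opinionPath c d (R0 n z.1) z.2 k)
        ∂withSignals ν (P n) (G n) (X.measurable_graph n) := by
  have h1 : Measurable fun y : MarkedGraph (Fin (n + 1)) A × (Fin (n + 1) → ℝ) ×
      (ℕ × Fin (n + 1) → ℝ) => φ (y.1.opinionPath c d y.2.1 y.2.2 k) :=
    hφ.comp (measurable_pi_lambda _ fun i => MarkedGraph.measurable_opinionPath c d measurable_fst
      (measurable_fst.comp measurable_snd) (measurable_snd.comp measurable_snd) k measurable_const)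
  have h2 : Measurable fun ω => (G n ω, R0 n ω, W n ω) :=
    hO.measurable_graph.prodMk (hO.measurable_initial.prodMk hO.measurable_signal)
  have h3 : Measurable fun z : Ω n × (ℕ × Fin (n + 1) → ℝ) => (G n z.1, R0 n z.1, z.2) :=
    ((X.measurable_graph n).comp measurable_fst).prodMk
      (((X.measurable_initial n).comp measurable_fst).prodMk measurable_snd)
  have h4 := congrArg (fun μ => ∫⁻ y, φ (y.1.opinionPath c d y.2.1 y.2.2 k) ∂μ)
    (hO.map_eq (X.measurable_graph n))
  simp only [lintegral_map h1 h2, lintegral_map h1 h3] at h4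
  exact h4

theorem measurable_process (X : CoupledOpinions ν K c d P G R0 Γ h r) {n : ℕ}
    (hO : IsOpinionProcess ν (P n) (G n) (R0 n) (W n)) (k : ℕ) :
    Measurable fun ω => (G n ω).opinionPath c d (R0 n ω) (W n ω) k :=
  measurable_pi_lambda _ fun _ => MarkedGraph.measurable_opinionPath c d (X.measurable_graph n)
    (X.measurable_initial n) hO.measurable_signal k measurable_const

theorem ae_process_mem (X : CoupledOpinions ν K c d P G R0 Γ h r) {n : ℕ}
    (hO : IsOpinionProcess ν (P n) (G n) (R0 n) (W n)) (k : ℕ) :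
    ∀ᵐ ω ∂P n, ∀ i, (G n ω).opinionPath c d (R0 n ω) (W n ω) k i ∈ Metric.closedBall 0 1 := by
  let s : Set (Fin (n + 1) → Fin (k + 1) → ℝ) := {x | ∀ i, x i ∈ Metric.closedBall 0 1}
  have hs : MeasurableSet s := by
    simp only [s, Set.ofPred_forall]
    exact MeasurableSet.iInter fun i =>
      measurable_pi_apply i Metric.isClosed_closedBall.measurableSet
  have hφ : Measurable (sᶜ.indicator (1 : (Fin (n + 1) → Fin (k + 1) → ℝ) → ℝ≥0∞)) :=
    measurable_one.indicator hs.compl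
  have h1 := X.lintegral_process hO hφ
  have h2 : ∫⁻ z, sᶜ.indicator 1 ((G n z.1).opinionPath c d (R0 n z.1) z.2 k)
      ∂withSignals ν (P n) (G n) (X.measurable_graph n) = ∫⁻ _, 0
        ∂withSignals ν (P n) (G n) (X.measurable_graph n) := by
    refine lintegral_congr_ae ?_
    filter_upwards [X.ae_opinionPath_mem n k] with z hz
    exact Set.indicator_of_notMem (s := sᶜ) (Set.notMem_compl_iff.2 hz) _
  rw [h2, lintegral_zero] at h1
  filter_upwards [(lintegral_eq_zero_iff (hφ.comp (X.measurable_process hO k))).1 h1] with ω hω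
  by_contra hn
  simp [Set.indicator_of_mem
    (show (G n ω).opinionPath c d (R0 n ω) (W n ω) k ∈ sᶜ from hn)] at hω

variable [IsProbabilityMeasure Γ]

theorem tendsto_sq_process (X : CoupledOpinions ν K c d P G R0 Γ h r)
    (hO : ∀ n, IsOpinionProcess ν (P n) (G n) (R0 n) (W n)) {k : ℕ}
    {f : (Fin (k + 1) → ℝ) → ℝ} (hf : Continuous f) :
    Tendsto (fun n => ∫⁻ ω, ENNReal.ofReal
      ((∫ i, f ((G n ω).opinionPath c d (R0 n ω) (W n ω) k i) ∂unifVertex n -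
        ∫ x, f x ∂pathLaw ν c d Γ X.measurable_limit r k) ^ 2) ∂P n) atTop (𝓝 0) := by
  refine (X.tendsto_sq hf).congr fun n => ?_
  refine (X.lintegral_process (hO n) (φ := fun x => ENNReal.ofReal
    ((∫ i, f (x i) ∂unifVertex n - ∫ x, f x ∂pathLaw ν c d Γ X.measurable_limit r k) ^ 2)) ?_).symm
  simp only [integral_unifVertex]
  exact ENNReal.measurable_ofReal.comp ((((Finset.measurable_sum _ fun i _ =>
    hf.measurable.comp (measurable_pi_apply i)).const_mul _).sub_const _).pow_const 2)

/-- The opinions of a uniform vertex up to time `k` can be coupled with those of the root of the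
limit graph. -/
theorem exists_isLimitCoupling (X : CoupledOpinions ν K c d P G R0 Γ h r)
    (hO : ∀ n, IsOpinionProcess ν (P n) (G n) (R0 n) (W n)) {F : ℕ → Type u}
    [∀ n, MeasurableSpace (F n)] {Y : ∀ n, Ω n → F n} (hY : ∀ n, Measurable (Y n)) (k : ℕ) :
    ∃ Q : ∀ n, Measure (Ω n × (Fin (n + 1) × (Fin (k + 1) → ℝ))),
      (∀ n, IsLimitCoupling (P n) (Y n) (pathLaw ν c d Γ X.measurable_limit r k) (Q n)) ∧
      TendstoInProb Q (fun n z => ⨆ t : Fin (k + 1),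
        ((Q n)[fun z' => |(G n z'.1).opinion c d (R0 n z'.1) (W n z'.1) t z'.2.1 - z'.2.2 t| |
          sigma (Y n)]) z) 0 := by
  have := isProbabilityMeasure_pathLaw (ν := ν) (c := c) (d := d) (Γ := Γ) X.measurable_limit
    X.measurable_limitInitial k
  obtain ⟨Q, h1, h2, h3⟩ := exists_limit_coupling (P := P) (fun n => X.measurable_process (hO n) k)
    (isCompact_closedBall 0 1) (fun n => X.ae_process_mem (hO n) k) (X.ae_pathLaw_mem k)
    fun f hf => X.tendsto_sq_process hO hf
  refine ⟨Q, fun n => isLimitCoupling_of_map_eq (hY n) (h1 n) (h2 n),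
    TendstoInProb.iSup fun t => tendstoInProb_condExp ?_⟩
  refine tendsto_of_tendsto_of_tendsto_of_le_of_le tendsto_const_nhds h3 (fun _ => zero_le)
    fun n => lintegral_mono fun z => ENNReal.ofReal_le_ofReal ?_
  rw [abs_abs]
  exact dist_le_pi_dist ((G n z.1).opinionPath c d (R0 n z.1) (W n z.1) k z.2.1) z.2.2 t

theorem tendstoInProb_process (X : CoupledOpinions ν K c d P G R0 Γ h r)
    (hO : ∀ n, IsOpinionProcess ν (P n) (G n) (R0 n) (W n)) (k : ℕ) {f : ℝ → ℝ}
    (hf : ContinuousOn f (Set.Icc (-1) 1)) :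
    TendstoInProb P (fun n ω => 1 / ((n : ℝ) + 1) *
      ∑ i, f ((G n ω).opinion c d (R0 n ω) (W n ω) k i))
        (∫ x, f x ∂rootLaw ν c d Γ X.measurable_limit r k) := by
  refine tendstoInProb_average (X := fun n ω => (G n ω).opinion c d (R0 n ω) (W n ω) k)
    (fun n => ?_) (fun n => ?_) (X.ae_rootLaw_le k) (fun f' B hu _ => ?_) hf
  · exact MarkedGraph.measurable_opinion c d (X.measurable_graph n) (X.measurable_initial n)
      (hO n).measurable_signal k
  · filter_upwards [X.ae_process_mem (hO n) k] with ω hω i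
    exact (norm_le_pi_norm ((G n ω).opinionPath c d (R0 n ω) (W n ω) k i) (Fin.last k)).trans
      (mem_closedBall_zero_iff.1 (hω i))
  · rw [integral_rootLaw _ hu.continuous.measurable]
    exact X.tendsto_sq_process hO (f := fun x => f' (x (Fin.last k)))
      (hu.continuous.comp (continuous_apply _))

/-- The opinion of a uniform vertex in the stationary regime can be coupled with a sample of the
limit law. -/
theorem exists_isLimitCoupling_stationary
    (X : CoupledOpinions ν K c d P G (fun _ _ _ => 0) Γ h r) (hd1 : d ≤ 1)
    {R : ∀ n, Ω n → Fin (n + 1) → ℝ} (hR : ∀ n, Measurable (R n))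
    (hst : ∀ n, ∀ᵐ ω ∂(P n),
      IsStationaryLaw ν c d (G n ω) (condDistrib (R n) (G n) (P n) (G n ω)))
    {μ : Measure ℝ} [IsProbabilityMeasure μ] (hμ1 : ∀ᵐ x ∂μ, |x| ≤ 1)
    (hμ : ∀ (f : ℝ → ℝ) (B : ℝ), UniformContinuous f → (∀ x, |f x| ≤ B) →
      Tendsto (fun k => ∫ x, f x ∂rootLaw ν c d Γ X.measurable_limit r k) atTop
        (𝓝 (∫ x, f x ∂μ)))
    {F : ℕ → Type u} [∀ n, MeasurableSpace (F n)] {Y : ∀ n, Ω n → F n}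
    (hY : ∀ n, Measurable (Y n)) :
    (∃ Q : ∀ n, Measure (Ω n × (Fin (n + 1) × ℝ)),
      (∀ n, IsLimitCoupling (P n) (Y n) μ (Q n)) ∧
      TendstoInProb Q (fun n => (Q n)[fun z => |R n z.1 z.2.1 - z.2.2| | sigma (Y n)]) 0) ∧
    ∀ f : ℝ → ℝ, ContinuousOn f (Set.Icc (-1) 1) →
      TendstoInProb P (fun n ω => 1 / ((n : ℝ) + 1) * ∑ i, f (R n ω i)) (∫ x, f x ∂μ) := by
  have hR1 : ∀ n, ∀ᵐ ω ∂P n, ∀ i, |R n ω i| ≤ 1 := fun n =>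
    ae_abs_le_one_of_isStationaryLaw (X.measurable_graph n) (hR n) (X.admissible n) (hst n)
      X.c_nonneg X.d_pos X.add_le
  have hemp : ∀ (f : ℝ → ℝ) (B : ℝ), UniformContinuous f → (∀ x, |f x| ≤ B) →
      Tendsto (fun n => ∫⁻ ω, ENNReal.ofReal
        ((∫ i, f (R n ω i) ∂unifVertex n - ∫ x, f x ∂μ) ^ 2) ∂P n) atTop (𝓝 0) :=
    fun f B hu hB => X.tendsto_sq_stationary hd1 hR hst hu hB (hμ f B hu hB)
  refine ⟨?_, fun f hf => tendstoInProb_average hR hR1 hμ1 hemp hf⟩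
  obtain ⟨Q, h1, h2, h3⟩ := exists_limit_coupling hR (isCompact_Icc (a := (-1 : ℝ)) (b := 1))
    (fun n => (hR1 n).mono fun ω hω i => abs_le.1 (hω i)) (hμ1.mono fun x hx => abs_le.1 hx)
    fun f hf => tendsto_sq_of_continuousOn hR1 hμ1 hemp hf.continuousOn
  refine ⟨Q, fun n => isLimitCoupling_of_map_eq (hY n) (h1 n) (h2 n), tendstoInProb_condExp ?_⟩
  simpa only [abs_abs, Real.dist_eq] using h3

end CoupledOpinions

end FiniteGraphs

end OpinionDynamics

open OpinionDynamics

theorem mainTheorem1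
    -- the attribute space, a Polish space with metric `dist`
    {A : Type u} [MetricSpace A] [PolishSpace A] [MeasurableSpace A] [BorelSpace A]
    -- the parameters of the model
    (c d : ℝ) (hc0 : 0 ≤ c) (hc1 : c < 1) (hd0 : 0 < d) (hd1 : d ≤ 1) (hcd : c + d ≤ 1)
    -- the laws of the signals, Lipschitz in the marks
    (ν : Kernel (Mark A) ℝ) [IsMarkovKernel ν] (K : ℝ≥0)
    (hLip : ∀ x y : Mark A, wasserstein1 (ν x) (ν y) ≤ ENNReal.ofReal (K * Mark.rho x y))
    -- the random marked graphs
    {Ω : ℕ → Type v} [∀ n, MeasurableSpace (Ω n)] (P : ∀ n, Measure (Ω n))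
    [∀ n, IsProbabilityMeasure (P n)] (G : ∀ n, Ω n → MarkedGraph (Fin (n + 1)) A)
    (hG : ∀ n, Measurable (G n))
    (hweight : ∀ n, ∀ᵐ ω ∂(P n), ∀ i, 0 < ((G n ω).mark i).deg → ((G n ω).mark i).totalWeight = c)
    (hbound : ∀ n, ∀ᵐ ω ∂(P n), ∀ i,
      ∀ᵐ t ∂(ν ((G n ω).mark i)), |t| ≤ d + c - ((G n ω).mark i).totalWeight)
    -- the law of the limit graph, and the strong coupling
    (Γ : Measure (MarkedGraph ℕ A)) [IsProbabilityMeasure Γ]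
    (hcoupling : StrongCoupling P (fun n ω => (G n ω).attributes) G Γ) :
    -- the law of the limit of the stationary opinion, and the constant in the geometric rate
    ∃ (μstar : Measure ℝ) (C : ℝ), IsProbabilityMeasure μstar ∧ μstar (Set.Icc (-1) 1)ᶜ = 0 ∧
      -- Part 1: the opinions at finite times
      (∀ (R0 : ∀ n, Ω n → Fin (n + 1) → ℝ) (W : ∀ n, Ω n → ℕ × Fin (n + 1) → ℝ)
        (Γ0 : Measure (MarkedGraph ℕ (A × ℝ))) [IsProbabilityMeasure Γ0],
        (∀ n, IsOpinionProcess ν (P n) (G n) (R0 n) (W n)) →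
        (∀ n, ∀ᵐ ω ∂(P n), ∀ i, R0 n ω i ∈ Set.Icc (-1 : ℝ) 1) →
        StrongCoupling P (fun n ω => (G n ω).attributes)
          (fun n ω => (G n ω).withInitial (R0 n ω)) Γ0 →
        ∃ (Ω' : Type u) (_ : MeasurableSpace Ω') (P' : Measure Ω') (_ : IsProbabilityMeasure P')
          (G' : Ω' → MarkedGraph ℕ A) (R0' : Ω' → ℕ → ℝ) (W' : Ω' → ℕ × ℕ → ℝ)
          (R' : ℕ → Ω' → ℝ),
          -- `R' r` is the opinion of the root at time `r` on the limit graph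
          IsOpinionProcess ν P' G' R0' W' ∧
          P'.map (fun ω => (G' ω).withInitial (R0' ω)) = Γ0 ∧
          (∀ r ω, R' r ω = (G' ω).opinion c d (R0' ω) (W' ω) r 0) ∧
          (∀ r, ∀ᵐ ω ∂P', R' r ω ∈ Set.Icc (-1 : ℝ) 1) ∧
          (∀ k : ℕ, ∃ Q : ∀ n, Measure (Ω n × (Fin (n + 1) × (Fin (k + 1) → ℝ))),
            (∀ n, IsLimitCoupling (P n) (fun ω => (G n ω).attributes)
              (P'.map (fun ω (r : Fin (k + 1)) => R' r ω)) (Q n)) ∧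
            TendstoInProb Q (fun n z => ⨆ r : Fin (k + 1),
              ((Q n)[fun z' => |(G n z'.1).opinion c d (R0 n z'.1) (W n z'.1) r z'.2.1 - z'.2.2 r| |
                sigma (fun ω => (G n ω).attributes)]) z) 0) ∧
          (∀ (k : ℕ) (f : ℝ → ℝ), ContinuousOn f (Set.Icc (-1) 1) →
            TendstoInProb P (fun n ω => (1 / ((n : ℝ) + 1)) *
              ∑ i, f ((G n ω).opinion c d (R0 n ω) (W n ω) k i)) (∫ ω, f (R' k ω) ∂P')) ∧
          -- weak convergence to the limit of the stationary opinion, at a geometric rate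
          (∀ f : ℝ → ℝ, ContinuousOn f (Set.Icc (-1) 1) →
            Tendsto (fun k => ∫ ω, f (R' k ω) ∂P') atTop (𝓝 (∫ x, f x ∂μstar))) ∧
          (∀ k, wasserstein1 (P'.map (R' k)) μstar ≤ ENNReal.ofReal (C * (1 - d) ^ k))) ∧
      -- Part 2: the stationary opinions
      (∀ R : ∀ n, Ω n → Fin (n + 1) → ℝ, (∀ n, Measurable (R n)) →
        (∀ n, ∀ᵐ ω ∂(P n), IsStationaryLaw ν c d (G n ω) (condDistrib (R n) (G n) (P n) (G n ω))) →
        (∃ Q : ∀ n, Measure (Ω n × (Fin (n + 1) × ℝ)),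
          (∀ n, IsLimitCoupling (P n) (fun ω => (G n ω).attributes) μstar (Q n)) ∧
          TendstoInProb Q (fun n =>
            (Q n)[fun z => |R n z.1 z.2.1 - z.2.2| | sigma (fun ω => (G n ω).attributes)]) 0) ∧
        (∀ f : ℝ → ℝ, ContinuousOn f (Set.Icc (-1) 1) →
          TendstoInProb P (fun n ω => (1 / ((n : ℝ) + 1)) * ∑ i, f (R n ω i))
            (∫ x, f x ∂μstar))) := by
  have hadm : ∀ n, ∀ᵐ ω ∂(P n), Admissible ν c d (G n ω) := fun n => by
    filter_upwards [hweight n, hbound n] with ω h1 h2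
    exact ⟨h1, h2⟩
  have hY : CoupledOpinions ν K c d P G (fun _ _ _ => 0) Γ id (fun _ _ => 0) :=
    { lipschitz := hLip
      c_nonneg := hc0
      d_pos := hd0
      add_le := hcd
      measurable_graph := hG
      measurable_initial := fun _ => measurable_const
      measurable_limit := measurable_id
      measurable_limitInitial := measurable_const
      admissible := hadm
      initial_le := fun _ => ae_of_all _ fun _ _ => by simp
      pairCoupling := hcoupling.pairCoupling_zero }
  -- the limit law is a limit point of the laws at the root, started from opinions that vanish
  have hprobY := isProbabilityMeasure_rootLaw (ν := ν) (c := c) (d := d) (Γ := Γ)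
    hY.measurable_limit hY.measurable_limitInitial
  have hU : (Ultrafilter.of (atTop : Filter ℕ) : Filter ℕ) ≤ atTop := Ultrafilter.of_le _
  obtain ⟨μ, hμ, hμ1, hμlim⟩ := exists_tendsto_of_isCompact (Ultrafilter.of (atTop : Filter ℕ))
    (τ := rootLaw ν c d Γ hY.measurable_limit (fun _ _ => 0))
    (isCompact_Icc (a := (-1 : ℝ)) (b := 1))
    (.of_forall fun k => (hY.ae_rootLaw_le k).mono fun x hx => abs_le.1 hx)
  have hμ2 : ∀ᵐ x ∂μ, |x| ≤ 1 := hμ1.mono fun x hx => abs_le.2 hx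
  have hAttr : ∀ n, Measurable fun ω => (G n ω).attributes := fun n =>
    MarkedGraph.measurable_attributes.comp (hG n)
  refine ⟨μ, 2, hμ, hμ1, ?_, ?_⟩
  · intro R0 W Γ0 _ hO hR0 hcoupling0
    have hX : CoupledOpinions ν K c d P G R0 Γ0 MarkedGraph.dropInitial MarkedGraph.initial :=
      { lipschitz := hLip
        c_nonneg := hc0
        d_pos := hd0
        add_le := hcd
        measurable_graph := hG
        measurable_initial := fun n => (hO n).measurable_initial
        measurable_limit := MarkedGraph.measurable_dropInitial
        measurable_limitInitial := MarkedGraph.measurable_initial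
        admissible := hadm
        initial_le := fun n => (hR0 n).mono fun ω hω i => abs_le.2 (hω i)
        pairCoupling := hcoupling0.pairCoupling_initial }
    have hprobX := isProbabilityMeasure_rootLaw (ν := ν) (c := c) (d := d) (Γ := Γ0)
      hX.measurable_limit hX.measurable_limitInitial
    have hπ := hX.exists_coupling_limit hY hU hμlim
    have hpath : ∀ k, Measurable fun z : MarkedGraph ℕ (A × ℝ) × (ℕ × ℕ → ℝ) =>
        z.1.dropInitial.opinion c d z.1.initial z.2 k := fun k =>
      MarkedGraph.measurable_opinion c d (hX.measurable_limit.comp measurable_fst)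
        (hX.measurable_limitInitial.comp measurable_fst) measurable_snd k
    have hroot : ∀ k, Measurable fun z : MarkedGraph ℕ (A × ℝ) × (ℕ × ℕ → ℝ) =>
        z.1.dropInitial.opinion c d z.1.initial z.2 k 0 := fun k =>
      (measurable_pi_apply 0).comp (hpath k)
    have hmap : ∀ k, (withSignals ν Γ0 MarkedGraph.dropInitial hX.measurable_limit).map
        (fun z => z.1.dropInitial.opinion c d z.1.initial z.2 k 0) =
          rootLaw ν c d Γ0 hX.measurable_limit MarkedGraph.initial k := fun k =>
      (rootLaw_eq_map hX.measurable_limit hX.measurable_limitInitial k).symm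
    have hint : ∀ (k : ℕ) (f : ℝ → ℝ), ContinuousOn f (Set.Icc (-1) 1) →
        ∫ z, f (z.1.dropInitial.opinion c d z.1.initial z.2 k 0)
          ∂withSignals ν Γ0 MarkedGraph.dropInitial hX.measurable_limit =
        ∫ x, f x ∂rootLaw ν c d Γ0 hX.measurable_limit MarkedGraph.initial k := fun k f hf => by
      have hfm := aestronglyMeasurable_of_continuousOn (hX.ae_rootLaw_le k) hf
      rw [← hmap k] at hfm ⊢
      exact (integral_map (hroot k).aemeasurable hfm).symm
    -- the limit process lives on the canonical space of the limit graph, extended by signals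
    refine ⟨MarkedGraph ℕ (A × ℝ) × (ℕ × ℕ → ℝ), inferInstance,
      withSignals ν Γ0 MarkedGraph.dropInitial hX.measurable_limit, inferInstance,
      fun z => z.1.dropInitial, fun z => z.1.initial, Prod.snd,
      fun k z => z.1.dropInitial.opinion c d z.1.initial z.2 k 0,
      isOpinionProcess_withSignals _ hX.measurable_limitInitial, map_fst_withSignals _,
      fun _ _ => rfl, fun k => ?_, fun k => ?_, fun k f hf => ?_, fun f hf => ?_, fun k => ?_⟩
    · have h1 := hX.ae_rootLaw_le k
      rw [← hmap k] at h1
      exact (ae_of_ae_map (hroot k).aemeasurable h1).mono fun z hz => abs_le.1 hz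
    · exact hX.exists_isLimitCoupling hO hAttr k
    · rw [hint k f hf]
      exact hX.tendstoInProb_process hO k hf
    · simp only [hint _ f hf]
      obtain ⟨f', B, hu, hB, he⟩ := exists_extension_real hf
      have h1 := tendsto_integral_of_coupling hd0 hd1 hπ hu hB
      rw [integral_congr_ae (hμ2.mono fun x hx => he x hx)] at h1
      exact h1.congr fun k => integral_congr_ae ((hX.ae_rootLaw_le k).mono fun x hx => he x hx)
    · obtain ⟨π, h1, h2, h3⟩ := hπ k
      have : IsProbabilityMeasure π := by
        have : IsProbabilityMeasure (π.map Prod.snd) := by rw [h2]; exact hμ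
        exact Measure.isProbabilityMeasure_of_map Prod.snd
      rw [hmap k, mul_comm]
      exact wasserstein1_le_of_ae h1 h2 h3
  · intro R hR hst
    exact hY.exists_isLimitCoupling_stationary hd1 hR hst hμ2
      (fun f B hu hB => tendsto_integral_of_coupling hd0 hd1
        (hY.exists_coupling_limit hY hU hμlim) hu hB) hAttr
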